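/- **Definitions.** For a real matrix $A\in\mathbb R^{m\times n}$ let $\mathrm{nnz}(A)$ be its number of non-zero entries, $\|\cdot\|_{\max}$ the largest and $\min_+(\cdot)$ the smallest non-zero absolute value of an entry of a matrix or vector ($1/\min_+(0)$ is read as $0$), $\Pi_A$ the orthogonal projection onto $\mathrm{im}(A)$, and, for $A\ne0$, $\kappa(A)=\sigma_{\max}(A)/\sigma_{\min}(A)$, where $\sigma_{\max}(A)=\max_{x\ne0}\|Ax\|_2/\|x\|_2$ and $\sigma_{\min}(A)=\min_{0\neq x\perp\ker A}\|Ax\|_2/\|x\|_2$. A *linear system approximation (LSA) instance* is a triple $(A,c,\epsilon)$ with $0\ne A\in\mathbb R^{m\times n}$, $\mathrm{nnz}(A)\ge\max(m,n)$, $c\in\mathbb R^m$ and $0<\epsilon\le1$; a *solution* is an $x\in\mathbb R^n$ with $\|Ax-\Pi_Ac\|_2\le\epsilon\|\Pi_Ac\|_2$. Its *sparse parameter complexity* is $$\mathcal S(A,c,\epsilon)=\Bigl(\mathrm{nnz}(A),\ \max\bigl(\|A\|_{\max},\|c\|_{\max},\tfrac1{\min_+(A)},\tfrac1{\min_+(c)}\bigr),\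 \kappa(A),\ \epsilon^{-1}\Bigr).$$ Let $f:[1,\infty)^4\to[0,\infty)^4$ be non-decreasing. A class $\mathcal M_1$ of matrices is *efficiently $f$-reducible* to a class $\mathcal M_2$, written $\mathcal M_1\le_f\mathcal M_2$, if there are two algorithms $\mathcal A_{1\to2}$ and $\mathcal A_{1\leftarrow2}$ such that for every LSA instance $(M^1,c^1,\epsilon_1)$ with $M^1\in\mathcal M_1$: the call $\mathcal A_{1\to2}(M^1,c^1,\epsilon_1)$ returns an LSA instance $(M^2,c^2,\epsilon_2)$ with $M^2\in\mathcal M_2$; for every solution $x^2$ of $(M^2,c^2,\epsilon_2)$ the vector $\mathcal A_{1\leftarrow2}(M^1,M^2,x^2)$ is a solution of $(M^1,c^1,\epsilon_1)$; coordinatewise $\mathcal S(M^2,c^2,\epsilon_2)\le f(\mathcal S(M^1,c^1,\epsilon_1))$; and both calls take time $O(\mathrm{nnz}(M^1))$. (Algorithms run on a real random access machine: arithmetic operations, square roots and comparisons of real numbers, and index arithmetic and array accesses, cost one step each; matrices are stored as lists of their non-zero entries in row-major order.) $\mathcal G_{z,2}$ is the class of integer matrices with at least one non-zero entry in every row and every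 column, in which every row has sum zero and in every row the sum of the positive entries is a power of $2$. $\mathcal T_2$ is the class of 2D truss incidence matrices: given a graph whose vertices are distinct points $s^1,\dots,s^N\in\mathbb R^2$, and a real weight $w_e$ for each edge $e$, the matrix has $2N$ columns, in pairs $x^1,\dots,x^N\in\mathbb R^2$ of variables, and one row for each edge $e=\{i,j\}$, namely the linear form $w_e\,(s^i-s^j)^\top(x^i-x^j)$. **Lemma.** There is a constant $C>0$ such that, with $$f(s,U,K,\epsilon^{-1})=\Bigl(C\,s\log(sU),\ C\,s^{3/2}U\log^{1/2}(sU),\ C\,K s^4U^2\log^2(sU),\ C\,sU^2\epsilon^{-1}\Bigr),$$ we have $\mathcal G_{z,2}\le_f\mathcal T_2$. -/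

import Mathlib

noncomputable section

namespace TrussReduction

/-! ### Sparse matrices and parameters of linear systems -/

/-- A matrix class: a property of real matrices of every size. -/
abbrev MatrixClass : Type :=
  ∀ ⦃m n : ℕ⦄, Matrix (Fin m) (Fin n) ℝ → Prop

/-- The positions of the non-zero entries of `A`, listed in row-major order. -/
def entries {m n : ℕ} (A : Matrix (Fin m) (Fin n) ℝ) : List (Fin m × Fin n) :=
  open Classical in
  (List.finRange m ×ˢ List.finRange n).filter fun p => decide (A p.1 p.2 ≠ 0)

/-- The number of non-zero entries. -/
def nnz {m n : ℕ} (A : Matrix (Fin m) (Fin n) ℝ) : ℕ :=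
  open Classical in
  (Finset.univ.filter fun p : Fin m × Fin n => A p.1 p.2 ≠ 0).card

theorem length_entries {m n : ℕ} (A : Matrix (Fin m) (Fin n) ℝ) :
    (entries A).length = nnz A := by
  classical
  have hnd : (entries A).Nodup :=
    ((List.nodup_finRange m).product (List.nodup_finRange n)).filter _
  rw [nnz, ← List.toFinset_card_of_nodup hnd]
  congr 1
  ext ⟨a, b⟩
  simp [entries, List.mem_product]

/-- The largest absolute value of an entry. -/
def maxAbs {ι : Type} (v : ι → ℝ) : ℝ := ⨆ i, |v i|

/-- The smallest absolute value of a non-zero entry.  If all entries vanish it is `0`, so that its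
reciprocal, which is what is used below, is `0` as well and does not affect a maximum. -/
def minNonzeroAbs {ι : Type} (v : ι → ℝ) : ℝ := sInf {a | ∃ i, v i ≠ 0 ∧ a = |v i|}

/-- The action of a matrix on Euclidean vectors. -/
def act {m n : ℕ} (A : Matrix (Fin m) (Fin n) ℝ) :
    EuclideanSpace ℝ (Fin n) →ₗ[ℝ] EuclideanSpace ℝ (Fin m) :=
  Matrix.toEuclideanLin A

/-- The maximum singular value. -/
def sigmaMax {m n : ℕ} (A : Matrix (Fin m) (Fin n) ℝ) : ℝ :=
  sSup {r | ∃ x : EuclideanSpace ℝ (Fin n), x ≠ 0 ∧ r = ‖act A x‖ / ‖x‖}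

/-- The minimum non-zero singular value (of a non-zero matrix). -/
def sigmaMin {m n : ℕ} (A : Matrix (Fin m) (Fin n) ℝ) : ℝ :=
  sInf {r | ∃ x : EuclideanSpace ℝ (Fin n),
    x ≠ 0 ∧ x ∈ (LinearMap.ker (act A))ᗮ ∧ r = ‖act A x‖ / ‖x‖}

/-- The non-zero condition number (of a non-zero matrix). -/
def condNumber {m n : ℕ} (A : Matrix (Fin m) (Fin n) ℝ) : ℝ :=
  sigmaMax A / sigmaMin A

/-- The orthogonal projection of `c` onto the image of `A`. -/
def proj {m n : ℕ} (A : Matrix (Fin m) (Fin n) ℝ) (c : EuclideanSpace ℝ (Fin m)) :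
    EuclideanSpace ℝ (Fin m) :=
  (LinearMap.range (act A)).starProjection c

/-- `x` solves the linear system approximation instance `(A, c, ε)`. -/
def IsSolution {m n : ℕ} (A : Matrix (Fin m) (Fin n) ℝ) (c : EuclideanSpace ℝ (Fin m)) (ε : ℝ)
    (x : EuclideanSpace ℝ (Fin n)) : Prop :=
  ‖act A x - proj A c‖ ≤ ε * ‖proj A c‖

/-- `(A, c, ε)` is a linear system approximation instance whose sparse parameter complexity is
defined (the right-hand side `c` may be any vector). -/
def IsInstance {m n : ℕ} (A : Matrix (Fin m) (Fin n) ℝ) (_c : EuclideanSpace ℝ (Fin m))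
    (ε : ℝ) : Prop :=
  A ≠ 0 ∧ max m n ≤ nnz A ∧ 0 < ε ∧ ε ≤ 1

/-- The sparse parameter complexity of an instance. -/
def complexity {m n : ℕ} (A : Matrix (Fin m) (Fin n) ℝ) (c : EuclideanSpace ℝ (Fin m)) (ε : ℝ) :
    ℝ × ℝ × ℝ × ℝ :=
  ((nnz A : ℝ),
    max (max (maxAbs fun p : Fin m × Fin n => A p.1 p.2) (maxAbs fun i => c i))
      (max (1 / minNonzeroAbs fun p : Fin m × Fin n => A p.1 p.2)
        (1 / minNonzeroAbs fun i => c i)),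
    condNumber A,
    ε⁻¹)

/-! ### Real random access machines

The machine has index registers and index arrays (holding natural numbers), and number registers
and number arrays (holding real numbers).  A program is finite and therefore refers to finitely
many registers and arrays; the cells of an array are addressed through index registers.  Every
elementary instruction and every test costs one step.  There is no conversion of real numbers
into indices. -/

/-- A memory state. -/
structure Store where
  idx : ℕ → ℕ
  num : ℕ → ℝ
  idxArr : ℕ → ℕ → ℕ
  numArr : ℕ → ℕ → ℝ

/-- Elementary instructions; the first argument names the destination. -/
inductive Instr : Type
  | idxConst (d k : ℕ)
  | idxAdd (d a b : ℕ)
  | idxSub (d a b : ℕ)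
  | idxLoad (d arr i : ℕ)
  | idxStore (arr i a : ℕ)
  | numConst (d : ℕ) (q : ℚ)
  | numOfIdx (d a : ℕ)
  | numAdd (d a b : ℕ)
  | numSub (d a b : ℕ)
  | numMul (d a b : ℕ)
  | numDiv (d a b : ℕ)
  | numSqrt (d a : ℕ)
  | numLoad (d arr i : ℕ)
  | numStore (arr i a : ℕ)

/-- Overwrite an index register. -/
def Store.setIdx (σ : Store) (d v : ℕ) : Store :=
  { σ with idx := Function.update σ.idx d v }

/-- Overwrite a number register. -/
def Store.setNum (σ : Store) (d : ℕ) (v : ℝ) : Store :=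
  { σ with num := Function.update σ.num d v }

/-- Overwrite a cell of an index array. -/
def Store.setIdxArr (σ : Store) (arr i v : ℕ) : Store :=
  { σ with idxArr := Function.update σ.idxArr arr (Function.update (σ.idxArr arr) i v) }

/-- Overwrite a cell of a number array. -/
def Store.setNumArr (σ : Store) (arr i : ℕ) (v : ℝ) : Store :=
  { σ with numArr := Function.update σ.numArr arr (Function.update (σ.numArr arr) i v) }

/-- The effect of an instruction.  Subtraction of indices is truncated at `0`; division by `0` and
the square root of a negative number give `0`. -/
def Instr.apply : Instr → Store → Store
  | .idxConst d k, σ => σ.setIdx d k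
  | .idxAdd d a b, σ => σ.setIdx d (σ.idx a + σ.idx b)
  | .idxSub d a b, σ => σ.setIdx d (σ.idx a - σ.idx b)
  | .idxLoad d arr i, σ => σ.setIdx d (σ.idxArr arr (σ.idx i))
  | .idxStore arr i a, σ => σ.setIdxArr arr (σ.idx i) (σ.idx a)
  | .numConst d q, σ => σ.setNum d (q : ℝ)
  | .numOfIdx d a, σ => σ.setNum d (σ.idx a : ℝ)
  | .numAdd d a b, σ => σ.setNum d (σ.num a + σ.num b)
  | .numSub d a b, σ => σ.setNum d (σ.num a - σ.num b)
  | .numMul d a b, σ => σ.setNum d (σ.num a * σ.num b)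
  | .numDiv d a b, σ => σ.setNum d (σ.num a / σ.num b)
  | .numSqrt d a, σ => σ.setNum d (Real.sqrt (σ.num a))
  | .numLoad d arr i, σ => σ.setNum d (σ.numArr arr (σ.idx i))
  | .numStore arr i a, σ => σ.setNumArr arr (σ.idx i) (σ.num a)

/-- Tests on two registers. -/
inductive Test : Type
  | idxEq (a b : ℕ)
  | idxLt (a b : ℕ)
  | numEq (a b : ℕ)
  | numLt (a b : ℕ)

/-- The truth of a test. -/
def Test.Holds : Test → Store → Prop
  | .idxEq a b, σ => σ.idx a = σ.idx b
  | .idxLt a b, σ => σ.idx a < σ.idx b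
  | .numEq a b, σ => σ.num a = σ.num b
  | .numLt a b, σ => σ.num a < σ.num b

/-- Programs. -/
inductive Prog : Type
  | skip
  | instr (i : Instr)
  | seq (p q : Prog)
  | cond (b : Test) (p q : Prog)
  | loop (b : Test) (p : Prog)

/-- `Exec p σ t τ`: started in `σ`, the program `p` halts after exactly `t` steps in `τ`. -/
inductive Exec : Prog → Store → ℕ → Store → Prop
  | skip (σ : Store) : Exec .skip σ 0 σ
  | instr (i : Instr) (σ : Store) : Exec (.instr i) σ 1 (i.apply σ)
  | seq {p q : Prog} {σ τ υ : Store} {t u : ℕ} (hp : Exec p σ t τ) (hq : Exec q τ u υ) :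
      Exec (.seq p q) σ (t + u) υ
  | condTrue {b : Test} {p q : Prog} {σ τ : Store} {t : ℕ} (hb : b.Holds σ)
      (hp : Exec p σ t τ) : Exec (.cond b p q) σ (t + 1) τ
  | condFalse {b : Test} {p q : Prog} {σ τ : Store} {t : ℕ} (hb : ¬ b.Holds σ)
      (hq : Exec q σ t τ) : Exec (.cond b p q) σ (t + 1) τ
  | loopFalse {b : Test} {p : Prog} {σ : Store} (hb : ¬ b.Holds σ) :
      Exec (.loop b p) σ 1 σ
  | loopTrue {b : Test} {p : Prog} {σ τ υ : Store} {t u : ℕ} (hb : b.Holds σ)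
      (hp : Exec p σ t τ) (hl : Exec (.loop b p) τ u υ) : Exec (.loop b p) σ (t + u + 1) υ

/-- The memory holds the matrix `A` in slot `b` as a sparse matrix: index registers `3b`, `3b+1`,
`3b+2` hold the numbers of rows, columns and non-zero entries; index arrays `2b`, `2b+1` and number
array `b` hold the rows, columns and values of the non-zero entries in row-major order. -/
def Store.HoldsMatrix (σ : Store) (b : ℕ) {m n : ℕ} (A : Matrix (Fin m) (Fin n) ℝ) : Prop :=
  σ.idx (3 * b) = m ∧ σ.idx (3 * b + 1) = n ∧ σ.idx (3 * b + 2) = nnz A ∧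
    ∀ (k : ℕ) (hk : k < (entries A).length),
      σ.idxArr (2 * b) k = ((entries A)[k]).1 ∧
      σ.idxArr (2 * b + 1) k = ((entries A)[k]).2 ∧
      σ.numArr b k = A ((entries A)[k]).1 ((entries A)[k]).2

/-- Number array `a` holds the vector `v`. -/
def Store.HoldsVector (σ : Store) (a : ℕ) {n : ℕ} (v : EuclideanSpace ℝ (Fin n)) : Prop :=
  ∀ i : Fin n, σ.numArr a i = v i

/-- `P`, given `(A, c, ε)` in slot `0`, number array `2` and number register `0` (and anything in
the other cells), halts within `T` steps with `(B, c', ε')` in slot `1`, number array `3` and number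
register `1`. -/
def MapsInstance (P : Prog) (T : ℕ)
    {m n : ℕ} (A : Matrix (Fin m) (Fin n) ℝ) (c : EuclideanSpace ℝ (Fin m)) (ε : ℝ)
    {m' n' : ℕ} (B : Matrix (Fin m') (Fin n') ℝ) (c' : EuclideanSpace ℝ (Fin m')) (ε' : ℝ) : Prop :=
  ∀ σ : Store, σ.HoldsMatrix 0 A → σ.HoldsVector 2 c → σ.num 0 = ε →
    ∃ t τ, t ≤ T ∧ Exec P σ t τ ∧ τ.HoldsMatrix 1 B ∧ τ.HoldsVector 3 c' ∧ τ.num 1 = ε'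

/-- `Q`, given `A`, `B` and `y` in slots `0`, `1` and number array `3` (and anything in the other
cells), halts within `T` steps with `x` in number array `2`. -/
def MapsSolution (Q : Prog) (T : ℕ)
    {m n : ℕ} (A : Matrix (Fin m) (Fin n) ℝ) {m' n' : ℕ} (B : Matrix (Fin m') (Fin n') ℝ)
    (y : EuclideanSpace ℝ (Fin n')) (x : EuclideanSpace ℝ (Fin n)) : Prop :=
  ∀ σ : Store, σ.HoldsMatrix 0 A → σ.HoldsMatrix 1 B → σ.HoldsVector 3 y →
    ∃ t τ, t ≤ T ∧ Exec Q σ t τ ∧ τ.HoldsVector 2 x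

/-! ### Efficient reducibility -/

/-- `M₁` is efficiently `f`-reducible to `M₂`.  All coordinates of a sparse parameter complexity
are at least `1`, so this is the range on which `f` matters. -/
def EfficientlyReducible (M₁ M₂ : MatrixClass) (f : ℝ × ℝ × ℝ × ℝ → ℝ × ℝ × ℝ × ℝ) : Prop :=
  MonotoneOn f (Set.Ici (1, 1, 1, 1)) ∧
  Set.MapsTo f (Set.Ici (1, 1, 1, 1)) (Set.Ici (0, 0, 0, 0)) ∧
  ∃ (P Q : Prog) (T : ℕ),
    ∀ (m n : ℕ) (A : Matrix (Fin m) (Fin n) ℝ) (c : EuclideanSpace ℝ (Fin m)) (ε : ℝ),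
      M₁ A → IsInstance A c ε →
      ∃ (m' n' : ℕ) (B : Matrix (Fin m') (Fin n') ℝ) (c' : EuclideanSpace ℝ (Fin m')) (ε' : ℝ),
        M₂ B ∧ IsInstance B c' ε' ∧
        MapsInstance P (T * nnz A) A c ε B c' ε' ∧
        complexity B c' ε' ≤ f (complexity A c ε) ∧
        ∀ y : EuclideanSpace ℝ (Fin n'), ∃ x : EuclideanSpace ℝ (Fin n),
          MapsSolution Q (T * nnz A) A B y x ∧ (IsSolution B c' ε' y → IsSolution A c ε x)

/-! ### The two matrix classes -/

/-- Integer matrices with a non-zero entry in every row and column, all row sums zero, and in each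
row the sum of the positive entries a power of two. -/
def ZeroSumPowTwo : MatrixClass := fun m n A =>
  ∃ Z : Matrix (Fin m) (Fin n) ℤ,
    A = Z.map (fun z : ℤ => (z : ℝ)) ∧
    (∀ i, ∃ j, Z i j ≠ 0) ∧ (∀ j, ∃ i, Z i j ≠ 0) ∧
    (∀ i, ∑ j, Z i j = 0) ∧
    (∀ i, ∃ k : ℕ, ∑ j, max (Z i j) 0 = 2 ^ k)

/-- 2D truss incidence matrices.  The graph has `N` vertices, which are distinct points `s v` of the
plane, the columns come in `N` pairs, and row `k` belongs to the edge between `i k` and `j k`; it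
is the equation `w k * ⟪s (i k) - s (j k), x (i k) - x (j k)⟫ = 0`.  Distinct rows belong to distinct
edges. -/
def Truss2D : MatrixClass := fun m n B =>
  ∃ (N : ℕ) (hn : N * 2 = n) (s : Fin N → Fin 2 → ℝ) (i j : Fin m → Fin N) (w : Fin m → ℝ),
    Function.Injective s ∧
    (∀ k, i k ≠ j k) ∧ (Function.Injective fun k => s(i k, j k)) ∧
    ∀ (k : Fin m) (v : Fin N) (a : Fin 2),
      B k (Fin.cast hn (finProdFinEquiv (v, a))) =
        (if v = i k then w k * (s (i k) a - s (j k) a) else 0) -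
        (if v = j k then w k * (s (i k) a - s (j k) a) else 0)

/-- The parameter blow-up, with all the constants hidden in the `O`-notation equal to `C`.  The
fourth argument is the reciprocal of the accuracy. -/
def blowup (C : ℝ) : ℝ × ℝ × ℝ × ℝ → ℝ × ℝ × ℝ × ℝ := fun p =>
  let s := p.1
  let U := p.2.1
  let K := p.2.2.1
  let e := p.2.2.2
  (C * (s * Real.log (s * U)),
    C * (s ^ (3 / 2 : ℝ) * U * Real.log (s * U) ^ (1 / 2 : ℝ)),
    C * (K * s ^ 4 * U ^ 2 * Real.log (s * U) ^ 2),
    C * (s * U ^ 2 * e))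

end TrussReduction

end

/-!
Every row of the matrix becomes a chain of bars. The horizontal force in the chain starts at the
mass of the row, the sum of the absolute values of its entries, and after each entry it is the mass
plus the sum of the entries so far, hence at least half the mass; since the row sums to zero, one
more bar closes the chain. At each entry, a tie leads horizontally from the joint of the column to
the foot of a post below the chain, and a brace leads on to the next joint of the chain. The forces
of an entry cancel vertically if the force in the chain times its height is constant, which fixes
the heights and makes all coordinates comparable to one.

The linear forms of the bars of a row then sum to the row, applied to the horizontal displacements
of the columns, up to a factor. If the bars are scaled by the square root of their number in the
row, spreading a right-hand side evenly over the bars is an isometry whose adjoint takes the system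
of the truss back to the original system, so approximate solutions carry over with the same
accuracy. Conversely, the equations of the truss can be solved explicitly along the chains for every
right-hand side whose row sums lie in the image of the matrix, and the size of these solutions
bounds the smallest non-zero singular value, hence the condition number.
-/

noncomputable section

namespace TrussReduction

open Finset

/-! ### Singular values -/

section SingularValues

variable {m n : ℕ} {A : Matrix (Fin m) (Fin n) ℝ}

theorem act_apply (A : Matrix (Fin m) (Fin n) ℝ) (x : EuclideanSpace ℝ (Fin n)) (i : Fin m) :
    act A x i = ∑ j, A i j * x j := by
  simp [act, Matrix.toLpLin_apply, Matrix.mulVec, dotProduct]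

theorem exists_act_ne_zero (hA : A ≠ 0) : ∃ x, act A x ≠ 0 := by
  by_contra! h
  exact hA (Matrix.toEuclideanLin.map_eq_zero_iff.1 (LinearMap.ext h))

theorem norm_act_div_norm_le_sigmaMax (A : Matrix (Fin m) (Fin n) ℝ)
    {x : EuclideanSpace ℝ (Fin n)} (hx : x ≠ 0) : ‖act A x‖ / ‖x‖ ≤ sigmaMax A := by
  refine le_csSup ⟨‖(act A).toContinuousLinearMap‖, ?_⟩ ⟨x, hx, rfl⟩
  rintro _ ⟨z, -, rfl⟩
  exact (act A).toContinuousLinearMap.ratio_le_opNorm z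

theorem sigmaMax_le {M : ℝ} (hM : 0 ≤ M) (h : ∀ x, ‖act A x‖ ≤ M * ‖x‖) : sigmaMax A ≤ M := by
  refine Real.sSup_le ?_ hM
  rintro _ ⟨x, hx, rfl⟩
  exact (div_le_iff₀ (norm_pos_iff.2 hx)).2 (h x)

theorem abs_le_sigmaMax (i : Fin m) (j : Fin n) : |A i j| ≤ sigmaMax A := by
  have hnorm : ‖EuclideanSpace.single j (1 : ℝ)‖ = 1 := by simp
  have happly : act A (EuclideanSpace.single j (1 : ℝ)) i = A i j := by
    simp [act, Matrix.toLpLin_apply]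
  calc |A i j| = ‖act A (EuclideanSpace.single j (1 : ℝ)) i‖ := by rw [happly, Real.norm_eq_abs]
    _ ≤ ‖act A (EuclideanSpace.single j (1 : ℝ))‖ := PiLp.norm_apply_le _ i
    _ = ‖act A (EuclideanSpace.single j (1 : ℝ))‖ / ‖EuclideanSpace.single j (1 : ℝ)‖ := by
        rw [hnorm, div_one]
    _ ≤ sigmaMax A :=
        norm_act_div_norm_le_sigmaMax A (norm_pos_iff.1 (by rw [hnorm]; exact one_pos))

theorem bddBelow_norm_act_div_norm (A : Matrix (Fin m) (Fin n) ℝ) :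
    BddBelow {r | ∃ x : EuclideanSpace ℝ (Fin n),
      x ≠ 0 ∧ x ∈ (LinearMap.ker (act A))ᗮ ∧ r = ‖act A x‖ / ‖x‖} := by
  refine ⟨0, ?_⟩
  rintro _ ⟨x, -, -, rfl⟩
  positivity

theorem sigmaMin_mul_norm_le {x : EuclideanSpace ℝ (Fin n)}
    (hx : x ∈ (LinearMap.ker (act A))ᗮ) : sigmaMin A * ‖x‖ ≤ ‖act A x‖ := by
  rcases eq_or_ne x 0 with rfl | hx0
  · simp
  · exact (le_div_iff₀ (norm_pos_iff.2 hx0)).1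
      (csInf_le (bddBelow_norm_act_div_norm A) ⟨x, hx0, hx, rfl⟩)

theorem exists_mem_ker_orthogonal_act_eq (A : Matrix (Fin m) (Fin n) ℝ)
    (x : EuclideanSpace ℝ (Fin n)) : ∃ u ∈ (LinearMap.ker (act A))ᗮ, act A u = act A x := by
  refine ⟨x - (LinearMap.ker (act A)).starProjection x,
    Submodule.sub_starProjection_mem_orthogonal x, ?_⟩
  have hker := Submodule.starProjection_apply_mem (LinearMap.ker (act A)) x
  rw [map_sub, LinearMap.mem_ker.1 hker, sub_zero]

theorem exists_ne_zero_mem_ker_orthogonal (hA : A ≠ 0) :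
    ∃ u, u ≠ 0 ∧ u ∈ (LinearMap.ker (act A))ᗮ := by
  obtain ⟨x, hx⟩ := exists_act_ne_zero hA
  obtain ⟨u, hu, hux⟩ := exists_mem_ker_orthogonal_act_eq A x
  exact ⟨u, fun h => hx (by rw [← hux, h, map_zero]), hu⟩

theorem sigmaMin_le_sigmaMax (hA : A ≠ 0) : sigmaMin A ≤ sigmaMax A := by
  obtain ⟨u, hu0, hu⟩ := exists_ne_zero_mem_ker_orthogonal hA
  exact (csInf_le (bddBelow_norm_act_div_norm A) ⟨u, hu0, hu, rfl⟩).trans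
    (norm_act_div_norm_le_sigmaMax A hu0)

theorem norm_le_of_mem_ker_orthogonal {x y : EuclideanSpace ℝ (Fin n)}
    (hx : x ∈ (LinearMap.ker (act A))ᗮ) (hxy : act A y = act A x) : ‖x‖ ≤ ‖y‖ := by
  have hker : x - y ∈ LinearMap.ker (act A) := by
    rw [LinearMap.mem_ker, map_sub, hxy, sub_self]
  have hinner : ‖x‖ * ‖x‖ = inner ℝ x y := by
    have h := Submodule.inner_left_of_mem_orthogonal hker hx
    rwa [inner_sub_right, sub_eq_zero, real_inner_self_eq_norm_mul_norm] at h
  rcases (norm_nonneg x).eq_or_lt with h | h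
  · exact h ▸ norm_nonneg y
  · exact le_of_mul_le_mul_left (hinner.trans_le (real_inner_le_norm x y)) h

theorem inv_le_sigmaMin (hA : A ≠ 0) {M : ℝ} (hM : 0 < M)
    (h : ∀ x, ∃ y, act A y = act A x ∧ ‖y‖ ≤ M * ‖act A x‖) : M⁻¹ ≤ sigmaMin A := by
  obtain ⟨u, hu0, hu⟩ := exists_ne_zero_mem_ker_orthogonal hA
  refine le_csInf ⟨_, u, hu0, hu, rfl⟩ ?_
  rintro _ ⟨x, hx0, hx, rfl⟩
  obtain ⟨y, hyx, hy⟩ := h x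
  rw [le_div_iff₀ (norm_pos_iff.2 hx0), inv_mul_le_iff₀ hM]
  exact (norm_le_of_mem_ker_orthogonal hx hyx).trans hy

theorem sigmaMin_pos (hA : A ≠ 0) : 0 < sigmaMin A := by
  set V := (LinearMap.ker (act A))ᗮ
  have hker : LinearMap.ker ((act A).domRestrict V) = ⊥ := by
    rw [LinearMap.ker_eq_bot']
    rintro ⟨x, hx⟩ h
    have hxker : x ∈ LinearMap.ker (act A) := by simpa using h
    exact Subtype.ext (inner_self_eq_zero.1 (Submodule.inner_right_of_mem_orthogonal hxker hx))
  obtain ⟨K, hK, hanti⟩ := LinearMap.exists_antilipschitzWith ((act A).domRestrict V) hker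
  have hK' : (0 : ℝ) < K := hK
  refine (inv_pos.2 hK').trans_le (inv_le_sigmaMin hA hK' fun x => ?_)
  obtain ⟨u, hu, hux⟩ := exists_mem_ker_orthogonal_act_eq A x
  refine ⟨u, hux, ?_⟩
  simpa [dist_zero_right, hux] using hanti.le_mul_dist ⟨u, hu⟩ 0

theorem one_le_condNumber (hA : A ≠ 0) : 1 ≤ condNumber A :=
  (one_le_div (sigmaMin_pos hA)).2 (sigmaMin_le_sigmaMax hA)

theorem exists_act_eq_sigmaMax_mul_norm_le (hA : A ≠ 0) (x : EuclideanSpace ℝ (Fin n)) :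
    ∃ u, act A u = act A x ∧ sigmaMax A * ‖u‖ ≤ condNumber A * ‖act A x‖ := by
  obtain ⟨u, hu, hux⟩ := exists_mem_ker_orthogonal_act_eq A x
  refine ⟨u, hux, ?_⟩
  have hmin := sigmaMin_mul_norm_le hu
  have hmax := (sigmaMin_pos hA).le.trans (sigmaMin_le_sigmaMax hA)
  rw [condNumber, div_mul_eq_mul_div, le_div_iff₀ (sigmaMin_pos hA), mul_assoc, mul_comm ‖u‖,
    ← hux]
  exact mul_le_mul_of_nonneg_left hmin hmax

end SingularValues

/-! ### Transfer of approximate solutions -/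

section Transfer

variable {m n m' n' : ℕ}

theorem inner_act_left (M : Matrix (Fin m) (Fin n) ℝ) (x : EuclideanSpace ℝ (Fin n))
    (w : EuclideanSpace ℝ (Fin m)) : inner ℝ (act M x) w = inner ℝ x (act M.transpose w) := by
  rw [act, act, ← Matrix.conjTranspose_eq_transpose_of_trivial,
    Matrix.toEuclideanLin_conjTranspose_eq_adjoint, LinearMap.adjoint_inner_right]

variable {J : Matrix (Fin m') (Fin m) ℝ}

theorem act_transpose_act_of_transpose_mul_self (hJ : J.transpose * J = 1)
    (x : EuclideanSpace ℝ (Fin m)) : act J.transpose (act J x) = x := by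
  simp [act, Matrix.toLpLin_apply, hJ]

theorem norm_act_of_transpose_mul_self (hJ : J.transpose * J = 1)
    (x : EuclideanSpace ℝ (Fin m)) : ‖act J x‖ = ‖x‖ := by
  have h := inner_act_left J x (act J x)
  rw [act_transpose_act_of_transpose_mul_self hJ, real_inner_self_eq_norm_sq,
    real_inner_self_eq_norm_sq] at h
  exact (sq_eq_sq₀ (norm_nonneg _) (norm_nonneg _)).1 h

theorem norm_act_transpose_le_of_transpose_mul_self (hJ : J.transpose * J = 1)
    (w : EuclideanSpace ℝ (Fin m')) : ‖act J.transpose w‖ ≤ ‖w‖ := by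
  set d := act J.transpose w with hd
  have h : ‖d‖ * ‖d‖ ≤ ‖d‖ * ‖w‖ := by
    calc ‖d‖ * ‖d‖ = inner ℝ (act J d) w := by
          rw [inner_act_left, ← hd, real_inner_self_eq_norm_mul_norm]
      _ ≤ ‖act J d‖ * ‖w‖ := real_inner_le_norm _ _
      _ = ‖d‖ * ‖w‖ := by rw [norm_act_of_transpose_mul_self hJ]
  rcases (norm_nonneg d).eq_or_lt with h0 | h0
  · exact h0 ▸ norm_nonneg w
  · exact le_of_mul_le_mul_left h h0

variable {A : Matrix (Fin m) (Fin n) ℝ} {B : Matrix (Fin m') (Fin n') ℝ}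
  {p : EuclideanSpace ℝ (Fin n') → EuclideanSpace ℝ (Fin n)}

theorem proj_act_of_transpose_mul_self (hJ : J.transpose * J = 1)
    (hB : ∀ y, act J.transpose (act B y) = act A (p y))
    (hrange : ∀ w u, act J.transpose w = act A u → ∃ y, act B y = w)
    (c : EuclideanSpace ℝ (Fin m)) : proj B (act J c) = act J (proj A c) := by
  refine Submodule.eq_starProjection_of_mem_orthogonal (K := LinearMap.range (act B)) ?_ ?_
  · obtain ⟨u, hu⟩ : proj A c ∈ LinearMap.range (act A) := Submodule.starProjection_apply_mem _ c
    obtain ⟨y, hy⟩ := hrange (act J (proj A c)) u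
      (by rw [act_transpose_act_of_transpose_mul_self hJ, hu])
    exact ⟨y, hy⟩
  · rw [Submodule.mem_orthogonal']
    rintro _ ⟨z, rfl⟩
    rw [← map_sub, inner_act_left, hB]
    exact Submodule.inner_left_of_mem_orthogonal (LinearMap.mem_range_self (act A) (p z))
      (Submodule.sub_starProjection_mem_orthogonal c)

theorem isSolution_of_isSolution_act (hJ : J.transpose * J = 1)
    (hB : ∀ y, act J.transpose (act B y) = act A (p y))
    (hrange : ∀ w u, act J.transpose w = act A u → ∃ y, act B y = w)
    {c : EuclideanSpace ℝ (Fin m)} {ε : ℝ} {y : EuclideanSpace ℝ (Fin n')}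
    (hy : IsSolution B (act J c) ε y) : IsSolution A c ε (p y) := by
  rw [IsSolution, proj_act_of_transpose_mul_self hJ hB hrange,
    norm_act_of_transpose_mul_self hJ] at hy
  calc ‖act A (p y) - proj A c‖ = ‖act J.transpose (act B y - act J (proj A c))‖ := by
        rw [map_sub, hB, act_transpose_act_of_transpose_mul_self hJ]
    _ ≤ ‖act B y - act J (proj A c)‖ := norm_act_transpose_le_of_transpose_mul_self hJ _
    _ ≤ ε * ‖proj A c‖ := hy

end Transfer

/-! ### Balanced sparse systems -/

/-- An `m × n` matrix given by the list of its `s` entries: the `k`-th entry is `val k`, at position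
`(row k, col k)`. The fields are functions on `ℕ` like the arrays of the machine, and only their
values at `k < s` matter. -/
structure SparseSystem where
  m : ℕ
  n : ℕ
  s : ℕ
  row : ℕ → ℕ
  col : ℕ → ℕ
  val : ℕ → ℝ

namespace SparseSystem

/-- The systems from which a truss can be built: row sums vanish, no row is empty, and the entries
have absolute value at least `1`. -/
structure IsBalanced (D : SparseSystem) : Prop where
  row_lt : ∀ k < D.s, D.row k < D.m
  col_lt : ∀ k < D.s, D.col k < D.n
  one_le_abs_val : ∀ k < D.s, 1 ≤ |D.val k|
  sum_val_eq_zero : ∀ i < D.m, ∑ k ∈ range D.s with D.row k = i, D.val k = 0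
  exists_row_eq : ∀ i < D.m, ∃ k < D.s, D.row k = i

section RowSum

variable (D : SparseSystem)

/-- The partial sum of row `i`: the sum of `f` over those of the first `k` entries that lie in
row `i`. -/
def rowSum (f : ℕ → ℝ) (k i : ℕ) : ℝ := ∑ l ∈ range k with D.row l = i, f l

variable (f : ℕ → ℝ) (k i : ℕ)

@[simp] theorem rowSum_zero : D.rowSum f 0 i = 0 := by simp [rowSum]

theorem rowSum_succ : D.rowSum f (k + 1) i = D.rowSum f k i + if D.row k = i then f k else 0 := by
  simp only [rowSum, sum_filter, sum_range_succ]

theorem rowSum_succ_self : D.rowSum f (k + 1) (D.row k) = D.rowSum f k (D.row k) + f k := by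
  rw [rowSum_succ, if_pos rfl]

variable {f k i}

theorem rowSum_succ_of_ne (h : D.row k ≠ i) : D.rowSum f (k + 1) i = D.rowSum f k i := by
  rw [rowSum_succ, if_neg h, add_zero]

theorem rowSum_congr {g : ℕ → ℝ} (h : ∀ l < k, D.row l = i → f l = g l) :
    D.rowSum f k i = D.rowSum g k i :=
  sum_congr rfl fun l hl => h l (mem_range.1 (mem_filter.1 hl).1) (mem_filter.1 hl).2

theorem rowSum_le_rowSum {g : ℕ → ℝ} (h : ∀ l < k, f l ≤ g l) : D.rowSum f k i ≤ D.rowSum g k i :=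
  sum_le_sum fun l hl => h l (mem_range.1 (mem_filter.1 hl).1)

theorem abs_rowSum_le {g : ℕ → ℝ} (h : ∀ l < k, |f l| ≤ g l) : |D.rowSum f k i| ≤ D.rowSum g k i :=
  (abs_sum_le_sum_abs _ _).trans (D.rowSum_le_rowSum h)

theorem rowSum_le_rowSum_of_le (hf : ∀ l, 0 ≤ f l) {k' : ℕ} (h : k ≤ k') :
    D.rowSum f k i ≤ D.rowSum f k' i :=
  sum_le_sum_of_subset_of_nonneg (filter_subset_filter _ (range_mono h)) fun l _ _ => hf l

end RowSum

section Rank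

variable (D : SparseSystem)

/-- The number of entries of row `i` among the first `k` entries. -/
def rank (k i : ℕ) : ℕ := Nat.count (fun l => D.row l = i) k

theorem rank_zero (i : ℕ) : D.rank 0 i = 0 := Nat.count_zero _

theorem rank_succ_self (k : ℕ) : D.rank (k + 1) (D.row k) = D.rank k (D.row k) + 1 := by
  rw [rank, rank, Nat.count_succ, if_pos rfl]

variable {D}

theorem rank_succ_of_ne {k i : ℕ} (h : D.row k ≠ i) : D.rank (k + 1) i = D.rank k i := by
  rw [rank, rank, Nat.count_succ, if_neg h, add_zero]

theorem rank_le {k : ℕ} (hk : k ≤ D.s) (i : ℕ) : D.rank k i ≤ D.s :=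
  (Nat.count_le _).trans hk

theorem rank_pos {k i : ℕ} (h : ∃ l < k, D.row l = i) : 0 < D.rank k i := by
  obtain ⟨l, hl, rfl⟩ := h
  exact (Nat.zero_le _).trans_lt (Nat.count_strict_mono (p := fun l' => D.row l' = D.row l) rfl hl)

theorem eq_of_rank_eq {k l : ℕ} (hrow : D.row k = D.row l)
    (hrank : D.rank k (D.row k) = D.rank l (D.row l)) : k = l := by
  rw [hrow] at hrank
  exact Nat.count_injective (p := fun l' => D.row l' = D.row l) hrow rfl hrank

theorem rowSum_const (a : ℝ) (k i : ℕ) : D.rowSum (fun _ => a) k i = D.rank k i * a := by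
  rw [rowSum, sum_const, nsmul_eq_mul, rank, Nat.count_eq_card_filter_range]

end Rank

section Load

variable (D : SparseSystem)

/-- The sum of the absolute values of row `i`. -/
def mass (i : ℕ) : ℝ := D.rowSum (fun l => |D.val l|) D.s i

/-- The coefficient of the chain of row `i` after its first `k` entries. Starting from `mass i`
keeps all of them comparable to `mass i`. -/
def load (k i : ℕ) : ℝ := D.mass i + D.rowSum D.val k i

/-- The height of the chain of its row after entry `k`. With heights inversely proportional
to the load, the vertical forces of the bars of an entry cancel. -/
def height (k : ℕ) : ℝ := D.mass (D.row k) / D.load (k + 1) (D.row k)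

/-- The factor by which the bars of row `i` are scaled: the square root of the number of bars that
represent the row. -/
def scale (i : ℕ) : ℝ := √(1 + 4 * D.rank D.s i)

@[simp] theorem load_zero (i : ℕ) : D.load 0 i = D.mass i := by simp [load]

theorem load_succ_self (k : ℕ) :
    D.load (k + 1) (D.row k) = D.load k (D.row k) + D.val k := by
  rw [load, load, rowSum_succ_self, add_assoc]

variable {D}

theorem load_succ_of_ne {k i : ℕ} (h : D.row k ≠ i) : D.load (k + 1) i = D.load k i := by
  rw [load, load, D.rowSum_succ_of_ne h]

theorem load_le_two_mul_mass {k : ℕ} (hk : k ≤ D.s) (i : ℕ) : D.load k i ≤ 2 * D.mass i := by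
  have : D.rowSum D.val k i ≤ D.mass i :=
    (D.rowSum_le_rowSum fun l _ => le_abs_self _).trans
      (D.rowSum_le_rowSum_of_le (fun l => abs_nonneg _) hk)
  rw [load]
  linarith

theorem mass_le {U : ℝ} (hU : ∀ k < D.s, |D.val k| ≤ U) (hU0 : 0 ≤ U) (i : ℕ) :
    D.mass i ≤ D.s * U :=
  calc D.mass i ≤ D.rowSum (fun _ => U) D.s i := D.rowSum_le_rowSum hU
    _ = D.rank D.s i * U := rowSum_const _ _ _
    _ ≤ D.s * U := by gcongr; exact rank_le le_rfl i

theorem scale_sq (i : ℕ) : D.scale i ^ 2 = 1 + 4 * D.rank D.s i := Real.sq_sqrt (by positivity)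

theorem one_le_scale (i : ℕ) : 1 ≤ D.scale i := by
  rw [scale, Real.one_le_sqrt]
  exact le_add_of_nonneg_right (by positivity)

theorem scale_pos (i : ℕ) : 0 < D.scale i := one_pos.trans_le (one_le_scale i)

theorem scale_le (hs : 1 ≤ D.s) (i : ℕ) : D.scale i ≤ 5 / 2 * √D.s := by
  have hs' : (1 : ℝ) ≤ D.s := by exact_mod_cast hs
  have hrank : (D.rank D.s i : ℝ) ≤ D.s := by exact_mod_cast rank_le le_rfl i
  rw [scale, Real.sqrt_le_left (by positivity), mul_pow, Real.sq_sqrt (by positivity)]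
  linarith

namespace IsBalanced

variable (hD : D.IsBalanced) {k i : ℕ}
include hD

theorem val_ne_zero (hk : k < D.s) : D.val k ≠ 0 := fun h => by
  simpa [h] using (hD.one_le_abs_val k hk).trans_lt' one_pos

theorem two_le_rank (hi : i < D.m) : 2 ≤ D.rank D.s i := by
  by_contra! h
  have hone : D.rank D.s i = 1 := le_antisymm (by omega) (rank_pos (hD.exists_row_eq i hi))
  rw [rank, Nat.count_eq_card_filter_range] at hone
  obtain ⟨k, hk⟩ := card_eq_one.1 hone
  have hmem : k ∈ ({l ∈ range D.s | D.row l = i} : Finset ℕ) := hk ▸ mem_singleton_self k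
  have hsum := hD.sum_val_eq_zero i hi
  rw [hk, sum_singleton] at hsum
  exact hD.val_ne_zero (mem_range.1 (mem_filter.1 hmem).1) hsum

theorem two_le_mass (hi : i < D.m) : 2 ≤ D.mass i :=
  calc (2 : ℝ) ≤ D.rank D.s i * 1 := by rw [mul_one]; exact_mod_cast hD.two_le_rank hi
    _ = D.rowSum (fun _ => 1) D.s i := (rowSum_const _ _ _).symm
    _ ≤ D.mass i := D.rowSum_le_rowSum hD.one_le_abs_val

theorem mass_pos (hi : i < D.m) : 0 < D.mass i := two_pos.trans_le (hD.two_le_mass hi)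

theorem load_s (hi : i < D.m) : D.load D.s i = D.mass i := by
  rw [load, rowSum, hD.sum_val_eq_zero i hi, add_zero]

/-- The negative entries of a row have total `-mass i / 2`, since the row sum vanishes. -/
theorem half_mass_le_load (hk : k ≤ D.s) (hi : i < D.m) : D.mass i / 2 ≤ D.load k i := by
  have hneg : D.rowSum (fun l => |D.val l| - D.val l) D.s i = D.mass i := by
    rw [rowSum, sum_sub_distrib, hD.sum_val_eq_zero i hi, sub_zero, mass, rowSum]
  have hpartial : D.rowSum (fun l => |D.val l| - D.val l) k i ≤ D.mass i :=
    hneg ▸ D.rowSum_le_rowSum_of_le (fun l => sub_nonneg.2 (le_abs_self _)) hk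
  have habs : -D.rowSum D.val k i ≤ D.rowSum (fun l => |D.val l|) k i :=
    (neg_le_abs _).trans (D.abs_rowSum_le fun l _ => le_rfl)
  have hsplit : D.rowSum (fun l => |D.val l| - D.val l) k i =
      D.rowSum (fun l => |D.val l|) k i - D.rowSum D.val k i := sum_sub_distrib _ _
  rw [load]
  linarith

theorem load_pos (hk : k ≤ D.s) (hi : i < D.m) : 0 < D.load k i :=
  (half_pos (hD.mass_pos hi)).trans_le (hD.half_mass_le_load hk hi)

theorem load_row_pos (hk : k < D.s) : 0 < D.load k (D.row k) :=
  hD.load_pos hk.le (hD.row_lt k hk)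

theorem load_succ_row_pos (hk : k < D.s) : 0 < D.load (k + 1) (D.row k) :=
  hD.load_pos hk (hD.row_lt k hk)

theorem half_le_height (hk : k < D.s) : 1 / 2 ≤ D.height k := by
  rw [height, le_div_iff₀ (hD.load_succ_row_pos hk)]
  linarith [load_le_two_mul_mass (show k + 1 ≤ D.s from hk) (D.row k)]

theorem height_le_two (hk : k < D.s) : D.height k ≤ 2 := by
  rw [height, div_le_iff₀ (hD.load_succ_row_pos hk)]
  linarith [hD.half_mass_le_load (show k + 1 ≤ D.s from hk) (hD.row_lt k hk)]

theorem height_pos (hk : k < D.s) : 0 < D.height k := one_half_pos.trans_le (hD.half_le_height hk)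

theorem height_mul_load (hk : k < D.s) :
    D.height k * D.load (k + 1) (D.row k) = D.mass (D.row k) :=
  div_mul_cancel₀ _ (hD.load_succ_row_pos hk).ne'

end IsBalanced

end Load

end SparseSystem

/-! ### The truss of a sparse system -/

/-- The joints of the truss: one for every column and for the left end of the chain of every row,
and two for every entry. -/
inductive Joint : Type
  | column (j : ℕ)
  | anchor (i : ℕ)
  | foot (k : ℕ)
  | head (k : ℕ)

/-- A bar of the truss: its end points, the row it represents, and the force along it that enters
the equations, which is proportional to its direction. -/
structure Bar where
  src : Joint
  tgt : Joint
  owner : ℕ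
  fx : ℝ
  fy : ℝ

namespace Bar

/-- The linear form of a bar, at displacements `X` and `Y` in the two directions. -/
def form (b : Bar) (X Y : Joint → ℝ) : ℝ :=
  b.fx * (X b.src - X b.tgt) + b.fy * (Y b.src - Y b.tgt)

/-- The force of a bar in direction `0` or `1`. -/
def component (b : Bar) (a : ℕ) : ℝ := if a = 0 then b.fx else b.fy

end Bar

namespace SparseSystem

variable (D : SparseSystem)

section Joints

/-- The joints that are present in the truss. -/
def IsJoint : Joint → Prop
  | .column j => j < D.n
  | .anchor i => i < D.m
  | .foot k => k < D.s
  | .head k => k < D.s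

/-- The number of joints. -/
def numJoints : ℕ := D.n + D.m + 2 * D.s

/-- The number of a joint. -/
def index : Joint → ℕ
  | .column j => j
  | .anchor i => D.n + i
  | .foot k => D.n + D.m + 2 * k
  | .head k => D.n + D.m + 2 * k + 1

/-- The joint with a given number. -/
def jointAt (v : ℕ) : Joint :=
  if v < D.n then .column v
  else if v < D.n + D.m then .anchor (v - D.n)
  else if (v - (D.n + D.m)) % 2 = 0 then .foot ((v - (D.n + D.m)) / 2)
  else .head ((v - (D.n + D.m)) / 2)

/-- The right end of the chain of row `i` after the first `k` entries. -/
def last : ℕ → ℕ → Joint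
  | 0, i => .anchor i
  | k + 1, i => if D.row k = i then .head k else last k i

variable {D}

theorem index_lt {p : Joint} (hp : D.IsJoint p) : D.index p < D.numJoints := by
  rw [numJoints]
  cases p <;> simp only [IsJoint, index] at hp ⊢ <;> omega

theorem jointAt_index {p : Joint} (hp : D.IsJoint p) : D.jointAt (D.index p) = p := by
  cases p <;> grind [IsJoint, index, jointAt]

theorem isJoint_jointAt {v : ℕ} (hv : v < D.numJoints) : D.IsJoint (D.jointAt v) := by
  grind [numJoints, IsJoint, jointAt]

theorem index_jointAt (v : ℕ) : D.index (D.jointAt v) = v := by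
  grind [index, jointAt]

theorem last_succ_self (k : ℕ) : D.last (k + 1) (D.row k) = .head k := if_pos rfl

theorem last_succ_of_ne {k i : ℕ} (h : D.row k ≠ i) : D.last (k + 1) i = D.last k i := if_neg h

theorem last_eq_anchor_or_head (k i : ℕ) :
    (D.last k i = .anchor i ∧ D.rank k i = 0) ∨
      ∃ l < k, D.row l = i ∧ D.last k i = .head l ∧ D.rank k i = D.rank (l + 1) i := by
  induction k with
  | zero => exact .inl ⟨rfl, D.rank_zero i⟩
  | succ k ih =>
    by_cases h : D.row k = i
    · subst h
      exact .inr ⟨k, k.lt_succ_self, rfl, last_succ_self k, rfl⟩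
    · rw [last_succ_of_ne h, rank_succ_of_ne h]
      exact ih.imp_right fun ⟨l, hl, hrest⟩ => ⟨l, hl.trans k.lt_succ_self, hrest⟩

theorem apply_last {α : Type*} {f : Joint → α} {g : ℕ → ℕ → α} {i : ℕ}
    (anchor : f (.anchor i) = g 0 i) (head : ∀ k, D.row k = i → f (.head k) = g (k + 1) i)
    (stay : ∀ k, D.row k ≠ i → g (k + 1) i = g k i) (k : ℕ) : f (D.last k i) = g k i := by
  induction k with
  | zero => exact anchor
  | succ k ih =>
    by_cases h : D.row k = i
    · rw [last, if_pos h, head k h]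
    · rw [last_succ_of_ne h, ih, stay k h]

theorem isJoint_last {k i : ℕ} (hk : k ≤ D.s) (hi : i < D.m) : D.IsJoint (D.last k i) := by
  obtain ⟨h, -⟩ | ⟨l, hl, -, h, -⟩ := D.last_eq_anchor_or_head k i
  · rw [h]
    exact hi
  · rw [h]
    exact hl.trans_le hk

theorem index_last_lt_index_foot (k : ℕ) {i : ℕ} (hi : i < D.m) :
    D.index (D.last k i) < D.index (.foot k) := by
  obtain ⟨h, -⟩ | ⟨l, hl, -, h, -⟩ := D.last_eq_anchor_or_head k i <;>
    rw [h] <;> simp only [index] <;> omega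

end Joints

section Bars

/-- The bar that carries the displacement of the column of entry `k` to the foot of entry `k`. -/
def tieBar (k : ℕ) : Bar :=
  ⟨.column (D.col k), .foot k, D.row k, D.scale (D.row k) * D.val k, 0⟩

/-- The vertical bar between the end of the chain before entry `k` and the foot of entry `k`. -/
def postBar (k : ℕ) : Bar :=
  ⟨D.last k (D.row k), .foot k, D.row k, 0, D.scale (D.row k) * D.val k * D.height k⟩

/-- The bar from the foot of entry `k` to the end of the chain after entry `k`. -/
def braceBar (k : ℕ) : Bar :=
  ⟨.foot k, .head k, D.row k, D.scale (D.row k) * D.val k,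
    D.scale (D.row k) * D.val k * D.height k⟩

/-- The bar by which entry `k` extends the chain of its row. -/
def chainBar (k : ℕ) : Bar :=
  ⟨D.last k (D.row k), .head k, D.row k, D.scale (D.row k) * D.load k (D.row k),
    -(D.scale (D.row k) * D.val k * D.height k)⟩

/-- The bar between the two ends of the chain of row `i`. -/
def closingBar (i : ℕ) : Bar :=
  ⟨.anchor i, D.last D.s i, i, -(D.scale i * D.mass i), 0⟩

/-- The number of bars. -/
def numBars : ℕ := 4 * D.s + D.m

/-- The bars in the order of the rows of the incidence matrix. -/
def bar (e : ℕ) : Bar :=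
  if e < 4 * D.s then
    match e % 4 with
    | 0 => D.tieBar (e / 4)
    | 1 => D.postBar (e / 4)
    | 2 => D.braceBar (e / 4)
    | _ => D.chainBar (e / 4)
  else D.closingBar (e - 4 * D.s)

variable {D} {k : ℕ}

theorem bar_tie (hk : k < D.s) : D.bar (4 * k) = D.tieBar k := by
  grind [bar]

theorem bar_post (hk : k < D.s) : D.bar (4 * k + 1) = D.postBar k := by
  grind [bar]

theorem bar_brace (hk : k < D.s) : D.bar (4 * k + 2) = D.braceBar k := by
  grind [bar]

theorem bar_chain (hk : k < D.s) : D.bar (4 * k + 3) = D.chainBar k := by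
  grind [bar]

theorem bar_closing (i : ℕ) : D.bar (4 * D.s + i) = D.closingBar i := by
  grind [bar]

theorem forall_bar {P : ℕ → Bar → Prop} (tie : ∀ k < D.s, P (4 * k) (D.tieBar k))
    (post : ∀ k < D.s, P (4 * k + 1) (D.postBar k))
    (brace : ∀ k < D.s, P (4 * k + 2) (D.braceBar k))
    (chain : ∀ k < D.s, P (4 * k + 3) (D.chainBar k))
    (closing : ∀ i < D.m, P (4 * D.s + i) (D.closingBar i)) :
    ∀ e < D.numBars, P e (D.bar e) := by
  intro e he
  rw [numBars] at he
  by_cases hes : e < 4 * D.s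
  · have hk : e / 4 < D.s := by omega
    obtain h | h | h | h : e = 4 * (e / 4) ∨ e = 4 * (e / 4) + 1 ∨ e = 4 * (e / 4) + 2 ∨
      e = 4 * (e / 4) + 3 := by omega
    · rw [h, bar_tie hk]; exact tie _ hk
    · rw [h, bar_post hk]; exact post _ hk
    · rw [h, bar_brace hk]; exact brace _ hk
    · rw [h, bar_chain hk]; exact chain _ hk
  · obtain ⟨i, rfl⟩ := Nat.exists_eq_add_of_le (not_lt.1 hes)
    rw [bar_closing]
    exact closing i (by omega)

theorem sum_range_four_mul {M : Type*} [AddCommMonoid M] (f : ℕ → M) (s : ℕ) :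
    ∑ e ∈ range (4 * s), f e =
      ∑ k ∈ range s, (f (4 * k) + f (4 * k + 1) + f (4 * k + 2) + f (4 * k + 3)) := by
  induction s with
  | zero => simp
  | succ s ih =>
    rw [sum_range_succ, ← ih, mul_add_one]
    simp only [sum_range_succ]
    simp only [add_assoc]

theorem sum_owner_eq (f : ℕ → ℝ) {i : ℕ} (hi : i < D.m) :
    ∑ e ∈ range D.numBars with (D.bar e).owner = i, f e =
      D.rowSum (fun k => f (4 * k) + f (4 * k + 1) + f (4 * k + 2) + f (4 * k + 3)) D.s i +
        f (4 * D.s + i) := by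
  rw [sum_filter, numBars, sum_range_add, sum_range_four_mul, rowSum, sum_filter]
  congr 1
  · refine sum_congr rfl fun k hk => ?_
    have hk := mem_range.1 hk
    simp only [bar_tie hk, bar_post hk, bar_brace hk, bar_chain hk, tieBar, postBar, braceBar,
      chainBar]
    split_ifs <;> simp
  · simp only [bar_closing, closingBar, sum_ite_eq', mem_range, hi, if_true]

theorem isJoint_tgt {e : ℕ} (he : e < D.numBars) : D.IsJoint (D.bar e).tgt :=
  forall_bar (P := fun _ b => D.IsJoint b.tgt) (fun _ => id) (fun _ => id) (fun _ => id)
    (fun _ => id) (fun _ hi => isJoint_last le_rfl hi) e he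

namespace IsBalanced

variable (hD : D.IsBalanced)
include hD

theorem owner_lt {e : ℕ} (he : e < D.numBars) : (D.bar e).owner < D.m :=
  forall_bar (P := fun _ b => b.owner < D.m) hD.row_lt hD.row_lt hD.row_lt hD.row_lt
    (fun _ => id) e he

theorem isJoint_src {e : ℕ} (he : e < D.numBars) : D.IsJoint (D.bar e).src :=
  forall_bar (P := fun _ b => D.IsJoint b.src) hD.col_lt
    (fun k hk => isJoint_last hk.le (hD.row_lt k hk)) (fun _ => id)
    (fun k hk => isJoint_last hk.le (hD.row_lt k hk)) (fun _ => id) e he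

theorem exists_last_eq_head {i : ℕ} (hi : i < D.m) : ∃ l < D.s, D.last D.s i = .head l := by
  obtain ⟨-, h⟩ | ⟨l, hl, -, h, -⟩ := D.last_eq_anchor_or_head D.s i
  · exact absurd (hD.two_le_rank hi) (by omega)
  · exact ⟨l, hl, h⟩

theorem index_src_lt_index_tgt {e : ℕ} (he : e < D.numBars) :
    D.index (D.bar e).src < D.index (D.bar e).tgt := by
  refine forall_bar (P := fun _ b => D.index b.src < D.index b.tgt)
    (fun k hk => ?_) (fun k hk => ?_) (fun _ _ => ?_) (fun k hk => ?_) (fun i hi => ?_) e he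
  · have := hD.col_lt k hk
    simp only [tieBar, index]
    omega
  · exact index_last_lt_index_foot k (hD.row_lt k hk)
  · exact Nat.lt_succ_self _
  · exact (index_last_lt_index_foot k (hD.row_lt k hk)).trans (Nat.lt_succ_self _)
  · obtain ⟨l, -, hl⟩ := hD.exists_last_eq_head hi
    simp only [closingBar, hl, index]
    omega

end IsBalanced

end Bars

section Forms

/-- The coefficient of variable `c` in the linear form of a bar; the variables of the joint with
number `v` are `2 * v` and `2 * v + 1`. -/
def coeff (b : Bar) (c : ℕ) : ℝ :=
  (if c / 2 = D.index b.src then b.component (c % 2) else 0) -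
    (if c / 2 = D.index b.tgt then b.component (c % 2) else 0)

/-- The incidence matrix of the truss. -/
def truss : Matrix (Fin D.numBars) (Fin (D.numJoints * 2)) ℝ := fun e c => D.coeff (D.bar e) c

variable {D}

theorem coeff_two_mul_add (b : Bar) (v : ℕ) {a : ℕ} (ha : a < 2) :
    D.coeff b (2 * v + a) =
      (if v = D.index b.src then b.component a else 0) -
        (if v = D.index b.tgt then b.component a else 0) := by
  rw [coeff, show (2 * v + a) / 2 = v by omega, show (2 * v + a) % 2 = a by omega]

variable {k : ℕ} (X Y : Joint → ℝ)

theorem sum_form_entry (hk : k < D.s) :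
    (D.bar (4 * k)).form X Y + (D.bar (4 * k + 1)).form X Y + (D.bar (4 * k + 2)).form X Y +
        (D.bar (4 * k + 3)).form X Y =
      D.scale (D.row k) * (D.val k * X (.column (D.col k)) +
        (D.load k (D.row k) * X (D.last k (D.row k)) -
          D.load (k + 1) (D.row k) * X (.head k))) := by
  rw [bar_tie hk, bar_post hk, bar_brace hk, bar_chain hk, load_succ_self]
  simp only [tieBar, postBar, braceBar, chainBar, Bar.form]
  ring

theorem rowSum_load_mul_sub (k i : ℕ) :
    D.rowSum (fun l => D.load l i * X (D.last l i) - D.load (l + 1) i * X (D.last (l + 1) i)) k i =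
      D.mass i * X (.anchor i) - D.load k i * X (D.last k i) := by
  induction k with
  | zero => simp [last]
  | succ k ih =>
    rw [rowSum_succ, ih]
    split_ifs with h
    · ring
    · rw [load_succ_of_ne h, last_succ_of_ne h]
      ring

/-- The four bars of an entry contribute the entry and a telescoping sum along the chain, and the
closing bar cancels the latter. -/
theorem IsBalanced.sum_form_eq (hD : D.IsBalanced) {i : ℕ} (hi : i < D.m) :
    ∑ e ∈ range D.numBars with (D.bar e).owner = i, (D.bar e).form X Y =
      D.scale i * D.rowSum (fun l => D.val l * X (.column (D.col l))) D.s i := by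
  have hentries : D.rowSum (fun k => (D.bar (4 * k)).form X Y + (D.bar (4 * k + 1)).form X Y +
        (D.bar (4 * k + 2)).form X Y + (D.bar (4 * k + 3)).form X Y) D.s i =
      D.rowSum (fun k => D.scale i * (D.val k * X (.column (D.col k)) +
        (D.load k i * X (D.last k i) - D.load (k + 1) i * X (D.last (k + 1) i)))) D.s i := by
    refine D.rowSum_congr fun k hk hki => ?_
    subst hki
    rw [sum_form_entry X Y hk, last_succ_self]
  have hclosing : (D.bar (4 * D.s + i)).form X Y =
      -(D.scale i * (D.mass i * X (.anchor i) - D.load D.s i * X (D.last D.s i))) := by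
    rw [bar_closing, hD.load_s hi]
    simp only [closingBar, Bar.form]
    ring
  rw [sum_owner_eq _ hi, hentries, hclosing, ← rowSum_load_mul_sub]
  simp only [rowSum, ← mul_sum, sum_add_distrib]
  ring

end Forms

end SparseSystem

section Coord

variable {n : ℕ}

/-- The coordinates of a vector, extended by zero. -/
def coord (y : EuclideanSpace ℝ (Fin n)) (c : ℕ) : ℝ := if h : c < n then y ⟨c, h⟩ else 0

theorem coord_of_lt (y : EuclideanSpace ℝ (Fin n)) {c : ℕ} (h : c < n) :
    coord y c = y ⟨c, h⟩ := dif_pos h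

@[simp] theorem coord_val (y : EuclideanSpace ℝ (Fin n)) (c : Fin n) : coord y c = y c :=
  dif_pos c.2

theorem abs_coord_le_norm (y : EuclideanSpace ℝ (Fin n)) (c : ℕ) : |coord y c| ≤ ‖y‖ := by
  unfold coord
  split_ifs with h
  · exact PiLp.norm_apply_le y ⟨c, h⟩
  · simp

theorem norm_le_sqrt_mul (y : EuclideanSpace ℝ (Fin n)) {M : ℝ} (hM : 0 ≤ M)
    (h : ∀ i, |y i| ≤ M) : ‖y‖ ≤ √n * M := by
  rw [EuclideanSpace.norm_eq, Real.sqrt_le_left (by positivity), mul_pow,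
    Real.sq_sqrt n.cast_nonneg]
  calc ∑ i, ‖y i‖ ^ 2 ≤ ∑ _i : Fin n, M ^ 2 :=
        sum_le_sum fun i _ => pow_le_pow_left₀ (norm_nonneg _) (h i) 2
    _ = n * M ^ 2 := by simp

end Coord

namespace SparseSystem

variable {D : SparseSystem}

section Spread

/-- `A` is the matrix whose entries are listed by `D`, expressed through its action on vectors. -/
def Represents (D : SparseSystem) (A : Matrix (Fin D.m) (Fin D.n) ℝ) : Prop :=
  ∀ (u : EuclideanSpace ℝ (Fin D.n)) (i : Fin D.m),
    act A u i = D.rowSum (fun l => D.val l * coord u (D.col l)) D.s i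

/-- The matrix that distributes a right-hand side evenly over the bars of each row. The scaling
makes its columns orthonormal. -/
def spread (D : SparseSystem) : Matrix (Fin D.numBars) (Fin D.m) ℝ :=
  fun e i => if (D.bar e).owner = i then (D.scale i)⁻¹ else 0

/-- The displacement of a joint in direction `a`. -/
def displacement (y : EuclideanSpace ℝ (Fin (D.numJoints * 2))) (a : ℕ) (p : Joint) : ℝ :=
  coord y (2 * D.index p + a)

/-- The horizontal displacements of the joints of the columns. -/
def recover (y : EuclideanSpace ℝ (Fin (D.numJoints * 2))) : EuclideanSpace ℝ (Fin D.n) :=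
  WithLp.toLp 2 fun j => displacement y 0 (.column j)

theorem coord_recover (y : EuclideanSpace ℝ (Fin (D.numJoints * 2))) {j : ℕ} (hj : j < D.n) :
    coord (recover y) j = displacement y 0 (.column j) :=
  coord_of_lt _ hj

theorem act_spread (hD : D.IsBalanced) (c : EuclideanSpace ℝ (Fin D.m)) (e : Fin D.numBars) :
    act D.spread c e = coord c (D.bar e).owner / D.scale (D.bar e).owner := by
  have howner := hD.owner_lt e.2
  rw [act_apply, sum_eq_single ⟨(D.bar e).owner, howner⟩]
  · rw [spread, if_pos rfl, coord_of_lt _ howner, div_eq_inv_mul]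
  · intro i _ hi
    rw [spread, if_neg fun h => hi (Fin.ext h.symm), zero_mul]
  · simp

theorem act_spread_transpose (w : EuclideanSpace ℝ (Fin D.numBars)) (i : Fin D.m) :
    act D.spread.transpose w i =
      (∑ e ∈ range D.numBars with (D.bar e).owner = i, coord w e) / D.scale i := by
  rw [sum_filter, ← Fin.sum_univ_eq_sum_range
    (fun e => if (D.bar e).owner = i then coord w e else 0), sum_div, act_apply]
  refine sum_congr rfl fun e _ => ?_
  rw [Matrix.transpose_apply, spread, coord_val]
  split_ifs
  · rw [div_eq_inv_mul]
  · rw [zero_mul, zero_div]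

theorem spread_transpose_mul_spread : D.spread.transpose * D.spread = 1 := by
  ext i j
  simp only [Matrix.mul_apply, Matrix.transpose_apply, spread]
  rcases eq_or_ne i j with rfl | hij
  · have hterm : ∀ e : ℕ, (if (D.bar e).owner = i then (D.scale i)⁻¹ else 0) *
        (if (D.bar e).owner = i then (D.scale i)⁻¹ else 0) =
        if (D.bar e).owner = i then (D.scale i ^ 2)⁻¹ else 0 := fun e => by
      split_ifs <;> ring
    simp only [hterm]
    rw [Fin.sum_univ_eq_sum_range
      (fun e => if (D.bar e).owner = i then (D.scale i ^ 2)⁻¹ else 0), ← sum_filter,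
      sum_owner_eq _ i.2, rowSum_const, Matrix.one_apply_eq]
    have hsq := scale_sq (D := D) i
    have hpos := scale_pos (D := D) i
    field_simp
    linarith
  · rw [Matrix.one_apply_ne hij]
    refine sum_eq_zero fun e _ => ?_
    split_ifs with hi hj
    · exact absurd (Fin.ext (hi.symm.trans hj)) hij
    all_goals simp

theorem act_truss (hD : D.IsBalanced) (y : EuclideanSpace ℝ (Fin (D.numJoints * 2)))
    (e : Fin D.numBars) :
    act D.truss y e = (D.bar e).form (displacement y 0) (displacement y 1) := by
  have hsrc := index_lt (hD.isJoint_src e.2)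
  have htgt := index_lt (isJoint_tgt e.2)
  have hcoeff : ∀ (v : Fin D.numJoints) (a : Fin 2),
      D.truss e (finProdFinEquiv (v, a)) * y (finProdFinEquiv (v, a)) =
        D.coeff (D.bar e) (2 * v + a) * coord y (2 * v + a) := fun v a => by
    rw [← coord_val, finProdFinEquiv_apply_val, truss, finProdFinEquiv_apply_val]
    simp only [add_comm]
  rw [act_apply, ← finProdFinEquiv.sum_comp, Fintype.sum_prod_type]
  simp only [hcoeff, Fin.sum_univ_two, Fin.val_zero, Fin.val_one]
  rw [Fin.sum_univ_eq_sum_range (fun v => D.coeff (D.bar e) (2 * v + 0) * coord y (2 * v + 0) +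
    D.coeff (D.bar e) (2 * v + 1) * coord y (2 * v + 1))]
  simp only [coeff_two_mul_add _ _ two_pos, coeff_two_mul_add _ _ one_lt_two, sub_mul, ite_mul,
    zero_mul, sum_add_distrib, sum_sub_distrib, sum_ite_eq', mem_range, hsrc, htgt, if_true]
  simp only [Bar.form, Bar.component, displacement, if_true, one_ne_zero, if_false]
  ring

theorem act_spread_transpose_act_truss (hD : D.IsBalanced) {A : Matrix (Fin D.m) (Fin D.n) ℝ}
    (hA : D.Represents A) (y : EuclideanSpace ℝ (Fin (D.numJoints * 2))) :
    act D.spread.transpose (act D.truss y) = act A (recover y) := by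
  ext i
  have hform : ∑ e ∈ range D.numBars with (D.bar e).owner = i, coord (act D.truss y) e =
      ∑ e ∈ range D.numBars with (D.bar e).owner = i,
        (D.bar e).form (displacement y 0) (displacement y 1) := by
    refine sum_congr rfl fun e he => ?_
    rw [coord_of_lt _ (mem_range.1 (mem_filter.1 he).1), act_truss hD]
  rw [act_spread_transpose, hA, hform, hD.sum_form_eq _ _ i.2,
    mul_div_cancel_left₀ _ (scale_pos _).ne']
  exact D.rowSum_congr fun l hl _ => by rw [coord_recover _ (hD.col_lt l hl)]

end Spread

/-! ### Solving the equations of the truss -/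

section Solution

variable (D) (W V : ℕ → ℝ)

/-- The part of the right-hand side `W` of the four bars of entry `k` that is not accounted for by
the displacement `V` of the column, and hence has to be absorbed by the chain. -/
def imbalance (k : ℕ) : ℝ :=
  (W (4 * k) + W (4 * k + 1) + W (4 * k + 2) + W (4 * k + 3)) / D.scale (D.row k) -
    D.val k * V (D.col k)

/-- The horizontal displacement of the end of the chain of row `i` after the first `k` entries. -/
def chainX (k i : ℕ) : ℝ := -D.rowSum (D.imbalance W V) k i / D.load k i

/-- The increment of the vertical displacement of the chain at entry `k`. -/
def rise (k : ℕ) : ℝ :=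
  (W (4 * k + 3) / D.scale (D.row k) - D.imbalance W V k -
    D.val k * D.chainX W V (k + 1) (D.row k)) / (D.val k * D.height k)

/-- The horizontal displacements that solve the equations of the truss. -/
def solX : Joint → ℝ
  | .column j => V j
  | .anchor _ => 0
  | .foot k => V (D.col k) - W (4 * k) / (D.scale (D.row k) * D.val k)
  | .head k => D.chainX W V (k + 1) (D.row k)

/-- The vertical displacements that solve the equations of the truss. -/
def solY : Joint → ℝ
  | .column _ => 0
  | .anchor _ => 0
  | .foot k => D.rowSum (D.rise W V) k (D.row k) -
      W (4 * k + 1) / (D.scale (D.row k) * D.val k * D.height k)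
  | .head k => D.rowSum (D.rise W V) (k + 1) (D.row k)

variable {D W V} {k i : ℕ}

theorem solX_last : D.solX W V (D.last k i) = D.chainX W V k i :=
  apply_last (f := D.solX W V) (g := D.chainX W V) (by simp [solX, chainX])
    (fun _ h => by rw [solX, h])
    (fun _ h => by rw [chainX, chainX, D.rowSum_succ_of_ne h, load_succ_of_ne h]) k

theorem solY_last : D.solY W V (D.last k i) = D.rowSum (D.rise W V) k i :=
  apply_last (f := D.solY W V) (g := D.rowSum (D.rise W V)) (by simp [solY])
    (fun _ h => by rw [solY, h]) (fun _ h => D.rowSum_succ_of_ne h) k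

namespace IsBalanced

variable (hD : D.IsBalanced)
include hD

theorem load_mul_chainX (hk : k ≤ D.s) (hi : i < D.m) :
    D.load k i * D.chainX W V k i = -D.rowSum (D.imbalance W V) k i :=
  mul_div_cancel₀ _ (hD.load_pos hk hi).ne'

theorem load_mul_chainX_sub (hk : k < D.s) :
    D.load k (D.row k) * (D.chainX W V k (D.row k) - D.chainX W V (k + 1) (D.row k)) =
      D.imbalance W V k + D.val k * D.chainX W V (k + 1) (D.row k) := by
  have hi := hD.row_lt k hk
  have hleft := hD.load_mul_chainX (W := W) (V := V) hk.le hi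
  have hright := hD.load_mul_chainX (W := W) (V := V) (show k + 1 ≤ D.s from hk) hi
  rw [rowSum_succ_self, load_succ_self] at hright
  linarith

theorem form_tieBar_sol (hk : k < D.s) :
    (D.tieBar k).form (D.solX W V) (D.solY W V) = W (4 * k) := by
  have hscale := (scale_pos (D := D) (D.row k)).ne'
  have hval := hD.val_ne_zero hk
  simp only [tieBar, Bar.form, solX]
  field_simp
  ring

theorem form_postBar_sol (hk : k < D.s) :
    (D.postBar k).form (D.solX W V) (D.solY W V) = W (4 * k + 1) := by
  have hscale := (scale_pos (D := D) (D.row k)).ne'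
  have hval := hD.val_ne_zero hk
  have hheight := (hD.height_pos hk).ne'
  simp only [postBar, Bar.form, solY_last]
  simp only [solY]
  field_simp
  ring

theorem form_chainBar_sol (hk : k < D.s) :
    (D.chainBar k).form (D.solX W V) (D.solY W V) = W (4 * k + 3) := by
  have hscale := (scale_pos (D := D) (D.row k)).ne'
  have hrise : D.val k * D.height k * D.rise W V k = W (4 * k + 3) / D.scale (D.row k) -
      D.imbalance W V k - D.val k * D.chainX W V (k + 1) (D.row k) :=
    mul_div_cancel₀ _ (mul_ne_zero (hD.val_ne_zero hk) (hD.height_pos hk).ne')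
  simp only [chainBar, Bar.form, solX_last, solY_last]
  simp only [solX, solY, rowSum_succ_self]
  calc _ = D.scale (D.row k) *
        (D.load k (D.row k) * (D.chainX W V k (D.row k) - D.chainX W V (k + 1) (D.row k)) +
          D.val k * D.height k * D.rise W V k) := by ring
    _ = W (4 * k + 3) := by
        rw [hD.load_mul_chainX_sub hk, hrise]
        field_simp
        ring

theorem form_braceBar_sol (hk : k < D.s) :
    (D.braceBar k).form (D.solX W V) (D.solY W V) = W (4 * k + 2) := by
  have hscale := (scale_pos (D := D) (D.row k)).ne'
  have hsum := sum_form_entry (D.solX W V) (D.solY W V) hk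
  rw [bar_tie hk, bar_post hk, bar_brace hk, bar_chain hk, hD.form_tieBar_sol hk,
    hD.form_postBar_sol hk, hD.form_chainBar_sol hk, solX_last, load_succ_self] at hsum
  have hchain := hD.load_mul_chainX_sub (W := W) (V := V) hk
  have hbalance : D.scale (D.row k) * (D.val k * V (D.col k) + D.imbalance W V k) =
      W (4 * k) + W (4 * k + 1) + W (4 * k + 2) + W (4 * k + 3) := by
    rw [imbalance]
    field_simp
    ring
  simp only [solX] at hsum
  linear_combination hsum + hbalance + D.scale (D.row k) * hchain

theorem form_closingBar_sol (hi : i < D.m)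
    (hW : ∑ e ∈ range D.numBars with (D.bar e).owner = i, W e =
      D.scale i * D.rowSum (fun l => D.val l * V (D.col l)) D.s i) :
    (D.closingBar i).form (D.solX W V) (D.solY W V) = W (4 * D.s + i) := by
  have himbalance : D.scale i * D.rowSum (D.imbalance W V) D.s i =
      D.rowSum (fun k => W (4 * k) + W (4 * k + 1) + W (4 * k + 2) + W (4 * k + 3)) D.s i -
        D.scale i * D.rowSum (fun l => D.val l * V (D.col l)) D.s i := by
    simp only [rowSum, mul_sum, ← sum_sub_distrib]
    refine sum_congr rfl fun l hl => ?_
    rw [← (mem_filter.1 hl).2, imbalance, mul_sub, mul_div_cancel₀ _ (scale_pos _).ne']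
  have hchain := hD.load_mul_chainX (W := W) (V := V) le_rfl hi
  rw [hD.load_s hi] at hchain
  rw [sum_owner_eq _ hi] at hW
  simp only [closingBar, Bar.form, solX_last]
  simp only [solX]
  linear_combination D.scale i * hchain - himbalance - hW

theorem form_bar_sol (hW : ∀ i < D.m, ∑ e ∈ range D.numBars with (D.bar e).owner = i, W e =
      D.scale i * D.rowSum (fun l => D.val l * V (D.col l)) D.s i) :
    ∀ e < D.numBars, (D.bar e).form (D.solX W V) (D.solY W V) = W e :=
  forall_bar (P := fun e b => b.form (D.solX W V) (D.solY W V) = W e)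
    (fun _ => hD.form_tieBar_sol) (fun _ => hD.form_postBar_sol) (fun _ => hD.form_braceBar_sol)
    (fun _ => hD.form_chainBar_sol) fun i hi => hD.form_closingBar_sol hi (hW i hi)

end IsBalanced

end Solution

/-! ### Bounds on the truss -/

section SolutionBounds

variable {W V : ℕ → ℝ} {U β η : ℝ} {k i : ℕ}

theorem abs_div_scale_le (hW : ∀ e, |W e| ≤ β) (e i : ℕ) : |W e / D.scale i| ≤ β := by
  rw [abs_div, abs_of_pos (scale_pos i)]
  exact (div_le_self (abs_nonneg _) (one_le_scale i)).trans (hW e)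

theorem abs_imbalance_le (hval : ∀ k < D.s, |D.val k| ≤ U) (hW : ∀ e, |W e| ≤ β)
    (hV : ∀ j, |V j| ≤ η) (hk : k < D.s) : |D.imbalance W V k| ≤ 4 * β + U * η := by
  have hforce : |(W (4 * k) + W (4 * k + 1) + W (4 * k + 2) + W (4 * k + 3)) /
      D.scale (D.row k)| ≤ 4 * β := by
    simp only [add_div]
    calc _ ≤ |W (4 * k) / D.scale (D.row k)| + |W (4 * k + 1) / D.scale (D.row k)| +
          |W (4 * k + 2) / D.scale (D.row k)| + |W (4 * k + 3) / D.scale (D.row k)| :=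
          (abs_add_le _ _).trans (add_le_add_left (abs_add_three _ _ _) _)
      _ ≤ β + β + β + β := by gcongr <;> exact abs_div_scale_le hW _ _
      _ = 4 * β := by ring
  have hcol : |D.val k * V (D.col k)| ≤ U * η := by
    rw [abs_mul]
    exact mul_le_mul (hval k hk) (hV _) (abs_nonneg _) ((abs_nonneg _).trans (hval k hk))
  exact (abs_sub _ _).trans (add_le_add hforce hcol)

namespace IsBalanced

variable (hD : D.IsBalanced)
include hD

theorem div_abs_val_le {x : ℝ} (hx : 0 ≤ x) (hk : k < D.s) : x / |D.val k| ≤ x :=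
  div_le_self hx (hD.one_le_abs_val k hk)

theorem div_height_le {x : ℝ} (hx : 0 ≤ x) (hk : k < D.s) : x / D.height k ≤ 2 * x := by
  rw [div_le_iff₀ (hD.height_pos hk)]
  nlinarith [hD.half_le_height hk]

variable {γ : ℝ} (himbalance : ∀ k < D.s, |D.imbalance W V k| ≤ γ)
include himbalance

theorem abs_chainX_le (hk : k ≤ D.s) (hi : i < D.m) : |D.chainX W V k i| ≤ 2 * γ := by
  have hload := hD.half_mass_le_load hk hi
  have hnum : |D.rowSum (D.imbalance W V) k i| ≤ D.mass i * γ :=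
    calc |D.rowSum (D.imbalance W V) k i|
        ≤ D.rowSum (fun l => |D.imbalance W V l|) D.s i :=
          (D.abs_rowSum_le fun l _ => le_rfl).trans
            (D.rowSum_le_rowSum_of_le (fun l => abs_nonneg _) hk)
      _ ≤ D.rowSum (fun l => |D.val l| * γ) D.s i := D.rowSum_le_rowSum fun l hl =>
          (himbalance l hl).trans (le_mul_of_one_le_left ((abs_nonneg _).trans (himbalance l hl))
            (hD.one_le_abs_val l hl))
      _ = D.mass i * γ := by rw [mass, rowSum, rowSum, sum_mul]
  have hmass := hD.mass_pos hi
  have hγ : 0 ≤ γ := nonneg_of_mul_nonneg_right ((abs_nonneg _).trans hnum) hmass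
  rw [chainX, abs_div, abs_neg, abs_of_pos (hD.load_pos hk hi), div_le_iff₀ (hD.load_pos hk hi)]
  nlinarith

theorem abs_rise_le (hW : ∀ e, |W e| ≤ β) (hβ : 4 * β ≤ γ) (hk : k < D.s) :
    |D.rise W V k| ≤ 7 * γ := by
  have hval := hD.one_le_abs_val k hk
  have hheight := hD.half_le_height hk
  have hγ : 0 ≤ γ := (abs_nonneg _).trans (himbalance k hk)
  have hchain := hD.abs_chainX_le himbalance (show k + 1 ≤ D.s from hk) (hD.row_lt k hk)
  have hnum : |W (4 * k + 3) / D.scale (D.row k) - D.imbalance W V k -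
      D.val k * D.chainX W V (k + 1) (D.row k)| ≤ β + γ + |D.val k| * (2 * γ) :=
    (abs_sub _ _).trans <| add_le_add ((abs_sub _ _).trans
      (add_le_add (abs_div_scale_le hW _ _) (himbalance k hk)))
      (by rw [abs_mul]; exact mul_le_mul_of_nonneg_left hchain (abs_nonneg _))
  rw [rise, abs_div, abs_mul, abs_of_pos (hD.height_pos hk),
    div_le_iff₀ (by have := hD.height_pos hk; positivity)]
  have hprod : |D.val k| / 2 ≤ |D.val k| * D.height k := by nlinarith
  nlinarith

theorem abs_solX_le (hW : ∀ e, |W e| ≤ β) (hβ : 4 * β ≤ γ) (hV : ∀ j, |V j| ≤ γ) {p : Joint}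
    (hp : D.IsJoint p) : |D.solX W V p| ≤ 2 * γ := by
  have hγ : 0 ≤ γ := (abs_nonneg _).trans (hV 0)
  cases p with
  | column j => exact (hV j).trans (by linarith)
  | anchor i => simpa [solX] using hγ
  | foot k =>
    rw [solX, ← div_div]
    refine (abs_sub _ _).trans ?_
    have hforce : |W (4 * k) / D.scale (D.row k) / D.val k| ≤ β := by
      rw [abs_div]
      exact (hD.div_abs_val_le (abs_nonneg _) hp).trans (abs_div_scale_le hW _ _)
    linarith [hV (D.col k)]
  | head k => exact hD.abs_chainX_le himbalance hp (hD.row_lt k hp)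

theorem abs_solY_le (hW : ∀ e, |W e| ≤ β) (hβ : 4 * β ≤ γ) {p : Joint} (hp : D.IsJoint p) :
    |D.solY W V p| ≤ 8 * D.s * γ := by
  have hγ : 0 ≤ γ := by linarith [(abs_nonneg _).trans (hW 0)]
  have hrise : ∀ k ≤ D.s, ∀ i, |D.rowSum (D.rise W V) k i| ≤ 7 * D.s * γ := fun k hk i =>
    calc |D.rowSum (D.rise W V) k i| ≤ D.rowSum (fun _ => 7 * γ) k i :=
          D.abs_rowSum_le fun l hl => hD.abs_rise_le himbalance hW hβ (hl.trans_le hk)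
      _ = D.rank k i * (7 * γ) := rowSum_const _ _ _
      _ ≤ D.s * (7 * γ) := by gcongr; exact rank_le hk i
      _ = 7 * D.s * γ := by ring
  cases p with
  | column j => simpa [solY] using by positivity
  | anchor i => simpa [solY] using by positivity
  | foot k =>
    have hs : γ ≤ D.s * γ := le_mul_of_one_le_left hγ (by exact_mod_cast (Nat.zero_lt_of_lt hp))
    have hforce : |W (4 * k + 1) / D.scale (D.row k) / D.val k / D.height k| ≤ 2 * β := by
      rw [abs_div _ (D.height k), abs_of_pos (hD.height_pos hp), abs_div _ (D.val k)]
      refine (hD.div_height_le (by positivity) hp).trans (mul_le_mul_of_nonneg_left ?_ two_pos.le)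
      exact (hD.div_abs_val_le (abs_nonneg _) hp).trans (abs_div_scale_le hW _ _)
    rw [solY, ← div_div, ← div_div]
    refine (abs_sub _ _).trans ?_
    linarith [hrise k (le_of_lt hp) (D.row k)]
  | head k =>
    rw [solY]
    exact (hrise (k + 1) hp (D.row k)).trans (by gcongr; norm_num)

end IsBalanced

end SolutionBounds

section JoinDisplacements

/-- The displacements of the joints as one vector. -/
def joinDisplacements (D : SparseSystem) (X Y : Joint → ℝ) :
    EuclideanSpace ℝ (Fin (D.numJoints * 2)) :=
  WithLp.toLp 2 fun c => if (c : ℕ) % 2 = 0 then X (D.jointAt (c / 2)) else Y (D.jointAt (c / 2))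

theorem displacement_joinDisplacements_zero (X Y : Joint → ℝ) {p : Joint} (hp : D.IsJoint p) :
    displacement (D.joinDisplacements X Y) 0 p = X p := by
  have := index_lt hp
  rw [displacement, coord_of_lt _ (show 2 * D.index p + 0 < D.numJoints * 2 by omega)]
  simp [joinDisplacements, jointAt_index hp]

theorem displacement_joinDisplacements_one (X Y : Joint → ℝ) {p : Joint} (hp : D.IsJoint p) :
    displacement (D.joinDisplacements X Y) 1 p = Y p := by
  have := index_lt hp
  rw [displacement, coord_of_lt _ (show 2 * D.index p + 1 < D.numJoints * 2 by omega)]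
  simp [joinDisplacements, Nat.add_mod, show (2 * D.index p + 1) / 2 = D.index p by omega,
    jointAt_index hp]

theorem act_truss_joinDisplacements (hD : D.IsBalanced) (X Y : Joint → ℝ) (e : Fin D.numBars) :
    act D.truss (D.joinDisplacements X Y) e = (D.bar e).form X Y := by
  simp only [act_truss hD, Bar.form,
    displacement_joinDisplacements_zero X Y (hD.isJoint_src e.2),
    displacement_joinDisplacements_zero X Y (isJoint_tgt e.2),
    displacement_joinDisplacements_one X Y (hD.isJoint_src e.2),
    displacement_joinDisplacements_one X Y (isJoint_tgt e.2)]

theorem norm_joinDisplacements_le (hm : D.m ≤ D.s) (hn : D.n ≤ D.s) {X Y : Joint → ℝ} {M : ℝ}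
    (hM : 0 ≤ M) (hX : ∀ p, D.IsJoint p → |X p| ≤ M) (hY : ∀ p, D.IsJoint p → |Y p| ≤ M) :
    ‖D.joinDisplacements X Y‖ ≤ 3 * √D.s * M := by
  have hcoord : ∀ c, |D.joinDisplacements X Y c| ≤ M := fun c => by
    have hp : D.IsJoint (D.jointAt (c / 2)) := isJoint_jointAt (by omega)
    simp only [joinDisplacements]
    split_ifs
    exacts [hX _ hp, hY _ hp]
  refine (norm_le_sqrt_mul _ hM hcoord).trans (mul_le_mul_of_nonneg_right ?_ hM)
  have hm' : (D.m : ℝ) ≤ D.s := by exact_mod_cast hm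
  have hn' : (D.n : ℝ) ≤ D.s := by exact_mod_cast hn
  rw [Real.sqrt_le_left (by positivity), mul_pow, Real.sq_sqrt (Nat.cast_nonneg _), numJoints]
  push_cast
  linarith

end JoinDisplacements

section EntryBounds

variable {U : ℝ}

theorem abs_truss_eq_zero_or_component (hD : D.IsBalanced) (e : Fin D.numBars)
    (c : Fin (D.numJoints * 2)) :
    D.truss e c = 0 ∨ |D.truss e c| = |(D.bar e).component (c % 2)| := by
  have hne := (hD.index_src_lt_index_tgt e.2).ne
  rw [truss, coeff]
  split_ifs with hsrc htgt
  · exact absurd (hsrc.symm.trans htgt) hne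
  · exact .inr (by rw [sub_zero])
  · exact .inr (by rw [zero_sub, abs_neg])
  · exact .inl (sub_zero 0)

section Range

variable (hD : D.IsBalanced) (hval : ∀ k < D.s, |D.val k| ≤ U) {k i : ℕ}

include hval in
theorem le_s_mul (hk : k < D.s) : U ≤ D.s * U :=
  le_mul_of_one_le_left ((abs_nonneg _).trans (hval k hk)) (by exact_mod_cast Nat.zero_lt_of_lt hk)

include hD hval

theorem abs_val_mem_Icc (hk : k < D.s) : |D.val k| ∈ Set.Icc (1 / 2) (2 * (D.s * U)) := by
  have := hD.one_le_abs_val k hk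
  have := hval k hk
  have := le_s_mul hval hk
  constructor <;> linarith

theorem abs_val_mul_height_mem_Icc (hk : k < D.s) :
    |D.val k * D.height k| ∈ Set.Icc (1 / 2) (2 * (D.s * U)) := by
  have hlow := hD.one_le_abs_val k hk
  have hhigh := hval k hk
  have hU := le_s_mul hval hk
  rw [abs_mul, abs_of_pos (hD.height_pos hk)]
  constructor <;> nlinarith [hD.half_le_height hk, hD.height_le_two hk]

theorem mass_mem_Icc (hi : i < D.m) : D.mass i ∈ Set.Icc 2 (D.s * U) := by
  obtain ⟨k, hk, -⟩ := hD.exists_row_eq i hi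
  exact ⟨hD.two_le_mass hi, mass_le hval ((abs_nonneg _).trans (hval k hk)) i⟩

theorem abs_load_mem_Icc (hk : k < D.s) :
    |D.load k (D.row k)| ∈ Set.Icc (1 / 2) (2 * (D.s * U)) := by
  have hi := hD.row_lt k hk
  have hmass := mass_mem_Icc hD hval hi
  rw [abs_of_pos (hD.load_row_pos hk)]
  exact ⟨by linarith [hmass.1, hD.half_mass_le_load hk.le hi],
    by linarith [hmass.2, load_le_two_mul_mass hk.le (D.row k)]⟩

theorem abs_mass_mem_Icc (hi : i < D.m) : |D.mass i| ∈ Set.Icc (1 / 2) (2 * (D.s * U)) := by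
  obtain ⟨hlow, hhigh⟩ := mass_mem_Icc hD hval hi
  rw [abs_of_pos (hD.mass_pos hi)]
  constructor <;> linarith

theorem component_eq_zero_or_abs_mem (a : ℕ) : ∀ e < D.numBars,
    (D.bar e).component a = 0 ∨ ∃ i, ∃ z ∈ Set.Icc (1 / 2) (2 * (D.s * U)),
      |(D.bar e).component a| = D.scale i * z := by
  have hscale : ∀ i x, |x| ∈ Set.Icc (1 / 2) (2 * (D.s * U)) → D.scale i * x = 0 ∨
      ∃ i', ∃ z ∈ Set.Icc (1 / 2) (2 * (D.s * U)), |D.scale i * x| = D.scale i' * z :=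
    fun i x hx => .inr ⟨i, |x|, hx, by rw [abs_mul, abs_of_pos (scale_pos i)]⟩
  refine forall_bar (P := fun _ b => b.component a = 0 ∨ ∃ i, ∃ z ∈ Set.Icc (1 / 2)
    (2 * (D.s * U)), |b.component a| = D.scale i * z) (fun k hk => ?_) (fun k hk => ?_)
    (fun k hk => ?_) (fun k hk => ?_) (fun i hi => ?_) <;> unfold Bar.component <;> split_ifs
  · exact hscale _ _ (abs_val_mem_Icc hD hval hk)
  · exact .inl rfl
  · exact .inl rfl
  · simpa only [postBar, mul_assoc] using hscale _ _ (abs_val_mul_height_mem_Icc hD hval hk)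
  · exact hscale _ _ (abs_val_mem_Icc hD hval hk)
  · simpa only [braceBar, mul_assoc] using hscale _ _ (abs_val_mul_height_mem_Icc hD hval hk)
  · exact hscale _ _ (abs_load_mem_Icc hD hval hk)
  · simpa only [chainBar, mul_assoc, neg_eq_zero, abs_neg] using
      hscale _ _ (abs_val_mul_height_mem_Icc hD hval hk)
  · simpa only [closingBar, neg_eq_zero, abs_neg] using
      hscale _ _ (abs_mass_mem_Icc hD hval hi)
  · exact .inl rfl

theorem abs_component_le (hs : 1 ≤ D.s) {e : ℕ} (he : e < D.numBars) (a : ℕ) :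
    |(D.bar e).component a| ≤ 5 * (D.s * √D.s) * U := by
  have hU : 0 ≤ U := (abs_nonneg _).trans (hval 0 hs)
  obtain h | ⟨i, z, hz, h⟩ := component_eq_zero_or_abs_mem hD hval a e he
  · rw [h, abs_zero]
    positivity
  · rw [h]
    calc D.scale i * z ≤ 5 / 2 * √D.s * (2 * (D.s * U)) :=
          mul_le_mul (scale_le hs i) hz.2 (by linarith [hz.1]) (by positivity)
      _ = 5 * (D.s * √D.s) * U := by ring

theorem half_le_abs_component {e : ℕ} (he : e < D.numBars) {a : ℕ}
    (ha : (D.bar e).component a ≠ 0) :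
    1 / 2 ≤ |(D.bar e).component a| := by
  obtain h | ⟨i, z, hz, h⟩ := component_eq_zero_or_abs_mem hD hval a e he
  · exact absurd h ha
  · rw [h]
    nlinarith [hz.1, one_le_scale (D := D) i]

end Range

section Singular

variable (hD : D.IsBalanced) (hval : ∀ k < D.s, |D.val k| ≤ U)
include hD hval

theorem abs_truss_le (hs : 1 ≤ D.s) (e : Fin D.numBars) (c : Fin (D.numJoints * 2)) :
    |D.truss e c| ≤ 5 * (D.s * √D.s) * U := by
  have hU : 0 ≤ U := (abs_nonneg _).trans (hval 0 hs)
  obtain h | h := abs_truss_eq_zero_or_component hD e c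
  · rw [h, abs_zero]
    positivity
  · exact h.trans_le (abs_component_le hD hval hs e.2 _)

theorem half_le_abs_truss {e : Fin D.numBars} {c : Fin (D.numJoints * 2)}
    (hne : D.truss e c ≠ 0) : 1 / 2 ≤ |D.truss e c| := by
  have h := (abs_truss_eq_zero_or_component hD e c).resolve_left hne
  rw [h]
  exact half_le_abs_component hD hval e.2 (abs_ne_zero.1 (h ▸ abs_ne_zero.2 hne))

theorem abs_act_truss_le (hs : 1 ≤ D.s) (y : EuclideanSpace ℝ (Fin (D.numJoints * 2)))
    (e : Fin D.numBars) : |act D.truss y e| ≤ 20 * (D.s * √D.s) * U * ‖y‖ := by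
  have hU : 0 ≤ U := (abs_nonneg _).trans (hval 0 hs)
  have hterm : ∀ f a p q, |f| ≤ 5 * (D.s * √D.s) * U →
      |f * (displacement y a p - displacement y a q)| ≤ 10 * (D.s * √D.s) * U * ‖y‖ :=
    fun f a p q hf => by
      have hdiff : |displacement y a p - displacement y a q| ≤ 2 * ‖y‖ :=
        (abs_sub _ _).trans (by
          rw [two_mul]; exact add_le_add (abs_coord_le_norm y _) (abs_coord_le_norm y _))
      rw [abs_mul]
      calc |f| * _ ≤ 5 * (D.s * √D.s) * U * (2 * ‖y‖) :=
            mul_le_mul hf hdiff (abs_nonneg _) (by positivity)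
        _ = 10 * (D.s * √D.s) * U * ‖y‖ := by ring
  rw [act_truss hD, Bar.form]
  calc _ ≤ 10 * (D.s * √D.s) * U * ‖y‖ + 10 * (D.s * √D.s) * U * ‖y‖ :=
        (abs_add_le _ _).trans (add_le_add
          (hterm _ 0 _ _ (abs_component_le hD hval hs e.2 0))
          (hterm _ 1 _ _ (abs_component_le hD hval hs e.2 1)))
    _ = 20 * (D.s * √D.s) * U * ‖y‖ := by ring

theorem sigmaMax_truss_le (hs : 1 ≤ D.s) (hm : D.m ≤ D.s) :
    sigmaMax D.truss ≤ 50 * D.s ^ 2 * U := by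
  have hU : 0 ≤ U := (abs_nonneg _).trans (hval 0 hs)
  have hbars : √D.numBars ≤ 5 / 2 * √D.s := by
    have hm' : (D.m : ℝ) ≤ D.s := by exact_mod_cast hm
    rw [Real.sqrt_le_left (by positivity), mul_pow, Real.sq_sqrt (Nat.cast_nonneg _), numBars]
    push_cast
    linarith
  refine sigmaMax_le (by positivity) fun y => ?_
  calc ‖act D.truss y‖ ≤ √D.numBars * (20 * (D.s * √D.s) * U * ‖y‖) :=
        norm_le_sqrt_mul _ (by positivity) (abs_act_truss_le hD hval hs y)
    _ ≤ 5 / 2 * √D.s * (20 * (D.s * √D.s) * U * ‖y‖) := by gcongr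
    _ = 50 * D.s * √D.s ^ 2 * U * ‖y‖ := by ring
    _ = 50 * D.s ^ 2 * U * ‖y‖ := by rw [Real.sq_sqrt (Nat.cast_nonneg _)]; ring

variable {A : Matrix (Fin D.m) (Fin D.n) ℝ} (hA : D.Represents A) (hs : 1 ≤ D.s) (hm : D.m ≤ D.s)
  (hn : D.n ≤ D.s)
include hA hs hm hn

theorem exists_act_truss_eq (hU : 1 ≤ U) {w : EuclideanSpace ℝ (Fin D.numBars)}
    {u : EuclideanSpace ℝ (Fin D.n)} (h : act D.spread.transpose w = act A u) :
    ∃ y, act D.truss y = w ∧ ‖y‖ ≤ 3 * √D.s * (8 * D.s * (4 * ‖w‖ + U * ‖u‖)) := by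
  have hsum : ∀ i < D.m, ∑ e ∈ range D.numBars with (D.bar e).owner = i, coord w e =
      D.scale i * D.rowSum (fun l => D.val l * coord u (D.col l)) D.s i := fun i hi => by
    have hi' := congrArg (fun v : EuclideanSpace ℝ (Fin D.m) => v ⟨i, hi⟩) h
    simp only [act_spread_transpose, hA u ⟨i, hi⟩] at hi'
    rw [div_eq_iff (scale_pos _).ne'] at hi'
    rw [hi', mul_comm]
  set γ := 4 * ‖w‖ + U * ‖u‖
  have hu : ‖u‖ ≤ U * ‖u‖ := le_mul_of_one_le_left (norm_nonneg _) hU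
  have hβ : 4 * ‖w‖ ≤ γ := le_add_of_nonneg_right ((norm_nonneg u).trans hu)
  have hη : ‖u‖ ≤ γ := hu.trans (le_add_of_nonneg_left (by positivity))
  have himbalance : ∀ k < D.s, |D.imbalance (coord w) (coord u) k| ≤ γ := fun k =>
    abs_imbalance_le hval (abs_coord_le_norm w) (abs_coord_le_norm u)
  refine ⟨D.joinDisplacements (D.solX (coord w) (coord u)) (D.solY (coord w) (coord u)), ?_,
    norm_joinDisplacements_le hm hn (by positivity) (fun p hp => ?_)
      (fun p hp => hD.abs_solY_le himbalance (abs_coord_le_norm w) hβ hp)⟩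
  · ext e
    rw [act_truss_joinDisplacements hD, hD.form_bar_sol hsum e e.2, coord_val]
  · refine (hD.abs_solX_le himbalance (abs_coord_le_norm w) hβ
      (fun j => (abs_coord_le_norm u j).trans hη) hp).trans ?_
    have hs' : (1 : ℝ) ≤ D.s := by exact_mod_cast hs
    exact mul_le_mul_of_nonneg_right (by linarith) (by positivity)

theorem exists_norm_le_mul_norm_act_truss (hU : 1 ≤ U) (hmax : 1 ≤ sigmaMax A) (hA0 : A ≠ 0)
    (x : EuclideanSpace ℝ (Fin (D.numJoints * 2))) :
    ∃ y, act D.truss y = act D.truss x ∧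
      ‖y‖ ≤ 120 * (D.s ^ 2 * U * condNumber A) * ‖act D.truss x‖ := by
  obtain ⟨u, hu, hnorm⟩ := exists_act_eq_sigmaMax_mul_norm_le hA0 (recover x)
  rw [← act_spread_transpose_act_truss hD hA] at hu hnorm
  obtain ⟨y, hy, hynorm⟩ := exists_act_truss_eq hD hval hA hs hm hn hU hu.symm
  refine ⟨y, hy, hynorm.trans ?_⟩
  have hK := one_le_condNumber hA0
  set w := act D.truss x
  have hunorm : ‖u‖ ≤ condNumber A * ‖w‖ :=
    calc ‖u‖ ≤ sigmaMax A * ‖u‖ := le_mul_of_one_le_left (norm_nonneg _) hmax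
      _ ≤ condNumber A * ‖act D.spread.transpose w‖ := hnorm
      _ ≤ condNumber A * ‖w‖ := by
          gcongr
          exact norm_act_transpose_le_of_transpose_mul_self spread_transpose_mul_spread w
  have hsqrt : √D.s ≤ D.s := Real.sqrt_le_self_iff.2 (.inr (by exact_mod_cast hs))
  have hw : ‖w‖ ≤ U * condNumber A * ‖w‖ :=
    le_mul_of_one_le_left (norm_nonneg _) (one_le_mul_of_one_le_of_one_le hU hK)
  calc 3 * √D.s * (8 * D.s * (4 * ‖w‖ + U * ‖u‖))
      ≤ 3 * D.s * (8 * D.s * (4 * (U * condNumber A * ‖w‖) + U * (condNumber A * ‖w‖))) := by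
        gcongr
    _ = 120 * (D.s ^ 2 * U * condNumber A) * ‖w‖ := by ring

theorem condNumber_truss_le (hU : 1 ≤ U) (hmax : 1 ≤ sigmaMax A) (hA0 : A ≠ 0)
    (htruss : D.truss ≠ 0) :
    condNumber D.truss ≤ 6000 * (condNumber A * D.s ^ 4 * U ^ 2) := by
  have : (1 : ℝ) ≤ D.s := by exact_mod_cast hs
  have hK := one_le_condNumber hA0
  have hmin : (120 * (D.s ^ 2 * U * condNumber A))⁻¹ ≤ sigmaMin D.truss :=
    inv_le_sigmaMin htruss (by positivity)
      (exists_norm_le_mul_norm_act_truss hD hval hA hs hm hn hU hmax hA0)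
  have hpos : 0 < sigmaMin D.truss := hmin.trans_lt' (by positivity)
  rw [condNumber, div_le_iff₀ hpos]
  calc sigmaMax D.truss ≤ 50 * D.s ^ 2 * U := sigmaMax_truss_le hD hval hs hm
    _ = 6000 * (condNumber A * D.s ^ 4 * U ^ 2) * (120 * (D.s ^ 2 * U * condNumber A))⁻¹ := by
        field_simp
        ring
    _ ≤ 6000 * (condNumber A * D.s ^ 4 * U ^ 2) * sigmaMin D.truss := by gcongr

end Singular

end EntryBounds

end SparseSystem

/-! ### The geometry of the truss -/

namespace SparseSystem

section Positions

variable (D : SparseSystem)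

/-- The horizontal position of the end of the chain of row `i` after its first `r` entries. The
chains of different rows are placed side by side. -/
def slot (i r : ℕ) : ℕ := i * (D.s + 1) + r

/-- The horizontal positions of the joints. -/
def posX : Joint → ℝ
  | .column j => -(j + 1)
  | .anchor i => D.slot i 0
  | .foot k => D.slot (D.row k) (D.rank k (D.row k))
  | .head k => D.slot (D.row k) (D.rank (k + 1) (D.row k))

/-- The vertical positions of the joints. -/
def posY : Joint → ℝ
  | .column _ => 0
  | .anchor _ => 1
  | .foot _ => 0
  | .head k => D.height k

variable {D} {i k : ℕ}

theorem slot_inj {i' r r' : ℕ} (hr : r ≤ D.s) (hr' : r' ≤ D.s) :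
    D.slot i r = D.slot i' r' ↔ i = i' ∧ r = r' := by
  refine ⟨fun h => ?_, fun ⟨hi, hr⟩ => by rw [hi, hr]⟩
  have hdiv : ∀ {i r}, r ≤ D.s → D.slot i r / (D.s + 1) = i := fun {i r} hr => by
    rw [slot, mul_comm, Nat.mul_add_div D.s.succ_pos, Nat.div_eq_of_lt (Nat.lt_succ_of_le hr),
      add_zero]
  obtain rfl : i = i' := (hdiv hr).symm.trans ((congrArg (· / (D.s + 1)) h).trans (hdiv hr'))
  exact ⟨rfl, Nat.add_left_cancel h⟩

theorem posX_last (k i : ℕ) : D.posX (D.last k i) = D.slot i (D.rank k i) :=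
  apply_last (f := D.posX) (g := fun k i => (D.slot i (D.rank k i) : ℝ))
    (by simp only [posX, rank_zero]) (fun _ h => by simp only [posX, h])
    (fun _ h => by simp only [rank_succ_of_ne h]) k

theorem posX_head (k : ℕ) : D.posX (.head k) = D.posX (.foot k) + 1 := by
  simp only [posX, slot, rank_succ_self]
  push_cast
  ring

theorem posX_foot (k : ℕ) : D.posX (.foot k) = D.posX (D.last k (D.row k)) := by
  rw [posX_last, posX]

namespace IsBalanced

variable (hD : D.IsBalanced)
include hD

theorem posY_last (hi : i < D.m) : ∀ k, D.posY (D.last k i) = D.mass i / D.load k i :=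
  apply_last (f := D.posY) (g := fun k i => D.mass i / D.load k i)
    (by simp only [posY, load_zero, div_self (hD.mass_pos hi).ne'])
    (fun _ h => by simp only [posY, height, h]) (fun _ h => by simp only [load_succ_of_ne h])

theorem eq_of_pos_eq {p q : Joint} (hp : D.IsJoint p) (hq : D.IsJoint q)
    (hx : D.posX p = D.posX q) (hy : D.posY p = D.posY q) : p = q := by
  have hcolumn : ∀ j i r : ℕ, -((j : ℝ) + 1) ≠ D.slot i r := fun j i r =>
    ((neg_neg_of_pos j.cast_add_one_pos).trans_le (Nat.cast_nonneg _)).ne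
  have hanchor_head : ∀ i k, k < D.s → D.slot i 0 ≠ D.slot (D.row k) (D.rank (k + 1) (D.row k)) :=
    fun i k hk h => by
      have := ((slot_inj D.s.zero_le (rank_le hk _)).1 h).2
      rw [rank_succ_self] at this
      omega
  have hheight : ∀ k < D.s, 0 < D.height k := fun k => hD.height_pos
  cases p <;> cases q <;> simp only [posX, posY, Nat.cast_inj] at hx hy <;>
    simp only [IsJoint] at hp hq
  case column.column => simpa using hx
  case anchor.anchor => rw [((slot_inj D.s.zero_le D.s.zero_le).1 hx).1]
  case foot.foot =>
    obtain ⟨hrow, hrank⟩ := (slot_inj (rank_le hp.le _) (rank_le hq.le _)).1 hx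
    rw [eq_of_rank_eq hrow hrank]
  case head.head =>
    obtain ⟨hrow, hrank⟩ := (slot_inj (rank_le hp _) (rank_le hq _)).1 hx
    rw [rank_succ_self, rank_succ_self] at hrank
    rw [eq_of_rank_eq hrow (Nat.succ_injective hrank)]
  case anchor.head => exact absurd hx (hanchor_head _ _ hq)
  case head.anchor => exact absurd hx.symm (hanchor_head _ _ hp)
  case foot.head => exact absurd hy (hheight _ hq).ne
  case head.foot => exact absurd hy (hheight _ hp).ne'
  case anchor.foot => exact absurd hy one_ne_zero
  case foot.anchor => exact absurd hy zero_ne_one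
  all_goals first | exact absurd hx (hcolumn _ _ _) | exact absurd hx.symm (hcolumn _ _ _)

end IsBalanced

end Positions

section Weights

variable {D : SparseSystem} {i k : ℕ}

/-- The force of the bar has the direction of the bar. -/
def IsAxial (D : SparseSystem) (b : Bar) : Prop :=
  ∃ w : ℝ, b.fx = w * (D.posX b.src - D.posX b.tgt) ∧ b.fy = w * (D.posY b.src - D.posY b.tgt)

theorem isAxial_tieBar (k : ℕ) : D.IsAxial (D.tieBar k) := by
  have hne : D.posX (.column (D.col k)) - D.posX (.foot k) ≠ 0 := by
    simp only [posX]
    linarith [(D.slot (D.row k) (D.rank k (D.row k))).cast_nonneg (α := ℝ),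
      (D.col k).cast_nonneg (α := ℝ)]
  exact ⟨_, (div_mul_cancel₀ _ hne).symm, by simp [tieBar, posY]⟩

theorem isAxial_braceBar (k : ℕ) : D.IsAxial (D.braceBar k) := by
  refine ⟨-(D.scale (D.row k) * D.val k), ?_, ?_⟩
  · simp only [braceBar, posX_head]
    ring
  · simp only [braceBar, posY]
    ring

namespace IsBalanced

variable (hD : D.IsBalanced)
include hD

theorem isAxial_postBar (hk : k < D.s) : D.IsAxial (D.postBar k) := by
  have hi := hD.row_lt k hk
  have hne : D.posY (D.last k (D.row k)) - D.posY (.foot k) ≠ 0 := by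
    rw [hD.posY_last hi, posY, sub_zero]
    exact (div_pos (hD.mass_pos hi) (hD.load_row_pos hk)).ne'
  exact ⟨_, by simp [postBar, posX_foot], (div_mul_cancel₀ _ hne).symm⟩

theorem isAxial_chainBar (hk : k < D.s) : D.IsAxial (D.chainBar k) := by
  have hi := hD.row_lt k hk
  have hleft : D.load k (D.row k) * (D.mass (D.row k) / D.load k (D.row k)) = D.mass (D.row k) :=
    mul_div_cancel₀ _ (hD.load_row_pos hk).ne'
  have hright := hD.height_mul_load hk
  rw [load_succ_self] at hright
  refine ⟨-(D.scale (D.row k) * D.load k (D.row k)), ?_, ?_⟩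
  · simp only [chainBar, posX_head, posX_foot]
    ring
  · simp only [chainBar, hD.posY_last hi]
    simp only [posY]
    linear_combination D.scale (D.row k) * (hleft - hright)

theorem isAxial_closingBar (hi : i < D.m) : D.IsAxial (D.closingBar i) := by
  have hrank : (D.rank D.s i : ℝ) ≠ 0 := by
    exact_mod_cast (two_pos.trans_le (hD.two_le_rank hi)).ne'
  refine ⟨D.scale i * D.mass i / D.rank D.s i, ?_, ?_⟩
  · simp only [closingBar, posX_last]
    simp only [posX, slot]
    push_cast
    field_simp
    ring
  · simp only [closingBar, hD.posY_last hi, hD.load_s hi, div_self (hD.mass_pos hi).ne']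
    simp only [posY, sub_self, mul_zero]

theorem isAxial_bar : ∀ e < D.numBars, D.IsAxial (D.bar e) :=
  forall_bar (P := fun _ => D.IsAxial) (fun k _ => isAxial_tieBar k)
    (fun _ => hD.isAxial_postBar) (fun k _ => isAxial_braceBar k) (fun _ => hD.isAxial_chainBar)
    fun _ => hD.isAxial_closingBar

end IsBalanced

end Weights

section Edges

variable {D : SparseSystem}

/-- The number of the bar between two given joints. -/
def barNumber (D : SparseSystem) : Joint → Joint → ℕ
  | .column _, .foot k => 4 * k
  | _, .foot k => 4 * k + 1
  | .foot _, .head k => 4 * k + 2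
  | .anchor i, .head k => if D.rank k i = 0 then 4 * k + 3 else 4 * D.s + i
  | _, .head k => 4 * k + 3
  | _, _ => 0

namespace IsBalanced

variable (hD : D.IsBalanced)
include hD

theorem barNumber_closingBar {i : ℕ} (hi : i < D.m) :
    D.barNumber (.anchor i) (D.last D.s i) = 4 * D.s + i := by
  have htwo := hD.two_le_rank hi
  obtain ⟨-, hrank⟩ | ⟨l, -, rfl, hlast, hrank⟩ := D.last_eq_anchor_or_head D.s i
  · omega
  · rw [rank_succ_self] at hrank
    rw [hlast, barNumber, if_neg (by omega)]

theorem barNumber_bar :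
    ∀ e < D.numBars, D.barNumber (D.bar e).src (D.bar e).tgt = e := by
  refine forall_bar (P := fun e b => D.barNumber b.src b.tgt = e) (fun k _ => rfl) (fun k _ => ?_)
    (fun k _ => rfl) (fun k _ => ?_) (fun i hi => hD.barNumber_closingBar hi)
  · obtain ⟨h, -⟩ | ⟨l, -, -, h, -⟩ := D.last_eq_anchor_or_head k (D.row k) <;>
      simp only [postBar, h, barNumber]
  · obtain ⟨h, hrank⟩ | ⟨l, -, -, h, -⟩ := D.last_eq_anchor_or_head k (D.row k)
    · simp only [chainBar, h, barNumber, hrank, if_true]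
    · simp only [chainBar, h, barNumber]

theorem truss2D_truss : Truss2D D.truss := by
  have hsrc := fun e : Fin D.numBars => index_lt (hD.isJoint_src e.2)
  have htgt := fun e : Fin D.numBars => index_lt (isJoint_tgt (D := D) e.2)
  have hlt := fun e : Fin D.numBars => hD.index_src_lt_index_tgt e.2
  choose w hwx hwy using fun e : Fin D.numBars => hD.isAxial_bar e e.2
  refine ⟨D.numJoints, rfl, fun v => ![D.posX (D.jointAt v), D.posY (D.jointAt v)],
    fun e => ⟨_, hsrc e⟩, fun e => ⟨_, htgt e⟩, w, ?_, ?_, ?_, ?_⟩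
  · intro v v' h
    have hjoint := hD.eq_of_pos_eq (isJoint_jointAt v.2) (isJoint_jointAt v'.2)
      (congrFun h 0) (congrFun h 1)
    exact Fin.ext (by rw [← index_jointAt v, hjoint, index_jointAt])
  · exact fun e h => (hlt e).ne (congrArg Fin.val h)
  · intro e e' h
    simp only [Sym2.eq_iff, Fin.mk.injEq] at h
    obtain ⟨hs, ht⟩ | ⟨hs, ht⟩ := h
    · have hsrc_eq : (D.bar e).src = (D.bar e').src := by
        rw [← jointAt_index (hD.isJoint_src e.2), hs, jointAt_index (hD.isJoint_src e'.2)]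
      have htgt_eq : (D.bar e).tgt = (D.bar e').tgt := by
        rw [← jointAt_index (isJoint_tgt e.2), ht, jointAt_index (isJoint_tgt e'.2)]
      exact Fin.ext (by rw [← hD.barNumber_bar e e.2, hsrc_eq, htgt_eq, hD.barNumber_bar e' e'.2])
    · exact absurd (hlt e) (by rw [hs, ht]; exact (hlt e').asymm)
  · intro e v a
    have hcol :
        (Fin.cast rfl (finProdFinEquiv (v, a)) : Fin (D.numJoints * 2)).val = 2 * v + a := by
      simp [add_comm]
    simp only [truss, hcol, coeff_two_mul_add _ _ a.2, Fin.ext_iff,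
      jointAt_index (hD.isJoint_src e.2), jointAt_index (isJoint_tgt e.2)]
    fin_cases a
    · simp [Bar.component, hwx]
    · simp [Bar.component, hwy]

end IsBalanced

end Edges

/-! ### The entries of the truss -/

section Entries

/-- The entry `x` in row `e` and column `c` of a matrix, as a list that is empty if `x` is zero. -/
def cell (e c : ℕ) (x : ℝ) : List (ℕ × ℕ × ℝ) := if x = 0 then [] else [(e, c, x)]

variable (D : SparseSystem)

/-- The columns in which the row of a bar may have non-zero entries. -/
def barColumns (b : Bar) : List ℕ :=
  [2 * D.index b.src, 2 * D.index b.src + 1, 2 * D.index b.tgt, 2 * D.index b.tgt + 1]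

/-- The non-zero entries of the row `e` that belongs to a bar. -/
def barEntries (e : ℕ) (b : Bar) : List (ℕ × ℕ × ℝ) :=
  cell e (2 * D.index b.src) b.fx ++ cell e (2 * D.index b.src + 1) b.fy ++
    cell e (2 * D.index b.tgt) (-b.fx) ++ cell e (2 * D.index b.tgt + 1) (-b.fy)

/-- The non-zero entries of the first `N` rows of the incidence matrix. -/
def trussEntries (N : ℕ) : List (ℕ × ℕ × ℝ) :=
  (List.range N).flatMap fun e => D.barEntries e (D.bar e)

variable {D} {b : Bar}

theorem map_filter_ne_zero (e : ℕ) (f : ℕ → ℝ) (l : List ℕ) :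
    (l.filter fun c => decide (f c ≠ 0)).map (fun c => (e, c, f c)) =
      l.flatMap fun c => cell e c (f c) := by
  induction l with
  | nil => rfl
  | cons c l ih =>
    rw [List.filter_cons, List.flatMap_cons, ← ih]
    by_cases hc : f c = 0 <;> simp [cell, hc]

theorem mem_barColumns_of_coeff_ne_zero {c : ℕ} (h : D.coeff b c ≠ 0) : c ∈ D.barColumns b := by
  have : c / 2 = D.index b.src ∨ c / 2 = D.index b.tgt := by
    by_contra! hc
    simp [coeff, hc.1, hc.2] at h
  simp only [barColumns, List.mem_cons, List.not_mem_nil, or_false]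
  omega

theorem filter_range_coeff_ne_zero {N : ℕ} (h : D.index b.src < D.index b.tgt)
    (hN : D.index b.tgt < N) :
    (List.range (N * 2)).filter (fun c => decide (D.coeff b c ≠ 0)) =
      (D.barColumns b).filter fun c => decide (D.coeff b c ≠ 0) := by
  have hsorted : (D.barColumns b).Pairwise (· < ·) := by
    simp only [barColumns, List.pairwise_cons, List.mem_cons, List.not_mem_nil, or_false,
      forall_eq_or_imp, forall_eq, false_implies, implies_true, List.Pairwise.nil, and_true]
    omega
  have hlt : ∀ c ∈ D.barColumns b, c < N * 2 := by
    simp only [barColumns, List.mem_cons, List.not_mem_nil, or_false, forall_eq_or_imp, forall_eq]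
    omega
  have hleft := (List.pairwise_lt_range (n := N * 2)).filter fun c => decide (D.coeff b c ≠ 0)
  have hright := hsorted.filter fun c => decide (D.coeff b c ≠ 0)
  refine List.Perm.eq_of_pairwise (fun _ _ _ _ hac hca => absurd hac hca.asymm) hleft hright
    ((List.perm_ext_iff_of_nodup (hleft.imp LT.lt.ne) (hright.imp LT.lt.ne)).2 fun c => ?_)
  simp only [List.mem_filter, List.mem_range, decide_eq_true_eq]
  exact ⟨fun hc => ⟨mem_barColumns_of_coeff_ne_zero hc.2, hc.2⟩, fun hc => ⟨hlt c hc.1, hc.2⟩⟩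

theorem flatMap_barColumns (e : ℕ) (h : D.index b.src < D.index b.tgt) :
    (D.barColumns b).flatMap (fun c => cell e c (D.coeff b c)) = D.barEntries e b := by
  have hsrc := fun a ha => D.coeff_two_mul_add b (D.index b.src) (a := a) ha
  have htgt := fun a ha => D.coeff_two_mul_add b (D.index b.tgt) (a := a) ha
  simp only [barColumns, barEntries, List.flatMap_cons, List.flatMap_nil, List.append_nil,
    List.append_assoc]
  rw [hsrc 1 one_lt_two, htgt 1 one_lt_two, ← add_zero (2 * D.index b.src), hsrc 0 two_pos,
    ← add_zero (2 * D.index b.tgt), htgt 0 two_pos]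
  simp [h.ne, h.ne', Bar.component]

theorem trussEntries_succ (N : ℕ) :
    D.trussEntries (N + 1) = D.trussEntries N ++ D.barEntries N (D.bar N) := by
  simp [trussEntries, List.range_succ]

theorem length_trussEntries (N : ℕ) :
    (D.trussEntries N).length = ∑ e ∈ range N, (D.barEntries e (D.bar e)).length := by
  induction N with
  | zero => rfl
  | succ N ih => rw [trussEntries_succ, List.length_append, ih, sum_range_succ]

namespace IsBalanced

variable (hD : D.IsBalanced)
include hD

theorem map_filter_truss_ne_zero (e : Fin D.numBars) :
    ((List.finRange (D.numJoints * 2)).filter fun c => decide (D.truss e c ≠ 0)).map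
      (fun c : Fin (D.numJoints * 2) => ((e : ℕ), (c : ℕ), D.truss e c)) =
        D.barEntries e (D.bar e) := by
  have hlt := hD.index_src_lt_index_tgt e.2
  calc
    _ = ((List.range (D.numJoints * 2)).filter fun c => decide (D.coeff (D.bar e) c ≠ 0)).map
          (fun c => ((e : ℕ), c, D.coeff (D.bar e) c)) := by
      rw [← List.map_coe_finRange_eq_range, List.filter_map, List.map_map]
      rfl
    _ = D.barEntries e (D.bar e) := by
      rw [filter_range_coeff_ne_zero hlt (index_lt (isJoint_tgt e.2)),
        map_filter_ne_zero e (D.coeff (D.bar e)), flatMap_barColumns _ hlt]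

theorem map_entries_truss :
    (entries D.truss).map (fun p => ((p.1 : ℕ), (p.2 : ℕ), D.truss p.1 p.2)) =
      D.trussEntries D.numBars := by
  have hprod : List.finRange D.numBars ×ˢ List.finRange (D.numJoints * 2) =
      (List.finRange D.numBars).flatMap fun e =>
        (List.finRange (D.numJoints * 2)).map (Prod.mk e) := rfl
  rw [trussEntries, ← List.map_coe_finRange_eq_range, List.flatMap_map]
  simp only [← hD.map_filter_truss_ne_zero]
  rw [entries, hprod, List.filter_flatMap, List.map_flatMap]
  simp only [List.filter_map, List.map_map]
  congr! 3

theorem nnz_truss_eq_length : nnz D.truss = (D.trussEntries D.numBars).length := by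
  rw [← hD.map_entries_truss, List.length_map, length_entries]

theorem length_barEntries_entry {k : ℕ} (hk : k < D.s) :
    (D.barEntries (4 * k) (D.bar (4 * k))).length +
        (D.barEntries (4 * k + 1) (D.bar (4 * k + 1))).length +
        (D.barEntries (4 * k + 2) (D.bar (4 * k + 2))).length +
        (D.barEntries (4 * k + 3) (D.bar (4 * k + 3))).length = 12 := by
  rw [bar_tie hk, bar_post hk, bar_brace hk, bar_chain hk]
  simp [barEntries, tieBar, postBar, braceBar, chainBar, cell, hD.val_ne_zero hk,
    (hD.height_pos hk).ne', (scale_pos (D := D) (D.row k)).ne', (hD.load_row_pos hk).ne']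

theorem length_barEntries_closing {i : ℕ} (hi : i < D.m) :
    (D.barEntries (4 * D.s + i) (D.bar (4 * D.s + i))).length = 2 := by
  rw [bar_closing]
  simp [barEntries, closingBar, cell, (hD.mass_pos hi).ne', (scale_pos (D := D) i).ne']

theorem nnz_truss : nnz D.truss = 12 * D.s + 2 * D.m := by
  rw [hD.nnz_truss_eq_length, length_trussEntries, numBars, sum_range_add, sum_range_four_mul,
    sum_congr rfl fun k hk => hD.length_barEntries_entry (mem_range.1 hk),
    sum_congr rfl fun i hi => hD.length_barEntries_closing (mem_range.1 hi)]
  simp [mul_comm]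

end IsBalanced

end Entries

end SparseSystem

/-! ### Reasoning about programs -/

/-- The unit in which the memory effects of programs are tracked: a register or a whole array. -/
inductive Loc : Type
  | idx (r : ℕ)
  | num (r : ℕ)
  | idxArr (a : ℕ)
  | numArr (a : ℕ)
  deriving DecidableEq

/-- The location that an instruction overwrites. -/
def Instr.dest : Instr → Loc
  | .idxConst d _ | .idxAdd d _ _ | .idxSub d _ _ | .idxLoad d _ _ => .idx d
  | .numConst d _ | .numOfIdx d _ | .numAdd d _ _ | .numSub d _ _ | .numMul d _ _
  | .numDiv d _ _ | .numSqrt d _ | .numLoad d _ _ => .num d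
  | .idxStore a _ _ => .idxArr a
  | .numStore a _ _ => .numArr a

/-- The locations that occur as destinations in a program. -/
def Prog.written : Prog → List Loc
  | .skip => []
  | .instr i => [i.dest]
  | .seq p q | .cond _ p q => p.written ++ q.written
  | .loop _ p => p.written

/-- The frame condition: `τ` differs from `σ` at most in the locations in `W`. -/
structure AgreesOff (W : List Loc) (σ τ : Store) : Prop where
  idx : ∀ r, .idx r ∉ W → τ.idx r = σ.idx r
  num : ∀ r, .num r ∉ W → τ.num r = σ.num r
  idxArr : ∀ a, .idxArr a ∉ W → τ.idxArr a = σ.idxArr a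
  numArr : ∀ a, .numArr a ∉ W → τ.numArr a = σ.numArr a

section Frame

variable {V W : List Loc} {σ τ υ : Store}

theorem AgreesOff.refl (W : List Loc) (σ : Store) : AgreesOff W σ σ :=
  ⟨fun _ _ => rfl, fun _ _ => rfl, fun _ _ => rfl, fun _ _ => rfl⟩

theorem AgreesOff.trans (h : AgreesOff W σ τ) (h' : AgreesOff W τ υ) : AgreesOff W σ υ :=
  ⟨fun r hr => (h'.idx r hr).trans (h.idx r hr), fun r hr => (h'.num r hr).trans (h.num r hr),
    fun a ha => (h'.idxArr a ha).trans (h.idxArr a ha),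
    fun a ha => (h'.numArr a ha).trans (h.numArr a ha)⟩

theorem AgreesOff.mono (h : AgreesOff V σ τ) (hVW : V ⊆ W) : AgreesOff W σ τ :=
  ⟨fun r hr => h.idx r fun hV => hr (hVW hV), fun r hr => h.num r fun hV => hr (hVW hV),
    fun a ha => h.idxArr a fun hV => ha (hVW hV), fun a ha => h.numArr a fun hV => ha (hVW hV)⟩

theorem Instr.agreesOff_apply (i : Instr) (σ : Store) : AgreesOff [i.dest] σ (i.apply σ) := by
  cases i <;> constructor <;> intro r hr <;>
    simp_all [Instr.dest, Instr.apply, Store.setIdx, Store.setNum, Store.setIdxArr,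
      Store.setNumArr]

theorem agreesOff_setIdx (σ : Store) (d v : ℕ) : AgreesOff [.idx d] σ (σ.setIdx d v) :=
  (Instr.idxConst d v).agreesOff_apply σ

theorem Exec.agreesOff {p : Prog} {t : ℕ} (h : Exec p σ t τ) : AgreesOff p.written σ τ := by
  induction h with
  | skip σ => exact .refl _ σ
  | instr i σ => exact i.agreesOff_apply σ
  | seq _ _ ihp ihq =>
    exact (ihp.mono (List.subset_append_left ..)).trans (ihq.mono (List.subset_append_right ..))
  | condTrue _ _ ih => exact ih.mono (List.subset_append_left ..)
  | condFalse _ _ ih => exact ih.mono (List.subset_append_right ..)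
  | loopFalse => exact .refl ..
  | loopTrue _ _ _ ihp ihl => exact ihp.trans ihl

end Frame

/-- The total-correctness judgement: started in `σ`, the program halts within `T` steps in a state
with property `Q`. -/
def Runs (p : Prog) (σ : Store) (T : ℕ) (Q : Store → Prop) : Prop :=
  ∃ t τ, t ≤ T ∧ Exec p σ t τ ∧ Q τ

namespace Runs

variable {p q : Prog} {b : Test} {σ : Store} {T T' : ℕ} {Q Q' : Store → Prop}

theorem mono (h : Runs p σ T Q) (hT : T ≤ T') (hQ : ∀ τ, Q τ → Q' τ) : Runs p σ T' Q' := by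
  obtain ⟨t, τ, ht, he, hq⟩ := h
  exact ⟨t, τ, ht.trans hT, he, hQ τ hq⟩

theorem with_agreesOff (h : Runs p σ T Q) :
    Runs p σ T fun τ => AgreesOff p.written σ τ ∧ Q τ := by
  obtain ⟨t, τ, ht, he, hq⟩ := h
  exact ⟨t, τ, ht, he, he.agreesOff, hq⟩

theorem seq (h : Runs p σ T Q)
    (h' : ∀ τ, AgreesOff p.written σ τ → Q τ → Runs q τ T' Q') :
    Runs (.seq p q) σ (T + T') Q' := by
  obtain ⟨t, τ, ht, he, hq⟩ := h
  obtain ⟨t', τ', ht', he', hq'⟩ := h' τ he.agreesOff hq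
  exact ⟨t + t', τ', add_le_add ht ht', .seq he he', hq'⟩

theorem cond (hp : b.Holds σ → Runs p σ T Q) (hq : ¬ b.Holds σ → Runs q σ T Q) :
    Runs (.cond b p q) σ (T + 1) Q := by
  by_cases hb : b.Holds σ
  · obtain ⟨t, τ, ht, he, hQ⟩ := hp hb
    exact ⟨t + 1, τ, by omega, .condTrue hb he, hQ⟩
  · obtain ⟨t, τ, ht, he, hQ⟩ := hq hb
    exact ⟨t + 1, τ, by omega, .condFalse hb he, hQ⟩

theorem skip (h : Q σ) : Runs .skip σ T Q :=
  ⟨0, σ, Nat.zero_le _, .skip σ, h⟩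

theorem loop {N : ℕ} (I : ℕ → Store → Prop) (hb : ∀ k τ, I k τ → (b.Holds τ ↔ k < N))
    (hp : ∀ k < N, ∀ τ, I k τ → Runs p τ T (I (k + 1))) (h : I 0 σ) :
    Runs (.loop b p) σ (N * (T + 1) + 1) (I N) := by
  suffices key : ∀ j k τ, k + j = N → I k τ → Runs (.loop b p) τ (j * (T + 1) + 1) (I N) from
    key N 0 σ (zero_add N) h
  intro j
  induction j with
  | zero =>
    rintro k τ rfl hI
    exact ⟨1, τ, by omega, .loopFalse fun hτ => lt_irrefl _ ((hb k τ hI).1 hτ), hI⟩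
  | succ j ih =>
    intro k τ hk hI
    obtain ⟨t, υ, ht, he, hI'⟩ := hp k (by omega) τ hI
    obtain ⟨t', υ', ht', he', hq⟩ := ih (k + 1) υ (by omega) hI'
    exact ⟨t + t' + 1, υ', by linarith, .loopTrue ((hb k τ hI).2 (by omega)) he he', hq⟩

end Runs

/-- A straight-line program. -/
def Prog.block : List Instr → Prog
  | [] => .skip
  | i :: l => .seq (.instr i) (block l)

/-- The effect of a straight-line program on the memory. -/
def runBlock : List Instr → Store → Store
  | [], σ => σ
  | i :: l, σ => runBlock l (i.apply σ)

theorem exec_block (l : List Instr) (σ : Store) :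
    Exec (Prog.block l) σ l.length (runBlock l σ) := by
  induction l generalizing σ with
  | nil => exact .skip σ
  | cons i l ih =>
    rw [List.length_cons, add_comm]
    exact .seq (.instr i σ) (ih _)

theorem Runs.block {l : List Instr} {σ : Store} {Q : Store → Prop} (h : Q (runBlock l σ)) :
    Runs (Prog.block l) σ l.length Q :=
  ⟨_, _, le_rfl, exec_block l σ, h⟩

theorem agreesOff_runBlock (l : List Instr) (σ : Store) :
    AgreesOff (Prog.block l).written σ (runBlock l σ) :=
  (exec_block l σ).agreesOff

section Fields

variable (σ : Store) (d i : ℕ)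

theorem runBlock_nil : runBlock [] σ = σ := rfl

theorem runBlock_cons (j : Instr) (l : List Instr) :
    runBlock (j :: l) σ = runBlock l (j.apply σ) := rfl

theorem idx_setIdx (v r : ℕ) : (σ.setIdx d v).idx r = if r = d then v else σ.idx r :=
  Function.update_apply ..

theorem num_setIdx (v : ℕ) : (σ.setIdx d v).num = σ.num := rfl

theorem idxArr_setIdx (v : ℕ) : (σ.setIdx d v).idxArr = σ.idxArr := rfl

theorem numArr_setIdx (v : ℕ) : (σ.setIdx d v).numArr = σ.numArr := rfl

theorem idx_setNum (v : ℝ) : (σ.setNum d v).idx = σ.idx := rfl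

theorem num_setNum (v : ℝ) (r : ℕ) : (σ.setNum d v).num r = if r = d then v else σ.num r :=
  Function.update_apply ..

theorem idxArr_setNum (v : ℝ) : (σ.setNum d v).idxArr = σ.idxArr := rfl

theorem numArr_setNum (v : ℝ) : (σ.setNum d v).numArr = σ.numArr := rfl

theorem idx_setIdxArr (v : ℕ) : (σ.setIdxArr d i v).idx = σ.idx := rfl

theorem num_setIdxArr (v : ℕ) : (σ.setIdxArr d i v).num = σ.num := rfl

theorem numArr_setIdxArr (v : ℕ) : (σ.setIdxArr d i v).numArr = σ.numArr := rfl

theorem idxArr_setIdxArr (v a : ℕ) : (σ.setIdxArr d i v).idxArr a =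
    if a = d then Function.update (σ.idxArr d) i v else σ.idxArr a :=
  Function.update_apply ..

theorem idx_setNumArr (v : ℝ) : (σ.setNumArr d i v).idx = σ.idx := rfl

theorem num_setNumArr (v : ℝ) : (σ.setNumArr d i v).num = σ.num := rfl

theorem idxArr_setNumArr (v : ℝ) : (σ.setNumArr d i v).idxArr = σ.idxArr := rfl

theorem numArr_setNumArr (v : ℝ) (a : ℕ) : (σ.setNumArr d i v).numArr a =
    if a = d then Function.update (σ.numArr d) i v else σ.numArr a :=
  Function.update_apply ..

end Fields

attribute [local simp] runBlock_nil runBlock_cons Instr.apply idx_setIdx num_setIdx idxArr_setIdx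
  numArr_setIdx idx_setNum num_setNum idxArr_setNum numArr_setNum idx_setIdxArr num_setIdxArr
  numArr_setIdxArr idxArr_setIdxArr idx_setNumArr num_setNumArr idxArr_setNumArr numArr_setNumArr

/-- Repeat `body` with index register `7` counting from `0` up to the content of index register
`bound`; index register `6` has to hold the step `1`. -/
def Prog.forRange (bound : ℕ) (body : Prog) : Prog :=
  .seq (.block [.idxConst 7 0])
    (.loop (.idxLt 7 bound) (.seq body (.block [.idxAdd 7 7 6])))

theorem Runs.forRange {bound N T : ℕ} {body : Prog} {σ : Store} (I : ℕ → Store → Prop)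
    (hN : σ.idx bound = N) (hone : σ.idx 6 = 1) (hcounter : .idx 7 ∉ body.written)
    (hbound : .idx bound ∉ (Prog.forRange bound body).written)
    (hstep : .idx 6 ∉ (Prog.forRange bound body).written)
    (hI : ∀ k τ v, I k τ → I k (τ.setIdx 7 v)) (h : I 0 σ)
    (hbody : ∀ k < N, ∀ τ, AgreesOff (Prog.forRange bound body).written σ τ → τ.idx 7 = k → I k τ →
      Runs body τ T (I (k + 1))) :
    Runs (Prog.forRange bound body) σ (2 + N * (T + 2)) (I N) := by
  set W := (Prog.forRange bound body).written
  have hinit : (Prog.block [.idxConst 7 0]).written ⊆ W := List.subset_append_left ..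
  have hloop : (Prog.seq body (Prog.block [.idxAdd 7 7 6])).written ⊆ W :=
    List.subset_append_right ..
  let J (k : ℕ) (τ : Store) : Prop := AgreesOff W σ τ ∧ τ.idx 7 = k ∧ I k τ
  have hJ : J 0 (runBlock [.idxConst 7 0] σ) :=
    ⟨(agreesOff_runBlock _ σ).mono hinit, by simp, hI 0 σ 0 h⟩
  have hguard (k : ℕ) (τ : Store) (hτ : J k τ) : (Test.idxLt 7 bound).Holds τ ↔ k < N := by
    rw [Test.Holds, hτ.2.1, hτ.1.idx bound hbound, hN]
  have hpass (k : ℕ) (hk : k < N) (τ : Store) (hτ : J k τ) :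
      Runs (.seq body (.block [.idxAdd 7 7 6])) τ (T + 1) (J (k + 1)) := by
    refine ((hbody k hk τ hτ.1 hτ.2.1 hτ.2.2).seq fun υ hυ hI' => ?_).with_agreesOff.mono le_rfl
      fun υ hυ => ⟨hτ.1.trans (hυ.1.mono hloop), hυ.2⟩
    have hυ6 : υ.idx 6 = 1 := by
      rw [hυ.idx 6 fun h => hstep (hloop (List.mem_append_left _ h)), hτ.1.idx 6 hstep, hone]
    exact Runs.block ⟨by simp [hυ.idx 7 hcounter, hτ.2.1, hυ6], hI _ _ _ hI'⟩
  refine ((Runs.block hJ).seq fun τ _ hτ => Runs.loop J hguard hpass hτ).mono ?_ fun τ hτ => hτ.2.2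
  simp only [List.length_singleton]
  linarith

/-! ### Writing a bar -/

section Emission

variable {D : SparseSystem} {W : List Loc} {σ τ : Store} {l : List (ℕ × ℕ × ℝ)} {b : Bar} {e : ℕ}

/-- The locations of the matrix entries that have been written. -/
abbrev tapeLocs : List Loc := [.idx 9, .idxArr 2, .idxArr 3, .numArr 1]

/-- The matrix entries written so far are those of the list `l`, and index register `9` is the next
position. -/
structure Tape (σ : Store) (l : List (ℕ × ℕ × ℝ)) : Prop where
  pos : σ.idx 9 = l.length
  row : ∀ (k : ℕ) (hk : k < l.length), σ.idxArr 2 k = l[k].1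
  col : ∀ (k : ℕ) (hk : k < l.length), σ.idxArr 3 k = l[k].2.1
  val : ∀ (k : ℕ) (hk : k < l.length), σ.numArr 1 k = l[k].2.2

theorem Tape.congr (h : Tape σ l) (hf : AgreesOff W σ τ) (hW : ∀ x ∈ tapeLocs, x ∉ W) :
    Tape τ l where
  pos := (hf.idx 9 (hW _ (by decide))).trans h.pos
  row k hk := (congrFun (hf.idxArr 2 (hW _ (by decide))) k).trans (h.row k hk)
  col k hk := (congrFun (hf.idxArr 3 (hW _ (by decide))) k).trans (h.col k hk)
  val k hk := (congrFun (hf.numArr 1 (hW _ (by decide))) k).trans (h.val k hk)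

/-- Write the entry with row index register `8`, column index register `16` and value number
register `v`, unless the value is zero. -/
def emitEntry (v : ℕ) : Prog :=
  .cond (.numEq v 2) .skip
    (.block [.idxStore 2 9 8, .idxStore 3 9 16, .numStore 1 9 v, .idxAdd 9 9 6])

theorem update_length_eq_getElem {α β : Type*} (f : ℕ → β) (g : α → β) (l : List α) (a : α)
    (hf : ∀ (k : ℕ) (hk : k < l.length), f k = g l[k]) (k : ℕ) (hk : k < (l ++ [a]).length) :
    Function.update f l.length (g a) k = g (l ++ [a])[k] := by
  rw [List.length_append, List.length_singleton] at hk
  obtain hk | rfl : k < l.length ∨ k = l.length := by omega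
  · rw [Function.update_of_ne hk.ne, hf k hk, List.getElem_append_left hk]
  · simp

theorem runs_emitEntry (v : ℕ) (h : Tape σ l) (hone : σ.idx 6 = 1) (hzero : σ.num 2 = 0) :
    Runs (emitEntry v) σ 5 fun τ =>
      Tape τ (l ++ SparseSystem.cell (σ.idx 8) (σ.idx 16) (σ.num v)) := by
  refine Runs.cond (T := 4) (fun hv => Runs.skip ?_) fun hv => Runs.block ?_
  · rw [Test.Holds, hzero] at hv
    simpa [SparseSystem.cell, hv] using h
  · rw [Test.Holds, hzero] at hv
    rw [SparseSystem.cell, if_neg hv]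
    have hget {β : Type} {f : ℕ → β} (g : ℕ × ℕ × ℝ → β) :=
      update_length_eq_getElem f g l (σ.idx 8, σ.idx 16, σ.num v)
    refine ⟨?_, ?_, ?_, ?_⟩
    · simp [h.pos, hone]
    · simpa [h.pos] using hget (·.1) h.row
    · simpa [h.pos] using hget (·.2.1) h.col
    · simpa [h.pos] using hget (·.2.2) h.val

/-- The locations of the data of a bar. -/
abbrev barLocs : List Loc := [.idx 6, .idx 8, .idx 10, .idx 11, .num 2, .num 3, .num 4]

/-- The data of the bar `b` in row `e`, and the constants `0` and `1`, are in the registers. -/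
structure BarLoaded (D : SparseSystem) (b : Bar) (e : ℕ) (σ : Store) : Prop where
  one : σ.idx 6 = 1
  zero : σ.num 2 = 0
  row : σ.idx 8 = e
  src : σ.idx 10 = D.index b.src
  tgt : σ.idx 11 = D.index b.tgt
  fx : σ.num 3 = b.fx
  fy : σ.num 4 = b.fy

theorem BarLoaded.congr (h : BarLoaded D b e σ) (hf : AgreesOff W σ τ)
    (hW : ∀ x ∈ barLocs, x ∉ W) : BarLoaded D b e τ where
  one := (hf.idx 6 (hW _ (by decide))).trans h.one
  zero := (hf.num 2 (hW _ (by decide))).trans h.zero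
  row := (hf.idx 8 (hW _ (by decide))).trans h.row
  src := (hf.idx 10 (hW _ (by decide))).trans h.src
  tgt := (hf.idx 11 (hW _ (by decide))).trans h.tgt
  fx := (hf.num 3 (hW _ (by decide))).trans h.fx
  fy := (hf.num 4 (hW _ (by decide))).trans h.fy

/-- Prepare column and value of an entry and write it. -/
def emitAfter (p : List Instr) (v : ℕ) : Prog := .seq (.block p) (emitEntry v)

theorem BarLoaded.runs_emitAfter {p : List Instr} {v c : ℕ} {x : ℝ} (hb : BarLoaded D b e σ)
    (ht : Tape σ l) (hp : ∀ y ∈ tapeLocs ++ barLocs, y ∉ (Prog.block p).written)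
    (hc : (runBlock p σ).idx 16 = c) (hx : (runBlock p σ).num v = x) :
    Runs (emitAfter p v) σ (p.length + 5) fun τ => Tape τ (l ++ SparseSystem.cell e c x) := by
  rw [List.forall_mem_append] at hp
  have hf := agreesOff_runBlock p σ
  have hb' := hb.congr hf hp.2
  refine Runs.seq (Q := (· = runBlock p σ)) (Runs.block rfl) ?_
  rintro _ - rfl
  simpa only [hb'.row, hc, hx] using runs_emitEntry v (ht.congr hf hp.1) hb'.one hb'.zero

/-- Write the entries of the row of a bar, and its right-hand side from number register `5`. -/
def emitBar : Prog :=
  .seq (emitAfter [.idxAdd 16 10 10] 3) <|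
  .seq (emitAfter [.idxAdd 16 10 10, .idxAdd 16 16 6] 4) <|
  .seq (emitAfter [.idxAdd 16 11 11, .numSub 6 2 3] 6) <|
  .seq (emitAfter [.idxAdd 16 11 11, .idxAdd 16 16 6, .numSub 6 2 4] 6) <|
  .block [.numStore 3 8 5, .idxAdd 8 8 6]

theorem runs_emitBar (hb : BarLoaded D b e σ) (ht : Tape σ l) :
    Runs emitBar σ 30 fun τ => Tape τ (l ++ D.barEntries e b) ∧ τ.idx 8 = e + 1 ∧
      τ.numArr 3 = Function.update (σ.numArr 3) e (σ.num 5) := by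
  refine Runs.mono (T := 6 + (7 + (7 + (8 + 2)))) ?_ (by norm_num) fun τ hτ => hτ
  refine (hb.runs_emitAfter ht (c := 2 * D.index b.src) (x := b.fx) (by decide)
    (by simp [hb.src, two_mul]) (by simp [hb.fx])).seq fun σ₁ f₁ t₁ => ?_
  have b₁ := hb.congr f₁ (by decide)
  refine (b₁.runs_emitAfter t₁ (c := 2 * D.index b.src + 1) (x := b.fy) (by decide)
    (by simp [b₁.src, b₁.one, two_mul]) (by simp [b₁.fy])).seq fun σ₂ f₂ t₂ => ?_
  have b₂ := b₁.congr f₂ (by decide)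
  refine (b₂.runs_emitAfter t₂ (c := 2 * D.index b.tgt) (x := -b.fx) (by decide)
    (by simp [b₂.tgt, two_mul]) (by simp [b₂.fx, b₂.zero])).seq fun σ₃ f₃ t₃ => ?_
  have b₃ := b₂.congr f₃ (by decide)
  refine (b₃.runs_emitAfter t₃ (c := 2 * D.index b.tgt + 1) (x := -b.fy) (by decide)
    (by simp [b₃.tgt, b₃.one, two_mul]) (by simp [b₃.fy, b₃.zero])).seq fun σ₄ f₄ t₄ => ?_
  have b₄ := b₃.congr f₄ (by decide)
  have hrhs : σ₄.numArr 3 = σ.numArr 3 := by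
    rw [f₄.numArr 3 (by decide), f₃.numArr 3 (by decide), f₂.numArr 3 (by decide),
      f₁.numArr 3 (by decide)]
  have hval : σ₄.num 5 = σ.num 5 := by
    rw [f₄.num 5 (by decide), f₃.num 5 (by decide), f₂.num 5 (by decide), f₁.num 5 (by decide)]
  refine Runs.block ⟨?_, by simp [b₄.row, b₄.one], by simp [b₄.row, hrhs, hval]⟩
  rw [SparseSystem.barEntries, ← List.append_assoc, ← List.append_assoc, ← List.append_assoc]
  exact t₄.congr (agreesOff_runBlock _ σ₄) (by decide)

/-- The first `N` rows of the truss incidence matrix, and of the right-hand side `r`, are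
written. -/
structure Emitted (D : SparseSystem) (r : ℕ → ℝ) (N : ℕ) (σ : Store) : Prop where
  count : σ.idx 8 = N
  tape : Tape σ (D.trussEntries N)
  rhs : ∀ e < N, σ.numArr 3 e = r e

theorem Emitted.congr {r : ℕ → ℝ} {N : ℕ} (h : Emitted D r N σ) (hf : AgreesOff W σ τ)
    (hW : ∀ x ∈ tapeLocs ++ [.idx 8, .numArr 3], x ∉ W) : Emitted D r N τ where
  count := (hf.idx 8 (hW _ (by decide))).trans h.count
  tape := h.tape.congr hf fun x hx => hW x (List.mem_append_left _ hx)
  rhs e he := (congrFun (hf.numArr 3 (hW _ (by decide))) e).trans (h.rhs e he)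

/-- Load the data of a bar into the registers and write its row. -/
def emitWith (p : List Instr) : Prog := .seq (.block p) emitBar

theorem Emitted.runs_emitWith {r : ℕ → ℝ} {N : ℕ} {p : List Instr} (h : Emitted D r N σ)
    (hp : ∀ x ∈ tapeLocs ++ [.idx 8, .numArr 3], x ∉ (Prog.block p).written)
    (hb : BarLoaded D (D.bar N) N (runBlock p σ)) (hr : (runBlock p σ).num 5 = r N) :
    Runs (emitWith p) σ (p.length + 30) (Emitted D r (N + 1)) := by
  have h' := h.congr (agreesOff_runBlock p σ) hp
  refine Runs.seq (Q := (· = runBlock p σ)) (Runs.block rfl) ?_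
  rintro _ - rfl
  refine (runs_emitBar hb h'.tape).mono le_rfl fun τ ⟨ht, hcount, hrhs⟩ => ⟨hcount, ?_, ?_⟩
  · rwa [SparseSystem.trussEntries_succ]
  · intro e he
    rw [hrhs, Function.update_apply, hr]
    split_ifs with heN
    · rw [heN]
    · exact h'.rhs e (by omega)

end Emission

/-! ### The program that builds the truss -/

section TrussProg

variable {D : SparseSystem} {c : ℕ → ℝ} {ε : ℝ} {k : ℕ} {W : List Loc} {σ τ : Store}

/-- The memory holds the system `D`, the right-hand side `c` and the accuracy `ε`. -/
structure Input (D : SparseSystem) (c : ℕ → ℝ) (ε : ℝ) (σ : Store) : Prop where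
  rows : σ.idx 0 = D.m
  cols : σ.idx 1 = D.n
  size : σ.idx 2 = D.s
  eps : σ.num 0 = ε
  row : ∀ k < D.s, σ.idxArr 0 k = D.row k
  col : ∀ k < D.s, σ.idxArr 1 k = D.col k
  val : ∀ k < D.s, σ.numArr 0 k = D.val k
  rhs : ∀ i < D.m, σ.numArr 2 i = c i

/-- The memory holds the input and the constants of the program. -/
structure Ready (D : SparseSystem) (c : ℕ → ℝ) (ε : ℝ) (σ : Store) : Prop
    extends Input D c ε σ where
  one : σ.idx 6 = 1
  zero : σ.idx 17 = 0
  numZero : σ.num 2 = 0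
  numOne : σ.num 8 = 1
  numFour : σ.num 9 = 4

/-- The locations of the input and the constants. -/
abbrev readyLocs : List Loc :=
  [.idx 0, .idx 1, .idx 2, .num 0, .idxArr 0, .idxArr 1, .numArr 0, .numArr 2,
    .idx 6, .idx 17, .num 2, .num 8, .num 9]

theorem Ready.congr (h : Ready D c ε σ) (hf : AgreesOff W σ τ) (hW : ∀ x ∈ readyLocs, x ∉ W) :
    Ready D c ε τ where
  rows := (hf.idx 0 (hW _ (by decide))).trans h.rows
  cols := (hf.idx 1 (hW _ (by decide))).trans h.cols
  size := (hf.idx 2 (hW _ (by decide))).trans h.size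
  eps := (hf.num 0 (hW _ (by decide))).trans h.eps
  row k hk := (congrFun (hf.idxArr 0 (hW _ (by decide))) k).trans (h.row k hk)
  col k hk := (congrFun (hf.idxArr 1 (hW _ (by decide))) k).trans (h.col k hk)
  val k hk := (congrFun (hf.numArr 0 (hW _ (by decide))) k).trans (h.val k hk)
  rhs i hi := (congrFun (hf.numArr 2 (hW _ (by decide))) i).trans (h.rhs i hi)
  one := (hf.idx 6 (hW _ (by decide))).trans h.one
  zero := (hf.idx 17 (hW _ (by decide))).trans h.zero
  numZero := (hf.num 2 (hW _ (by decide))).trans h.numZero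
  numOne := (hf.num 8 (hW _ (by decide))).trans h.numOne
  numFour := (hf.num 9 (hW _ (by decide))).trans h.numFour

theorem update_eq_of_lt_succ {β : Type*} {f g : ℕ → β} (h : ∀ i < k, f i = g i) :
    ∀ i < k + 1, Function.update f k (g k) i = g i := by
  intro i hi
  obtain rfl | hik := eq_or_ne i k
  · rw [Function.update_self]
  · rw [Function.update_of_ne hik, h i (by omega)]

/-- Start the count of the bars, the mass and the chain of a row. -/
def clearRow : List Instr := [.numStore 4 7 8, .numStore 5 7 2, .idxAdd 12 1 7, .idxStore 4 7 12]

/-- The first `k` rows are cleared. -/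
structure RowsCleared (D : SparseSystem) (k : ℕ) (σ : Store) : Prop where
  bars : ∀ i < k, σ.numArr 4 i = 1
  mass : ∀ i < k, σ.numArr 5 i = 0
  last : ∀ i < k, σ.idxArr 4 i = D.index (.anchor i)

theorem Ready.runs_clearRows (h : Ready D c ε σ) :
    Runs (.forRange 0 (.block clearRow)) σ (2 + D.m * 6) (RowsCleared D D.m) := by
  refine Runs.forRange (T := 4) (RowsCleared D) h.rows h.one (by decide) (by decide) (by decide)
    (fun k τ v hτ => ⟨hτ.bars, hτ.mass, hτ.last⟩) ⟨by simp, by simp, by simp⟩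
    fun k _ τ hf h7 hτ => Runs.block ⟨?_, ?_, ?_⟩
  all_goals have hr := h.congr hf (by decide)
  · simpa [clearRow, h7, hr.numOne] using update_eq_of_lt_succ (g := fun _ => 1) hτ.bars
  · simpa [clearRow, h7, hr.numZero] using update_eq_of_lt_succ (g := fun _ => 0) hτ.mass
  · simpa [clearRow, h7, hr.cols, SparseSystem.index] using
      update_eq_of_lt_succ (g := fun i => D.index (.anchor i)) hτ.last

/-- Add an entry to the count of the bars and to the mass of its row; the absolute value is computed
as the square root of the square. -/
def countEntry : List Instr :=
  [.idxLoad 12 0 7, .numLoad 7 0 7, .numMul 7 7 7, .numSqrt 7 7, .numLoad 10 5 12, .numAdd 10 10 7,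
    .numStore 5 12 10, .numLoad 10 4 12, .numAdd 10 10 9, .numStore 4 12 10]

/-- The first `k` entries are counted. -/
structure EntriesCounted (D : SparseSystem) (k : ℕ) (σ : Store) : Prop where
  bars : ∀ i < D.m, σ.numArr 4 i = 1 + D.rowSum (fun _ => 4) k i
  mass : ∀ i < D.m, σ.numArr 5 i = D.rowSum (fun l => |D.val l|) k i

theorem update_row_eq {f : ℕ → ℝ} {g : ℕ → ℕ → ℝ} {a : ℝ} (h : ∀ i < D.m, f i = g k i)
    (hself : D.row k < D.m → a = g (k + 1) (D.row k))
    (hother : ∀ i, D.row k ≠ i → g (k + 1) i = g k i) :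
    ∀ i < D.m, Function.update f (D.row k) a i = g (k + 1) i := by
  intro i hi
  obtain rfl | hik := eq_or_ne (D.row k) i
  · rw [Function.update_self, hself hi]
  · rw [Function.update_of_ne hik.symm, h i hi, hother i hik]

theorem Ready.runs_countEntries (h : Ready D c ε σ) (h' : RowsCleared D D.m σ) :
    Runs (.forRange 2 (.block countEntry)) σ (2 + D.s * 12) (EntriesCounted D D.s) := by
  refine Runs.forRange (T := 10) (EntriesCounted D) h.size h.one (by decide) (by decide)
    (by decide) (fun k τ v hτ => ⟨hτ.bars, hτ.mass⟩)
    ⟨fun i hi => by simp [h'.bars i hi], fun i hi => by simp [h'.mass i hi]⟩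
    fun k hk τ hf h7 hτ => Runs.block ⟨?_, ?_⟩
  all_goals have hr := h.congr hf (by decide)
  · have := update_row_eq hτ.bars (a := τ.numArr 4 (D.row k) + 4)
      (g := fun k i => 1 + D.rowSum (fun _ => 4) k i)
      (fun hi => by rw [hτ.bars _ hi, D.rowSum_succ_self, add_assoc])
      (fun i hi => by rw [D.rowSum_succ_of_ne hi])
    simpa [countEntry, h7, hr.row k hk, hr.numFour] using this
  · have := update_row_eq hτ.mass (a := τ.numArr 5 (D.row k) + |D.val k|)
      (g := fun k i => D.rowSum (fun l => |D.val l|) k i)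
      (fun hi => by rw [hτ.mass _ hi, D.rowSum_succ_self])
      (fun i hi => D.rowSum_succ_of_ne hi)
    simpa [countEntry, h7, hr.row k hk, hr.val k hk, Real.sqrt_mul_self_eq_abs] using this

/-- Compute the scale, the initial load and the scaled right-hand side of a row. -/
def scaleRow : List Instr :=
  [.numLoad 10 4 7, .numSqrt 10 10, .numStore 8 7 10, .numLoad 11 5 7, .numStore 6 7 11,
    .numLoad 12 2 7, .numDiv 12 12 10, .numStore 7 7 12]

/-- The first `k` rows are scaled. -/
structure RowsScaled (D : SparseSystem) (c : ℕ → ℝ) (k : ℕ) (σ : Store) : Prop where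
  load : ∀ i < k, σ.numArr 6 i = D.mass i
  rhs : ∀ i < k, σ.numArr 7 i = c i / D.scale i
  scale : ∀ i < k, σ.numArr 8 i = D.scale i

theorem Ready.runs_scaleRows (h : Ready D c ε σ) (h' : EntriesCounted D D.s σ) :
    Runs (.forRange 0 (.block scaleRow)) σ (2 + D.m * 10) (RowsScaled D c D.m) := by
  refine Runs.forRange (T := 8) (RowsScaled D c) h.rows h.one (by decide) (by decide) (by decide)
    (fun k τ v hτ => ⟨hτ.load, hτ.rhs, hτ.scale⟩) ⟨by simp, by simp, by simp⟩
    fun k hk τ hf h7 hτ => Runs.block ?_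
  have hr := h.congr hf (by decide)
  have hmass : τ.numArr 5 k = D.mass k := by rw [hf.numArr 5 (by decide), h'.mass k hk]; rfl
  have hscale : √(τ.numArr 4 k) = D.scale k := by
    rw [hf.numArr 4 (by decide), h'.bars k hk, D.rowSum_const, mul_comm, SparseSystem.scale]
  refine ⟨?_, ?_, ?_⟩
  · simpa [scaleRow, h7, hmass] using update_eq_of_lt_succ hτ.load
  · simpa [scaleRow, h7, hscale, hr.rhs k hk] using
      update_eq_of_lt_succ (g := fun i => c i / D.scale i) hτ.rhs
  · simpa [scaleRow, h7, hscale] using update_eq_of_lt_succ hτ.scale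

/-- Set the constants. -/
def initConsts : List Instr :=
  [.idxConst 6 1, .idxConst 17 0, .numConst 2 0, .numConst 8 1, .numConst 9 4]

/-- Start the output, and put the index of the first foot into index register `13`. -/
def initOutput : List Instr := [.idxConst 8 0, .idxConst 9 0, .idxAdd 13 1 0]

/-- Compute everything that has to be known before the first bar is written. -/
def prepare : Prog :=
  .seq (.block initConsts) <|
  .seq (.forRange 0 (.block clearRow)) <|
  .seq (.forRange 2 (.block countEntry)) <|
  .seq (.forRange 0 (.block scaleRow)) <|
  .block initOutput

/-- The right-hand side of the truss: the right-hand side of each row, distributed over its bars. -/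
def trussRhs (D : SparseSystem) (c : ℕ → ℝ) (e : ℕ) : ℝ :=
  c (D.bar e).owner / D.scale (D.bar e).owner

/-- The memory holds the data of the rows that do not change while the bars are written. -/
structure RowConsts (D : SparseSystem) (c : ℕ → ℝ) (σ : Store) : Prop where
  mass : ∀ i < D.m, σ.numArr 5 i = D.mass i
  rhs : ∀ i < D.m, σ.numArr 7 i = c i / D.scale i
  scale : ∀ i < D.m, σ.numArr 8 i = D.scale i

theorem RowConsts.congr (h : RowConsts D c σ) (hf : AgreesOff W σ τ)
    (hW : ∀ x ∈ [Loc.numArr 5, .numArr 7, .numArr 8], x ∉ W) : RowConsts D c τ where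
  mass i hi := (congrFun (hf.numArr 5 (hW _ (by decide))) i).trans (h.mass i hi)
  rhs i hi := (congrFun (hf.numArr 7 (hW _ (by decide))) i).trans (h.rhs i hi)
  scale i hi := (congrFun (hf.numArr 8 (hW _ (by decide))) i).trans (h.scale i hi)

/-- The memory holds the state of the chains before entry `k`. -/
structure Chains (D : SparseSystem) (k : ℕ) (σ : Store) : Prop where
  foot : σ.idx 13 = D.index (.foot k)
  load : ∀ i < D.m, σ.numArr 6 i = D.load k i
  last : ∀ i < D.m, σ.idxArr 4 i = D.index (D.last k i)

theorem Chains.congr (h : Chains D k σ) (hf : AgreesOff W σ τ)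
    (hW : ∀ x ∈ [Loc.idx 13, .numArr 6, .idxArr 4], x ∉ W) : Chains D k τ where
  foot := (hf.idx 13 (hW _ (by decide))).trans h.foot
  load i hi := (congrFun (hf.numArr 6 (hW _ (by decide))) i).trans (h.load i hi)
  last i hi := (congrFun (hf.idxArr 4 (hW _ (by decide))) i).trans (h.last i hi)

/-- The state before the bars of entry `k` are written. -/
structure BeforeEntry (D : SparseSystem) (c : ℕ → ℝ) (ε : ℝ) (k : ℕ) (σ : Store) : Prop where
  ready : Ready D c ε σ
  consts : RowConsts D c σ
  chains : Chains D k σ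
  emitted : Emitted D (trussRhs D c) (4 * k) σ

theorem Input.runs_prepare (h : Input D c ε σ) :
    Runs prepare σ (14 + 16 * D.m + 12 * D.s) (BeforeEntry D c ε 0) := by
  refine Runs.mono (T := 5 + (2 + D.m * 6 + (2 + D.s * 12 + (2 + D.m * 10 + 3)))) ?_ (by omega)
    fun τ hτ => hτ
  have hinit : Ready D c ε (runBlock initConsts σ) :=
    ⟨⟨h.rows, h.cols, h.size, h.eps, h.row, h.col, h.val, h.rhs⟩, by simp [initConsts],
      by simp [initConsts], by simp [initConsts], by simp [initConsts], by simp [initConsts]⟩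
  refine (Runs.block hinit).seq fun σ₁ _ h₁ => h₁.runs_clearRows.seq fun σ₂ f₂ cleared => ?_
  have h₂ := h₁.congr f₂ (by decide)
  refine (h₂.runs_countEntries cleared).seq fun σ₃ f₃ counted => ?_
  have h₃ := h₂.congr f₃ (by decide)
  refine (h₃.runs_scaleRows counted).seq fun σ₄ f₄ scaled => Runs.block ?_
  have h₄ := h₃.congr f₄ (by decide)
  refine ⟨h₄.congr (agreesOff_runBlock initOutput σ₄) (by decide), ⟨fun i hi => ?_, scaled.rhs,
    scaled.scale⟩, ⟨?_, fun i hi => ?_, fun i hi => ?_⟩, ?_⟩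
  · exact (congrFun (f₄.numArr 5 (by decide)) i).trans (counted.mass i hi)
  · simp [initOutput, h₄.cols, h₄.rows, SparseSystem.index]
  · rw [D.load_zero]
    exact scaled.load i hi
  · simp only [initOutput, SparseSystem.last, ← cleared.last i hi, ← f₃.idxArr 4 (by decide),
      ← f₄.idxArr 4 (by decide)]
    rfl
  · refine ⟨by simp [initOutput], ⟨?_, ?_, ?_, ?_⟩, ?_⟩ <;>
      simp [initOutput, SparseSystem.trussEntries]

/-- Compute the coefficients and the joints of entry `k`, and append the entry to the chain of its
row. -/
def loadEntry : List Instr :=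
  [.idxLoad 12 0 7, .idxLoad 18 1 7, .idxAdd 14 13 6, .idxLoad 15 4 12, .idxStore 4 12 14,
    .numLoad 7 0 7, .numLoad 10 8 12, .numLoad 11 5 12, .numLoad 12 6 12, .numLoad 5 7 12,
    .numAdd 13 12 7, .numStore 6 12 13, .numMul 7 10 7, .numDiv 13 11 13, .numMul 13 7 13,
    .numMul 12 10 12]

/-- The data of the four bars of entry `k` are in the registers. -/
structure EntryLoaded (D : SparseSystem) (c : ℕ → ℝ) (k : ℕ) (σ : Store) : Prop where
  foot : σ.idx 13 = D.index (.foot k)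
  head : σ.idx 14 = D.index (.head k)
  last : σ.idx 15 = D.index (D.last k (D.row k))
  col : σ.idx 18 = D.col k
  rhs : σ.num 5 = c (D.row k) / D.scale (D.row k)
  val : σ.num 7 = D.scale (D.row k) * D.val k
  load : σ.num 12 = D.scale (D.row k) * D.load k (D.row k)
  rise : σ.num 13 = D.scale (D.row k) * D.val k * D.height k

theorem EntryLoaded.congr (h : EntryLoaded D c k σ) (hf : AgreesOff W σ τ)
    (hW : ∀ x ∈ [Loc.idx 13, .idx 14, .idx 15, .idx 18, .num 5, .num 7, .num 12, .num 13], x ∉ W) :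
    EntryLoaded D c k τ where
  foot := (hf.idx 13 (hW _ (by decide))).trans h.foot
  head := (hf.idx 14 (hW _ (by decide))).trans h.head
  last := (hf.idx 15 (hW _ (by decide))).trans h.last
  col := (hf.idx 18 (hW _ (by decide))).trans h.col
  rhs := (hf.num 5 (hW _ (by decide))).trans h.rhs
  val := (hf.num 7 (hW _ (by decide))).trans h.val
  load := (hf.num 12 (hW _ (by decide))).trans h.load
  rise := (hf.num 13 (hW _ (by decide))).trans h.rise

theorem BeforeEntry.entryLoaded (h : BeforeEntry D c ε k σ) (h7 : σ.idx 7 = k) (hk : k < D.s)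
    (hi : D.row k < D.m) : EntryLoaded D c k (runBlock loadEntry σ) := by
  have hrow := h.ready.row k hk
  have hval := h.ready.val k hk
  have hscale := h.consts.scale _ hi
  have hload := h.chains.load _ hi
  constructor
  · simp [loadEntry, h.chains.foot]
  · simp [loadEntry, h.chains.foot, h.ready.one, SparseSystem.index]
  · simp [loadEntry, h7, hrow, h.chains.last _ hi]
  · simp [loadEntry, h7, h.ready.col k hk]
  · simp [loadEntry, h7, hrow, h.consts.rhs _ hi]
  · simp [loadEntry, h7, hrow, hval, hscale]
  · simp [loadEntry, h7, hrow, hscale, hload]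
  · simp [loadEntry, h7, hrow, hval, hscale, hload, h.consts.mass _ hi, SparseSystem.height,
      D.load_succ_self]

/-- The state of the chains after entry `k` has been loaded, except for the index of the next
foot. -/
theorem BeforeEntry.chains_loadEntry (h : BeforeEntry D c ε k σ) (h7 : σ.idx 7 = k)
    (hk : k < D.s) :
    (∀ i < D.m, (runBlock loadEntry σ).numArr 6 i = D.load (k + 1) i) ∧
      ∀ i < D.m, (runBlock loadEntry σ).idxArr 4 i = D.index (D.last (k + 1) i) := by
  have hrow := h.ready.row k hk
  constructor <;> intro i hi <;> obtain rfl | hik := eq_or_ne (D.row k) i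
  · simp [loadEntry, h7, hrow, h.ready.val k hk, h.chains.load _ hi, D.load_succ_self]
  · simp [loadEntry, h7, hrow, hik.symm, h.chains.load _ hi, SparseSystem.load_succ_of_ne hik]
  · simp [loadEntry, h7, hrow, h.chains.foot, h.ready.one, SparseSystem.last_succ_self,
      SparseSystem.index]
  · simp [loadEntry, h7, hrow, hik.symm, h.chains.last _ hi, SparseSystem.last_succ_of_ne hik]

/-- Write the four bars of an entry. -/
def emitEntryBars : Prog :=
  .seq (emitWith [.idxAdd 10 18 17, .idxAdd 11 13 17, .numAdd 3 7 2, .numAdd 4 2 2]) <|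
  .seq (emitWith [.idxAdd 10 15 17, .idxAdd 11 13 17, .numAdd 3 2 2, .numAdd 4 13 2]) <|
  .seq (emitWith [.idxAdd 10 13 17, .idxAdd 11 14 17, .numAdd 3 7 2, .numAdd 4 13 2]) <|
  emitWith [.idxAdd 10 15 17, .idxAdd 11 14 17, .numAdd 3 12 2, .numSub 4 2 13]

theorem EntryLoaded.runs_emitEntryBars (h : EntryLoaded D c k σ) (hk : k < D.s)
    (hr : Ready D c ε σ) (he : Emitted D (trussRhs D c) (4 * k) σ) :
    Runs emitEntryBars σ 136 (Emitted D (trussRhs D c) (4 * (k + 1))) := by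
  refine Runs.mono (T := 34 + (34 + (34 + 34))) ?_ le_rfl fun τ hτ => hτ
  have htie := SparseSystem.bar_tie hk
  have hpost := SparseSystem.bar_post hk
  have hbrace := SparseSystem.bar_brace hk
  have hchain := SparseSystem.bar_chain hk
  refine (he.runs_emitWith (by decide) ?_ ?_).seq fun σ₁ f₁ e₁ => ?_
  · rw [htie]
    constructor <;> simp [SparseSystem.tieBar, SparseSystem.index, hr.one, hr.zero, hr.numZero,
      he.count, h.col, h.foot, h.val]
  · simp [trussRhs, htie, SparseSystem.tieBar, h.rhs]
  have h₁ := h.congr f₁ (by decide)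
  have r₁ := hr.congr f₁ (by decide)
  refine (e₁.runs_emitWith (by decide) ?_ ?_).seq fun σ₂ f₂ e₂ => ?_
  · rw [hpost]
    constructor <;> simp [SparseSystem.postBar, r₁.one, r₁.zero, r₁.numZero, e₁.count, h₁.last,
      h₁.foot, h₁.rise]
  · simp [trussRhs, hpost, SparseSystem.postBar, h₁.rhs]
  have h₂ := h₁.congr f₂ (by decide)
  have r₂ := r₁.congr f₂ (by decide)
  refine (e₂.runs_emitWith (by decide) ?_ ?_).seq fun σ₃ f₃ e₃ => ?_
  · rw [hbrace]
    constructor <;> simp [SparseSystem.braceBar, r₂.one, r₂.zero, r₂.numZero, e₂.count, h₂.foot,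
      h₂.head, h₂.val, h₂.rise]
  · simp [trussRhs, hbrace, SparseSystem.braceBar, h₂.rhs]
  have h₃ := h₂.congr f₃ (by decide)
  have r₃ := r₂.congr f₃ (by decide)
  refine e₃.runs_emitWith (by decide) ?_ ?_
  · rw [hchain]
    constructor <;> simp [SparseSystem.chainBar, r₃.one, r₃.zero, r₃.numZero, e₃.count, h₃.last,
      h₃.head, h₃.load, h₃.rise]
  · simp [trussRhs, hchain, SparseSystem.chainBar, h₃.rhs]

/-- Load an entry, write its bars and advance the index of the next foot. -/
def entryBody : Prog := .seq (.block loadEntry) (.seq emitEntryBars (.block [.idxAdd 13 14 6]))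

theorem BeforeEntry.runs_entryBody (h : BeforeEntry D c ε k σ) (h7 : σ.idx 7 = k) (hk : k < D.s)
    (hi : D.row k < D.m) : Runs entryBody σ 153 (BeforeEntry D c ε (k + 1)) := by
  refine Runs.mono (T := 16 + (136 + 1)) ?_ le_rfl fun τ hτ => hτ
  have hloaded := h.entryLoaded h7 hk hi
  obtain ⟨hload, hlast⟩ := h.chains_loadEntry h7 hk
  have f₁ := agreesOff_runBlock loadEntry σ
  have r₁ := h.ready.congr f₁ (by decide)
  refine Runs.seq (Q := (· = runBlock loadEntry σ)) (Runs.block rfl) ?_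
  rintro _ - rfl
  refine (hloaded.runs_emitEntryBars hk r₁ (h.emitted.congr f₁ (by decide))).seq
    fun σ₂ f₂ e₂ => Runs.block ?_
  have f₃ := agreesOff_runBlock [.idxAdd 13 14 6] σ₂
  have r₂ := r₁.congr f₂ (by decide)
  have hhead : σ₂.idx 14 = D.index (.head k) := (f₂.idx 14 (by decide)).trans hloaded.head
  refine ⟨r₂.congr f₃ (by decide), ((h.consts.congr f₁ (by decide)).congr f₂ (by decide)).congr f₃
    (by decide), ⟨?_, fun i hi => ?_, fun i hi => ?_⟩, e₂.congr f₃ (by decide)⟩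
  · simp [hhead, r₂.one, SparseSystem.index, mul_add, add_assoc]
  · exact (congrFun (f₂.numArr 6 (by decide)) i).trans (hload i hi)
  · exact (congrFun (f₂.idxArr 4 (by decide)) i).trans (hlast i hi)

/-- Load and write the closing bar of a row. -/
def closeRow : Prog :=
  emitWith [.numLoad 10 8 7, .numLoad 11 5 7, .numMul 10 10 11, .numLoad 5 7 7, .idxAdd 10 1 7,
    .idxLoad 11 4 7, .numSub 3 2 10, .numAdd 4 2 2]

theorem runs_closeRow (hr : Ready D c ε σ) (hc : RowConsts D c σ) (hs : Chains D D.s σ)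
    (h7 : σ.idx 7 = k) (hk : k < D.m) (he : Emitted D (trussRhs D c) (4 * D.s + k) σ) :
    Runs closeRow σ 38 (Emitted D (trussRhs D c) (4 * D.s + (k + 1))) := by
  have hbar := D.bar_closing k
  refine he.runs_emitWith (by decide) ?_ ?_
  · rw [hbar]
    constructor <;> simp [SparseSystem.closingBar, SparseSystem.index, hr.one, hr.cols, hr.numZero,
      he.count, h7, hs.last k hk, hc.scale k hk, hc.mass k hk]
  · simp [trussRhs, hbar, SparseSystem.closingBar, h7, hc.rhs k hk]

/-- Write the numbers of rows, columns and entries, and the accuracy. -/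
def finish : List Instr := [.idxAdd 3 8 17, .idxAdd 4 13 13, .idxAdd 5 9 17, .numAdd 1 0 2]

/-- The program that builds the truss. Its registers are
* index: `0`–`5` dimensions of input and output, `6` one, `7` loop counter, `8` number of bars
  written, `9` number of entries written, `10`, `11` end points of a bar, `12`, `18` row and column
  of an entry, `13`, `14` foot and head, `15` end of the chain, `16` column to be written,
  `17` zero;
* number: `0`, `1` accuracies, `2` zero, `3`, `4` force of a bar, `5` right-hand side, `8` one,
  `9` four; the others hold intermediate results.

Index array `4` holds the ends of the chains; number arrays `4`–`8` hold for every row its number of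
bars, mass, load, scaled right-hand side and scale. -/
def trussProg : Prog :=
  .seq prepare <|
  .seq (.forRange 2 entryBody) <|
  .seq (.forRange 0 closeRow) <|
  .block finish

/-- The memory holds the truss incidence matrix, its right-hand side and the accuracy. -/
structure Output (D : SparseSystem) (c : ℕ → ℝ) (ε : ℝ) (σ : Store) : Prop where
  rows : σ.idx 3 = D.numBars
  cols : σ.idx 4 = D.numJoints * 2
  size : σ.idx 5 = (D.trussEntries D.numBars).length
  tape : Tape σ (D.trussEntries D.numBars)
  rhs : ∀ e < D.numBars, σ.numArr 3 e = trussRhs D c e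
  eps : σ.num 1 = ε

theorem BeforeEntry.runs_entries (h : BeforeEntry D c ε 0 σ) (hrow : ∀ k < D.s, D.row k < D.m) :
    Runs (.forRange 2 entryBody) σ (2 + D.s * 155) (BeforeEntry D c ε D.s) := by
  refine Runs.forRange (T := 153) (BeforeEntry D c ε) h.ready.size h.ready.one (by decide)
    (by decide) (by decide) (fun k τ v hτ => ?_) h
    fun k hk τ _ h7 hτ => hτ.runs_entryBody h7 hk (hrow k hk)
  have hf := agreesOff_setIdx τ 7 v
  exact ⟨hτ.ready.congr hf (by decide), hτ.consts.congr hf (by decide),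
    hτ.chains.congr hf (by decide), hτ.emitted.congr hf (by decide)⟩

theorem BeforeEntry.runs_closeRows (h : BeforeEntry D c ε D.s σ) :
    Runs (.forRange 0 closeRow) σ (2 + D.m * 40) (Emitted D (trussRhs D c) D.numBars) :=
  Runs.forRange (T := 38) (fun k => Emitted D (trussRhs D c) (4 * D.s + k)) h.ready.rows
    h.ready.one (by decide) (by decide) (by decide)
    (fun _ τ v hτ => hτ.congr (agreesOff_setIdx τ 7 v) (by decide))
    h.emitted fun _ hk _ hf h7 hτ => runs_closeRow (h.ready.congr hf (by decide))
      (h.consts.congr hf (by decide)) (h.chains.congr hf (by decide)) h7 hk hτ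

theorem Input.runs_trussProg (h : Input D c ε σ) (hrow : ∀ k < D.s, D.row k < D.m) :
    Runs trussProg σ (22 + 56 * D.m + 167 * D.s) (Output D c ε) := by
  refine Runs.mono (T := 14 + 16 * D.m + 12 * D.s + (2 + D.s * 155 + (2 + D.m * 40 + 4))) ?_
    (by omega) fun τ hτ => hτ
  refine h.runs_prepare.seq fun σ₁ _ h₁ => (h₁.runs_entries hrow).seq fun σ₂ _ h₂ =>
    h₂.runs_closeRows.seq fun σ₃ f₃ h₃ => Runs.block ?_
  have r₃ := h₂.ready.congr f₃ (by decide)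
  have hfoot : σ₃.idx 13 = D.numJoints := (f₃.idx 13 (by decide)).trans h₂.chains.foot
  refine ⟨?_, ?_, ?_, h₃.tape.congr (agreesOff_runBlock finish σ₃) (by decide), h₃.rhs, ?_⟩
  · simp [finish, h₃.count, r₃.zero]
  · simp [finish, hfoot, mul_two]
  · simp [finish, h₃.tape.pos, r₃.zero]
  · simp [finish, r₃.eps, r₃.numZero]

end TrussProg

/-! ### The program that maps solutions -/

/-- Copy every second coordinate. -/
def recoverProg : Prog :=
  .seq (.block [.idxConst 6 1]) <|
  .forRange 1 (.block [.idxAdd 8 7 7, .numLoad 2 3 8, .numStore 2 7 2])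

theorem runs_recoverProg {n : ℕ} {y : ℕ → ℝ} {σ : Store} (hn : σ.idx 1 = n)
    (hy : ∀ j < n, σ.numArr 3 (2 * j) = y j) :
    Runs recoverProg σ (3 + 5 * n) fun τ => ∀ j < n, τ.numArr 2 j = y j := by
  refine Runs.mono (T := 1 + (2 + n * 5)) ?_ (by omega) fun τ hτ => hτ
  refine Runs.seq (Q := (· = σ.setIdx 6 1)) (Runs.block rfl) ?_
  rintro _ - rfl
  refine Runs.forRange (T := 3) (fun k τ => ∀ j < k, τ.numArr 2 j = y j) (by simpa using hn) rfl
    (by decide) (by decide) (by decide) (fun _ _ _ hτ => hτ) (by simp) fun k hk τ hf h7 hτ =>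
      Runs.block ?_
  have h3 : τ.numArr 3 (k + k) = y k := by
    rw [hf.numArr 3 (by decide), ← two_mul]
    exact hy k hk
  simpa [h7, h3] using update_eq_of_lt_succ hτ

/-! ### The reduction -/

/-- The matrices to which the construction applies: all row sums are zero, every row has a non-zero
entry, and non-zero entries have absolute value at least one. -/
def ZeroSumBoundedBelow : MatrixClass := fun _ _ A =>
  (∀ i, ∑ j, A i j = 0) ∧ (∀ i, ∃ j, A i j ≠ 0) ∧ ∀ i j, A i j ≠ 0 → 1 ≤ |A i j|

theorem ZeroSumPowTwo.zeroSumBoundedBelow {m n : ℕ} {A : Matrix (Fin m) (Fin n) ℝ}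
    (hA : ZeroSumPowTwo A) : ZeroSumBoundedBelow A := by
  obtain ⟨Z, rfl, hrow, -, hsum, -⟩ := hA
  simp only [ZeroSumBoundedBelow, Matrix.map_apply, ne_eq, Int.cast_eq_zero]
  exact ⟨fun i => by exact_mod_cast hsum i, hrow,
    fun i j hij => by exact_mod_cast Int.one_le_abs hij⟩

section Magnitude

theorem abs_le_maxAbs {ι : Type} [Finite ι] (v : ι → ℝ) (i : ι) : |v i| ≤ maxAbs v :=
  le_ciSup (f := fun i => |v i|) (Set.finite_range _).bddAbove i

theorem maxAbs_le {ι : Type} {v : ι → ℝ} {M : ℝ} (hM : 0 ≤ M) (h : ∀ i, |v i| ≤ M) :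
    maxAbs v ≤ M := Real.iSup_le h hM

theorem one_div_minNonzeroAbs_le {ι : Type} {v : ι → ℝ} {M : ℝ} (hM : 0 < M)
    (h : ∀ i, v i ≠ 0 → 1 / M ≤ |v i|) : 1 / minNonzeroAbs v ≤ M := by
  rw [minNonzeroAbs]
  obtain hempty | hne := Set.eq_empty_or_nonempty {a | ∃ i, v i ≠ 0 ∧ a = |v i|}
  · rw [hempty, Real.sInf_empty, div_zero]
    exact hM.le
  · have hle : 1 / M ≤ sInf {a | ∃ i, v i ≠ 0 ∧ a = |v i|} := le_csInf hne <| by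
      rintro a ⟨i, hi, rfl⟩
      exact h i hi
    exact (one_div_le hM (hle.trans_lt' (by positivity))).1 hle

theorem one_div_le_abs_of_one_div_minNonzeroAbs_le {ι : Type} [Finite ι] {v : ι → ℝ} {M : ℝ}
    (h : 1 / minNonzeroAbs v ≤ M) {i : ι} (hi : v i ≠ 0) : 1 / M ≤ |v i| := by
  have hfin : {a | ∃ i, v i ≠ 0 ∧ a = |v i|}.Finite :=
    (Set.finite_range fun i => |v i|).subset (by rintro a ⟨i, -, rfl⟩; exact ⟨i, rfl⟩)
  have hmem : |v i| ∈ {a | ∃ i, v i ≠ 0 ∧ a = |v i|} := ⟨i, hi, rfl⟩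
  have hpos : 0 < minNonzeroAbs v := by
    obtain ⟨j, hj, hja⟩ := Set.Nonempty.csInf_mem ⟨_, hmem⟩ hfin
    rw [minNonzeroAbs, hja]
    exact abs_pos.2 hj
  exact ((one_div_le hpos (h.trans_lt' (by positivity))).1 h).trans
    (csInf_le hfin.bddBelow hmem)

/-- The second coordinate of the sparse parameter complexity. -/
def magnitude {m n : ℕ} (A : Matrix (Fin m) (Fin n) ℝ) (c : EuclideanSpace ℝ (Fin m)) : ℝ :=
  max (max (maxAbs fun p : Fin m × Fin n => A p.1 p.2) (maxAbs fun i => c i))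
    (max (1 / minNonzeroAbs fun p : Fin m × Fin n => A p.1 p.2) (1 / minNonzeroAbs fun i => c i))

variable {m n : ℕ} {A : Matrix (Fin m) (Fin n) ℝ} {c : EuclideanSpace ℝ (Fin m)}

theorem abs_le_magnitude (i : Fin m) (j : Fin n) : |A i j| ≤ magnitude A c :=
  (abs_le_maxAbs (fun p : Fin m × Fin n => A p.1 p.2) (i, j)).trans
    ((le_max_left _ _).trans (le_max_left _ _))

theorem abs_rhs_le_magnitude (i : Fin m) : |c i| ≤ magnitude A c :=
  (abs_le_maxAbs (fun i => c i) i).trans ((le_max_right _ _).trans (le_max_left _ _))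

theorem one_div_magnitude_le_abs_rhs {i : Fin m} (hi : c i ≠ 0) : 1 / magnitude A c ≤ |c i| :=
  one_div_le_abs_of_one_div_minNonzeroAbs_le (v := fun i => c i)
    ((le_max_right _ _).trans (le_max_right _ _)) hi

theorem magnitude_le {M : ℝ} (hM : 0 < M) (hA : ∀ i j, |A i j| ≤ M)
    (hA' : ∀ i j, A i j ≠ 0 → 1 / M ≤ |A i j|) (hc : ∀ i, |c i| ≤ M)
    (hc' : ∀ i, c i ≠ 0 → 1 / M ≤ |c i|) : magnitude A c ≤ M :=
  max_le (max_le (maxAbs_le hM.le fun p => hA p.1 p.2) (maxAbs_le hM.le hc))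
    (max_le (one_div_minNonzeroAbs_le hM fun p => hA' p.1 p.2) (one_div_minNonzeroAbs_le hM hc'))

end Magnitude

section Entries

variable {m n : ℕ} {A : Matrix (Fin m) (Fin n) ℝ}

theorem mem_entries {p : Fin m × Fin n} : p ∈ entries A ↔ A p.1 p.2 ≠ 0 := by
  obtain ⟨a, b⟩ := p
  simp [entries, List.mem_product]

theorem nodup_entries (A : Matrix (Fin m) (Fin n) ℝ) : (entries A).Nodup :=
  ((List.nodup_finRange m).product (List.nodup_finRange n)).filter _

theorem sum_entries {f : Fin m × Fin n → ℝ} (hf : ∀ p, A p.1 p.2 = 0 → f p = 0) :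
    ∑ k : Fin (entries A).length, f (entries A)[k.1] = ∑ i, ∑ j, f (i, j) := by
  classical
  rw [Fin.sum_univ_fun_getElem, ← List.sum_toFinset _ (nodup_entries A), ← Fintype.sum_prod_type]
  refine sum_subset (subset_univ _) fun p _ hp => hf p ?_
  by_contra h
  exact hp (List.mem_toFinset.2 (mem_entries.2 h))

end Entries

namespace SparseSystem

/-- `D` lists the non-zero entries of `A` in row-major order. -/
structure Lists (D : SparseSystem) (A : Matrix (Fin D.m) (Fin D.n) ℝ) : Prop where
  s_eq : D.s = (entries A).length
  row : ∀ (k : ℕ) (hk : k < (entries A).length), D.row k = (entries A)[k].1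
  col : ∀ (k : ℕ) (hk : k < (entries A).length), D.col k = (entries A)[k].2
  val : ∀ (k : ℕ) (hk : k < (entries A).length),
    D.val k = A (entries A)[k].1 (entries A)[k].2

/-- The sparse system listing the non-zero entries of `A`, padded by zeros. -/
def ofMatrix {m n : ℕ} (A : Matrix (Fin m) (Fin n) ℝ) : SparseSystem where
  m := m
  n := n
  s := (entries A).length
  row k := if h : k < (entries A).length then (entries A)[k].1 else 0
  col k := if h : k < (entries A).length then (entries A)[k].2 else 0
  val k := if h : k < (entries A).length then A (entries A)[k].1 (entries A)[k].2 else 0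

theorem lists_ofMatrix {m n : ℕ} (A : Matrix (Fin m) (Fin n) ℝ) : (ofMatrix A).Lists A :=
  ⟨rfl, fun _ hk => dif_pos hk, fun _ hk => dif_pos hk, fun _ hk => dif_pos hk⟩

variable {D : SparseSystem} {A : Matrix (Fin D.m) (Fin D.n) ℝ}

namespace Lists

variable (hL : D.Lists A)
include hL

theorem rowSum_eq {f : Fin D.n → ℝ} {g : ℕ → ℝ}
    (hg : ∀ (k : ℕ) (hk : k < (entries A).length),
      g k = A (entries A)[k].1 (entries A)[k].2 * f (entries A)[k].2) (i : Fin D.m) :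
    D.rowSum g D.s i = ∑ j, A i j * f j := by
  calc D.rowSum g D.s i
      = ∑ k : Fin (entries A).length, if D.row k = i then g k else 0 := by
        rw [rowSum, sum_filter, hL.s_eq]
        exact (Fin.sum_univ_eq_sum_range (fun k => if D.row k = i then g k else 0) _).symm
    _ = ∑ k : Fin (entries A).length, (fun p : Fin D.m × Fin D.n =>
          if p.1 = i then A p.1 p.2 * f p.2 else 0) (entries A)[k.1] := by
        refine sum_congr rfl fun k _ => ?_
        simp only [hL.row k k.2, Fin.val_inj, hg k k.2]
    _ = ∑ i', ∑ j, if i' = i then A i' j * f j else 0 :=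
        sum_entries (f := fun p => if p.1 = i then A p.1 p.2 * f p.2 else 0)
          fun p hp => by simp only [hp, zero_mul, ite_self]
    _ = ∑ j, A i j * f j := by
        rw [sum_comm]
        simp only [sum_ite_eq', mem_univ, if_true]

theorem represents : D.Represents A := fun u i => by
  rw [act_apply, hL.rowSum_eq (f := u) fun k hk => ?_]
  rw [hL.val k hk, hL.col k hk, coord_of_lt u (entries A)[k].2.2]

theorem exists_val_eq {k : ℕ} (hk : k < D.s) : ∃ i j, A i j ≠ 0 ∧ D.val k = A i j :=
  have hk' := hL.s_eq ▸ hk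
  ⟨_, _, mem_entries.1 (List.getElem_mem hk'), hL.val k hk'⟩

theorem isBalanced (hA : ZeroSumBoundedBelow A) : D.IsBalanced where
  row_lt k hk := hL.row k (hL.s_eq ▸ hk) ▸ Fin.is_lt _
  col_lt k hk := hL.col k (hL.s_eq ▸ hk) ▸ Fin.is_lt _
  one_le_abs_val k hk := by
    obtain ⟨i, j, hij, h⟩ := hL.exists_val_eq hk
    exact h ▸ hA.2.2 i j hij
  sum_val_eq_zero i hi := by
    refine (hL.rowSum_eq (f := fun _ => 1) (fun k hk => ?_) ⟨i, hi⟩).trans ?_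
    · rw [hL.val k hk, mul_one]
    · simpa only [mul_one] using hA.1 ⟨i, hi⟩
  exists_row_eq i hi := by
    obtain ⟨j, hj⟩ := hA.2.1 ⟨i, hi⟩
    obtain ⟨k, hk, hkj⟩ :=
      List.mem_iff_getElem.1 (mem_entries.2 hj : ((⟨i, hi⟩, j) : Fin D.m × Fin D.n) ∈ entries A)
    exact ⟨k, hL.s_eq ▸ hk, by rw [hL.row k hk, hkj]⟩

theorem abs_val_le_magnitude (c : EuclideanSpace ℝ (Fin D.m)) :
    ∀ k < D.s, |D.val k| ≤ magnitude A c := fun k hk => by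
  obtain ⟨i, j, -, h⟩ := hL.exists_val_eq hk
  exact h ▸ abs_le_magnitude i j

end Lists

end SparseSystem

section Blowup

variable {C : ℝ}

theorem monotoneOn_blowup (hC : 0 ≤ C) : MonotoneOn (blowup C) (Set.Ici (1, 1, 1, 1)) := by
  rintro ⟨s, U, K, e⟩ ⟨hs, hU, hK, he⟩ ⟨s', U', K', e'⟩ - ⟨hs', hU', hK', he'⟩
  dsimp only at hs hU hK he hs' hU' hK' he'
  have hlog : 0 ≤ Real.log (s * U) := Real.log_nonneg (one_le_mul_of_one_le_of_one_le hs hU)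
  have hU₀ : 0 ≤ U := one_pos.le.trans hU
  have hU'₀ : 0 ≤ U' := hU₀.trans hU'
  have hs₀ : 0 ≤ s := one_pos.le.trans hs
  have hs'₀ : 0 ≤ s' := hs₀.trans hs'
  have hK₀ : 0 ≤ K := one_pos.le.trans hK
  have hK'₀ : 0 ≤ K' := hK₀.trans hK'
  refine ⟨?_, ?_, ?_, ?_⟩ <;> dsimp only [blowup] <;> gcongr

theorem mapsTo_blowup (hC : 0 ≤ C) :
    Set.MapsTo (blowup C) (Set.Ici (1, 1, 1, 1)) (Set.Ici (0, 0, 0, 0)) := by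
  rintro ⟨s, U, K, e⟩ ⟨hs, hU, hK, he⟩
  dsimp only at hs hU hK he
  have hlog : 0 ≤ Real.log (s * U) := Real.log_nonneg (one_le_mul_of_one_le_of_one_le hs hU)
  refine ⟨?_, ?_, ?_, ?_⟩ <;> dsimp only [blowup] <;> positivity

theorem le_blowup (hC : 0 ≤ C) {s U K e : ℝ} (hs : 2 ≤ s) (hU : 1 ≤ U) (hK : 0 ≤ K) (he : 0 ≤ e) :
    (C / 2 * s, C / 2 * (s * √s * U), C / 4 * (K * s ^ 4 * U ^ 2), C * e) ≤
      blowup C (s, U, K, e) := by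
  have hlog : 1 / 2 ≤ Real.log (s * U) := by
    have hle : Real.log 2 ≤ Real.log (s * U) := Real.log_le_log two_pos (by nlinarith)
    linarith [Real.log_two_gt_d9]
  have hsqrt : 1 / 2 ≤ Real.log (s * U) ^ (1 / 2 : ℝ) := by
    rw [← Real.sqrt_eq_rpow]
    exact Real.le_sqrt_of_sq_le (by linarith)
  have hrpow : s ^ (3 / 2 : ℝ) = s * √s := by
    rw [Real.sqrt_eq_rpow, ← Real.rpow_one_add' (by positivity) (by norm_num)]
    norm_num
  have hsU : 1 ≤ s * U ^ 2 := one_le_mul_of_one_le_of_one_le (by linarith) (one_le_pow₀ hU)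
  refine ⟨?_, ?_, ?_, ?_⟩ <;> dsimp only [blowup]
  · calc C / 2 * s = C * (s * (1 / 2)) := by ring
      _ ≤ C * (s * Real.log (s * U)) := by gcongr
  · calc C / 2 * (s * √s * U) = C * (s * √s * U * (1 / 2)) := by ring
      _ ≤ C * (s ^ (3 / 2 : ℝ) * U * Real.log (s * U) ^ (1 / 2 : ℝ)) := by
        rw [hrpow]
        gcongr
  · calc C / 4 * (K * s ^ 4 * U ^ 2) = C * (K * s ^ 4 * U ^ 2 * (1 / 2) ^ 2) := by ring
      _ ≤ C * (K * s ^ 4 * U ^ 2 * Real.log (s * U) ^ 2) := by gcongr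
  · exact mul_le_mul_of_nonneg_left (le_mul_of_one_le_left he hsU) hC

end Blowup

namespace SparseSystem

variable {D : SparseSystem}

section Complexity

variable (hD : D.IsBalanced) (hs : 1 ≤ D.s) {U : ℝ} {c : EuclideanSpace ℝ (Fin D.m)}
include hD

theorem abs_act_spread_le (hc : ∀ i, |c i| ≤ U) (e : Fin D.numBars) : |act D.spread c e| ≤ U := by
  rw [act_spread hD, abs_div, abs_of_pos (scale_pos _), coord_of_lt _ (hD.owner_lt e.2)]
  exact (div_le_self (abs_nonneg _) (one_le_scale _)).trans (hc _)

include hs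

theorem le_abs_act_spread (hc : ∀ i, c i ≠ 0 → 1 / U ≤ |c i|) {e : Fin D.numBars}
    (he : act D.spread c e ≠ 0) : 1 / (5 / 2 * √D.s * U) ≤ |act D.spread c e| := by
  rw [act_spread hD, coord_of_lt _ (hD.owner_lt e.2)] at he ⊢
  rw [abs_div, abs_of_pos (scale_pos _)]
  calc 1 / (5 / 2 * √D.s * U) = 1 / U / (5 / 2 * √D.s) := by rw [div_div, mul_comm U]
    _ ≤ _ := div_le_div₀ (abs_nonneg _) (hc _ (div_ne_zero_iff.1 he).1) (scale_pos _)
      (scale_le hs _)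

theorem magnitude_truss_le (hU : 1 ≤ U) (hval : ∀ k < D.s, |D.val k| ≤ U) (hc : ∀ i, |c i| ≤ U)
    (hc' : ∀ i, c i ≠ 0 → 1 / U ≤ |c i|) :
    magnitude D.truss (act D.spread c) ≤ 5 * (D.s * √D.s) * U := by
  have hs' : (1 : ℝ) ≤ D.s := by exact_mod_cast hs
  have hsqrt : 1 ≤ √(D.s : ℝ) := Real.one_le_sqrt.2 hs'
  have hle : √(D.s : ℝ) ≤ D.s * √D.s := le_mul_of_one_le_left (Real.sqrt_nonneg _) hs'
  have hM : U ≤ 5 * (D.s * √D.s) * U := le_mul_of_one_le_left (by linarith) (by linarith)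
  refine magnitude_le (by positivity) (abs_truss_le hD hval hs) (fun e j hne => ?_)
    (fun e => (abs_act_spread_le hD hc e).trans hM)
    fun e he => (one_div_le_one_div_of_le (by positivity) ?_).trans (le_abs_act_spread hD hs hc' he)
  · refine (one_div_le_one_div_of_le two_pos ?_).trans (half_le_abs_truss hD hval hne)
    nlinarith
  · gcongr
    linarith

end Complexity

section Reduction

variable (hD : D.IsBalanced) {A : Matrix (Fin D.m) (Fin D.n) ℝ} {c : EuclideanSpace ℝ (Fin D.m)}
  {ε : ℝ}
include hD

theorem isInstance_truss (hA : IsInstance A c ε) (hs : D.s = nnz A) (hs₀ : 1 ≤ D.s) :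
    IsInstance D.truss (act D.spread c) ε := by
  obtain ⟨-, hmn, hε⟩ := hA
  have hm : D.m ≤ D.s := hs ▸ (le_max_left _ _).trans hmn
  have hn : D.n ≤ D.s := hs ▸ (le_max_right _ _).trans hmn
  have hnnz := hD.nnz_truss
  refine ⟨fun h => ?_, ?_, hε⟩
  · simp only [nnz, h, Matrix.zero_apply, ne_eq, not_true_eq_false, filter_false, card_empty]
      at hnnz
    omega
  · rw [hnnz, numBars, numJoints]
    omega

theorem complexity_truss_le (hA : IsInstance A c ε) (hL : D.Lists A) (hm : 0 < D.m) :
    complexity D.truss (act D.spread c) ε ≤ blowup 24000 (complexity A c ε) := by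
  have hnnz : D.s = nnz A := hL.s_eq.trans (length_entries A)
  have hms : D.m ≤ D.s := hnnz ▸ (le_max_left _ _).trans hA.2.1
  have hns : D.n ≤ D.s := hnnz ▸ (le_max_right _ _).trans hA.2.1
  have hs : 2 ≤ D.s := (hD.two_le_rank hm).trans (rank_le le_rfl _)
  have hs₁ : 1 ≤ D.s := one_le_two.trans hs
  obtain ⟨i, j, -, hij⟩ := hL.exists_val_eq hs₁
  have hone : 1 ≤ |A i j| := hij ▸ hD.one_le_abs_val 0 hs₁
  have hU : 1 ≤ magnitude A c := hone.trans (abs_le_magnitude i j)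
  have hval := hL.abs_val_le_magnitude c
  have hmagnitude : magnitude D.truss (act D.spread c) ≤ 5 * (D.s * √D.s) * magnitude A c :=
    magnitude_truss_le hD hs₁ hU hval abs_rhs_le_magnitude fun _ => one_div_magnitude_le_abs_rhs
  have hcond : condNumber D.truss ≤ 6000 * (condNumber A * D.s ^ 4 * magnitude A c ^ 2) :=
    condNumber_truss_le hD hval hL.represents hs₁ hms hns hU
      (hone.trans (abs_le_sigmaMax i j)) hA.1 (isInstance_truss hD hA hnnz hs₁).1
  have hK : 0 ≤ condNumber A := one_pos.le.trans (one_le_condNumber hA.1)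
  have hε : 0 < ε⁻¹ := inv_pos.2 hA.2.2.1
  have heq : complexity A c ε = ((D.s : ℝ), magnitude A c, condNumber A, ε⁻¹) := by
    rw [hnnz]
    rfl
  rw [heq]
  refine le_trans ⟨?_, hmagnitude.trans ?_, hcond.trans_eq (by norm_num), ?_⟩
    (le_blowup (by norm_num) (by exact_mod_cast hs) hU hK hε.le)
  · have hms' : (D.m : ℝ) ≤ D.s := by exact_mod_cast hms
    simp only [complexity, hD.nnz_truss, Nat.cast_add, Nat.cast_mul, Nat.cast_ofNat]
    linarith
  · rw [mul_assoc]
    exact mul_le_mul_of_nonneg_right (by norm_num) (by positivity)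
  · exact le_mul_of_one_le_left hε.le (by norm_num)

theorem mapsInstance_trussProg (hA : IsInstance A c ε) (hL : D.Lists A) (hs : 1 ≤ D.s) :
    MapsInstance trussProg (245 * nnz A) A c ε D.truss (act D.spread c) ε := by
  rintro σ ⟨hrows, hcols, hsize, hentries⟩ hc hε
  have hnnz : D.s = nnz A := hL.s_eq.trans (length_entries A)
  have hm : D.m ≤ D.s := hnnz ▸ (le_max_left _ _).trans hA.2.1
  have hin : Input D (coord c) ε σ :=
    { rows := hrows
      cols := hcols
      size := hsize.trans hnnz.symm
      eps := hε
      row := fun k hk => by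
        rw [hL.s_eq] at hk
        exact (hentries k hk).1.trans (hL.row k hk).symm
      col := fun k hk => by
        rw [hL.s_eq] at hk
        exact (hentries k hk).2.1.trans (hL.col k hk).symm
      val := fun k hk => by
        rw [hL.s_eq] at hk
        exact (hentries k hk).2.2.trans (hL.val k hk).symm
      rhs := fun i hi => (hc ⟨i, hi⟩).trans (coord_of_lt c hi).symm }
  obtain ⟨t, τ, ht, hexec, hτ⟩ := hin.runs_trussProg hD.row_lt
  refine ⟨t, τ, by omega, hexec, ⟨hτ.rows, hτ.cols, hτ.size.trans hD.nnz_truss_eq_length.symm,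
    fun k hk => ?_⟩, fun e => (hτ.rhs e e.2).trans (act_spread hD c e).symm, hτ.eps⟩
  have hk' : k < (D.trussEntries D.numBars).length := by
    rwa [← hD.map_entries_truss, List.length_map]
  have hget : (D.trussEntries D.numBars)[k] = (((entries D.truss)[k].1 : ℕ),
      ((entries D.truss)[k].2 : ℕ), D.truss (entries D.truss)[k].1 (entries D.truss)[k].2) := by
    simp only [← hD.map_entries_truss, List.getElem_map]
  exact ⟨by rw [hτ.tape.row k hk', hget], by rw [hτ.tape.col k hk', hget],
    by rw [hτ.tape.val k hk', hget]⟩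

omit hD in
theorem mapsSolution_recoverProg (hn : D.n ≤ nnz A) (hs : 1 ≤ nnz A)
    (y : EuclideanSpace ℝ (Fin (D.numJoints * 2))) :
    MapsSolution recoverProg (245 * nnz A) A D.truss y (recover y) := by
  rintro σ ⟨-, hcols, -⟩ - hy
  obtain ⟨t, τ, ht, hexec, hτ⟩ :=
    runs_recoverProg (y := fun j => displacement y 0 (.column j)) hcols fun j hj => by
      have hlt : 2 * j < D.numJoints * 2 := by rw [numJoints]; omega
      exact (hy ⟨2 * j, hlt⟩).trans (coord_of_lt y hlt).symm
  exact ⟨t, τ, by omega, hexec, fun j => hτ j j.2⟩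

theorem isSolution_recover (hA : IsInstance A c ε) (hL : D.Lists A) (hs : 1 ≤ D.s)
    {y : EuclideanSpace ℝ (Fin (D.numJoints * 2))}
    (hy : IsSolution D.truss (act D.spread c) ε y) : IsSolution A c ε (recover y) := by
  have hnnz : D.s = nnz A := hL.s_eq.trans (length_entries A)
  refine isSolution_of_isSolution_act spread_transpose_mul_spread
    (act_spread_transpose_act_truss hD hL.represents) (fun w u h => ?_) hy
  exact (exists_act_truss_eq hD
    (fun k hk => (hL.abs_val_le_magnitude c k hk).trans (le_max_right 1 _)) hL.represents hs
    (hnnz ▸ (le_max_left _ _).trans hA.2.1) (hnnz ▸ (le_max_right _ _).trans hA.2.1)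
    (le_max_left _ _) h).imp fun _ h => h.1

end Reduction

end SparseSystem

theorem EfficientlyReducible.mono_left {M₁ M₁' M₂ : MatrixClass}
    {f : ℝ × ℝ × ℝ × ℝ → ℝ × ℝ × ℝ × ℝ} (h : EfficientlyReducible M₁ M₂ f)
    (hM : ∀ ⦃m n : ℕ⦄ (A : Matrix (Fin m) (Fin n) ℝ), M₁' A → M₁ A) :
    EfficientlyReducible M₁' M₂ f := by
  obtain ⟨hmono, hmaps, P, Q, T, hred⟩ := h
  exact ⟨hmono, hmaps, P, Q, T, fun m n A c ε hA => hred m n A c ε (hM A hA)⟩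

end TrussReduction

end

open TrussReduction SparseSystem in
theorem mainTheorem8_general :
    ∃ C : ℝ, 0 < C ∧ EfficientlyReducible ZeroSumBoundedBelow Truss2D (blowup C) := by
  refine ⟨24000, by norm_num, monotoneOn_blowup (by norm_num), mapsTo_blowup (by norm_num),
    trussProg, recoverProg, 245, fun m n A c ε hA hI => ?_⟩
  have hL : (ofMatrix A).Lists A := lists_ofMatrix A
  have hD : (ofMatrix A).IsBalanced := hL.isBalanced hA
  have hnnz : (ofMatrix A).s = nnz A := length_entries A
  obtain ⟨i, j, hij⟩ : ∃ i j, A i j ≠ 0 := by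
    by_contra! h
    exact hI.1 (Matrix.ext h)
  have hs : 1 ≤ (ofMatrix A).s := List.length_pos_of_mem (mem_entries.2 hij : (i, j) ∈ entries A)
  exact ⟨_, _, (ofMatrix A).truss, act (ofMatrix A).spread c, ε, hD.truss2D_truss,
    isInstance_truss hD hI hnnz hs, mapsInstance_trussProg hD hI hL hs,
    complexity_truss_le hD hI hL i.pos, fun y => ⟨recover y,
      mapsSolution_recoverProg ((le_max_right _ _).trans hI.2.1) (hnnz ▸ hs) y,
      isSolution_recover hD hI hL hs⟩⟩

/-- There is a constant for the `O`-notation such that zero-sum power-of-two integer matrices are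
efficiently reducible, with the corresponding parameter blow-up, to 2D truss incidence matrices. -/
theorem mainTheorem8 :
    ∃ C : ℝ, 0 < C ∧
      TrussReduction.EfficientlyReducible TrussReduction.ZeroSumPowTwo TrussReduction.Truss2D
        (TrussReduction.blowup C) :=
  mainTheorem8_general.imp fun _ h =>
    ⟨h.1, h.2.mono_left fun _ _ _ => TrussReduction.ZeroSumPowTwo.zeroSumBoundedBelow⟩
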